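/- Let $(M,g)$ be a closed (compact, without boundary) smooth Riemannian manifold of dimension $n\ge 3$, and let $2^*=\frac{2n}{n-2}$. Let $[g]=\{w^{\frac{4}{n-2}}g : w\in C^\infty(M),\ w>0\}$ be the conformal class of $g$. For $h\in[g]$ let $R_h$ be the scalar curvature and $dV_h$ the Riemannian measure of $h$, let $H^1(M,h)$ be the Sobolev space of functions which are in $L^2$ together with their first derivatives (the completion of $C^\infty(M)$ for the norm $(\|u\|_{L^2}^2+\|\nabla_h u\|_{L^2}^2)^{1/2}$), let $H^1_+(M,h)=\{u\in H^1(M,h): u>0 \text{ a.e.}\}$, and put $$\langle u,v\rangle_h=4\,\frac{n-1}{n-2}\int_M\nabla_hu\cdot\nabla_hv\,dV_h+\int_MR_h\,uv\,dV_h .$$ For $1\le p\le 2^*-1$ and $u\in H^1_+(M,h)$ let $$J^h_p(u)=\frac{\langle u,u\rangle_h}{\|u\|^2_{L^{p+1}(M,h)}},\qquad I^h_p(u)=\frac{\langle u,u\rangle_h}{\|T_h(u)\|^2_{L^{p+1}(M,h)}},$$ where $T_h(u)$ denotes the unique minimizer of $\langle v,v\rangle_h$ among all $v\in H^1_+(M,h)$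 with $v\ge u$ a.e. Let $\mathcal Y^p(M,h)=\inf_{H^1_+(M,h)}J^h_p$ and $\mathcal Y^p_{oc}(M,h)=\inf_{H^1_+(M,h)}I^h_p$, and let $\mathcal Y(M,[g])=\inf_{u\in H^1_+(M,g)}J^g_{2^*-1}(u)$ be the Yamabe invariant. Assume $\mathcal Y(M,[g])>0$, $h\in[g]$ and $1\le p\le 2^*-1$. Then $T_h(u)$ is well defined for every $u\in H^1_+(M,h)$ (the minimizer exists and is unique), $J^h_p$ and $I^h_p$ are bounded below on $H^1_+(M,h)$, and for every $u\in H^1_+(M,h)$ $$J^h_p(u)=\mathcal Y^p(M,h)\iff I^h_p(u)=\mathcal Y^p_{oc}(M,h).$$ Moreover, each of these two equalities implies $T_h(u)=u$. -/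

import Mathlib

set_option maxSynthPendingDepth 3

open Set Filter Topology MeasureTheory
open scoped Manifold ContDiff ENNReal

namespace Yamabe

noncomputable section

/-- The model space `ℝⁿ` with its Euclidean structure. -/
abbrev E (n : ℕ) : Type := EuclideanSpace ℝ (Fin n)

/-- Smooth Riemannian metrics on the `n`-dimensional smooth manifold `M`. -/
abbrev Metric (n : ℕ) (M : Type*) [TopologicalSpace M] [ChartedSpace (E n) M]
    [IsManifold (𝓡 n) ∞ M] : Type _ :=
  Bundle.ContMDiffRiemannianMetric (𝓡 n) ∞ (E n) (fun x : M => TangentSpace (𝓡 n) x)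

/-! ### Curvature of a metric on an open subset of `ℝⁿ` -/

/-- The Gram matrix `G_{ij} = G(e_i, e_j)` of a bilinear form in the standard basis. -/
def gram {n : ℕ} (B : E n →L[ℝ] E n →L[ℝ] ℝ) : Matrix (Fin n) (Fin n) ℝ :=
  Matrix.of fun i j => B (EuclideanSpace.single i 1) (EuclideanSpace.single j 1)

section Coordinates

variable {V : Type*} [NormedAddCommGroup V] [NormedSpace ℝ V]

/-- The Christoffel symbols of the first kind,
`(u, v, z) ↦ ½ (∂_u G(v, z) + ∂_v G(u, z) - ∂_z G(u, v))`. -/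
def christoffelFirst (G : V → V →L[ℝ] V →L[ℝ] ℝ) (y : V) : V →L[ℝ] V →L[ℝ] V →L[ℝ] ℝ :=
  (1 / 2 : ℝ) • (fderiv ℝ G y + (fderiv ℝ G y).flip -
    (ContinuousLinearMap.flipₗᵢ ℝ V V ℝ).toContinuousLinearEquiv.toContinuousLinearMap ∘L
      (fderiv ℝ G y).flip)

/-- The Christoffel symbols `Γ(u, v)`, obtained from those of the first kind by raising the last
index: `G(Γ(u, v), z) = ½ (∂_u G(v, z) + ∂_v G(u, z) - ∂_z G(u, v))`. -/
def christoffel (G : V → V →L[ℝ] V →L[ℝ] ℝ) (y : V) : V →L[ℝ] V →L[ℝ] V :=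
  (ContinuousLinearMap.compL ℝ V (V →L[ℝ] ℝ) V (G y).inverse) ∘L christoffelFirst G y

/-- The Riemann curvature tensor
`R(u, v)z = (∂_u Γ)(v, z) - (∂_v Γ)(u, z) + Γ(u, Γ(v, z)) - Γ(v, Γ(u, z))`. -/
def riemann (G : V → V →L[ℝ] V →L[ℝ] ℝ) (y u v z : V) : V :=
  fderiv ℝ (christoffel G) y u v z - fderiv ℝ (christoffel G) y v u z
    + christoffel G y u (christoffel G y v z) - christoffel G y v (christoffel G y u z)

end Coordinates

/-- The Ricci tensor `Ric(v, z) = trace (u ↦ R(u, v)z)`. -/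
def ricci {n : ℕ} (G : E n → E n →L[ℝ] E n →L[ℝ] ℝ) (y v z : E n) : ℝ :=
  ∑ i, (riemann G y (EuclideanSpace.single i 1) v z) i

/-- The scalar curvature `∑ G^{jk} Ric_{jk}` of a metric in coordinates. -/
def scalarCurvatureCoord {n : ℕ} (G : E n → E n →L[ℝ] E n →L[ℝ] ℝ) (y : E n) : ℝ :=
  ∑ j, ∑ k, (gram (G y))⁻¹ j k *
    ricci G y (EuclideanSpace.single j 1) (EuclideanSpace.single k 1)

section Manifold

variable {n : ℕ} {M : Type*} [TopologicalSpace M] [ChartedSpace (E n) M] [IsManifold (𝓡 n) ∞ M]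

/-! ### Curvature, volume and gradients on a Riemannian manifold -/

/-- The metric `g` in the preferred chart around `x`: its pullback under the inverse chart `ψ`,
`(u, v) ↦ g_{ψ(y)} (dψ_y(u), dψ_y(v))`. -/
def chartMetric (g : Metric n M) (x : M) (y : E n) : E n →L[ℝ] E n →L[ℝ] ℝ :=
  let ψ : E n → M := (extChartAt (𝓡 n) x).symm
  let B : E n →L[ℝ] E n →L[ℝ] ℝ := g.inner (ψ y)
  let D : E n →L[ℝ] E n := mfderiv 𝓘(ℝ, E n) (𝓡 n) ψ y
  B.bilinearComp D D

/-- The scalar curvature `R_g` at `x`, computed in the preferred chart around `x`. -/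
def scalarCurvature (g : Metric n M) (x : M) : ℝ :=
  scalarCurvatureCoord (chartMetric g x) (extChartAt (𝓡 n) x x)

/-- The gradient `∇_g f` of a differentiable function: `g(∇_g f, v) = df(v)`. -/
def smoothGrad (g : Metric n M) (f : M → ℝ) (x : M) : TangentSpace (𝓡 n) x :=
  (g.inner x).inverse (mfderiv (𝓡 n) 𝓘(ℝ, ℝ) f x : TangentSpace (𝓡 n) x →L[ℝ] ℝ)

variable [MeasurableSpace M]

/-- The measure `√(det g_{ij}) dy¹⋯dyⁿ` on the domain of the preferred chart around `x`,
as a measure on `M` that vanishes outside this domain. -/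
def chartVolume (g : Metric n M) (x : M) : Measure M :=
  ((volume.withDensity fun y => ENNReal.ofReal (√(gram (chartMetric g x y)).det)).restrict
    (extChartAt (𝓡 n) x).target).map (extChartAt (𝓡 n) x).symm

/-- The Riemannian measure `dV_g`. The measures `√(det g_{ij}) dy` of two charts agree on the
overlap of the chart domains; their supremum is the measure on `M` which restricts to
`√(det g_{ij}) dy` on every chart domain. -/
def vol (g : Metric n M) : Measure M := ⨆ x : M, chartVolume g x

/-! ### The Sobolev space `H¹` -/

/-- `u` belongs to `H¹(M, g)` and has the gradient `X`. As usual on a closed manifold, `H¹(M, g)` is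
the completion of `C^∞(M)` for the norm `(‖u‖²_{L²} + ‖∇u‖²_{L²})^{1/2}`, realized in `L²(M, g)`:
`u` is the `L²`-limit of smooth functions whose gradients converge in `L²` to the vector field `X`.
The field `measurable` says that the vector field `X` is measurable. -/
structure HasSobolevGrad (g : Metric n M) (u : M → ℝ) (X : ∀ x : M, TangentSpace (𝓡 n) x) :
    Prop where
  memLp : MemLp u 2 (vol g)
  measurable : ∀ f : C^∞⟮𝓡 n, M; ℝ⟯,
    AEMeasurable (fun x => (mfderiv (𝓡 n) 𝓘(ℝ, ℝ) f x (X x) : ℝ)) (vol g)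
  approx : ∃ f : ℕ → C^∞⟮𝓡 n, M; ℝ⟯,
    Tendsto (fun k => eLpNorm (fun x => f k x - u x) 2 (vol g)) atTop (𝓝 0) ∧
    Tendsto (fun k => ∫⁻ x, ENNReal.ofReal
      (g.inner x (smoothGrad g (f k) x - X x) (smoothGrad g (f k) x - X x)) ∂(vol g))
      atTop (𝓝 0)

/-- The Sobolev space `H¹(M, g)`, as a set of elements of `L²(M, g)`. -/
def H1 (g : Metric n M) : Set (Lp ℝ 2 (vol g)) :=
  {u | ∃ X : ∀ x : M, TangentSpace (𝓡 n) x, HasSobolevGrad g u X}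

/-- `H¹₊(M, g) = {u ∈ H¹(M, g) : u > 0}`, the inequality holding almost everywhere. -/
def H1Plus (g : Metric n M) : Set (Lp ℝ 2 (vol g)) :=
  {u | u ∈ H1 g ∧ ∀ᵐ x ∂(vol g), 0 < u x}

open Classical in
/-- The gradient `∇_g u` of `u ∈ H¹(M, g)` (unique up to null sets). -/
def grad (g : Metric n M) (u : Lp ℝ 2 (vol g)) : ∀ x : M, TangentSpace (𝓡 n) x :=
  if hu : ∃ X : ∀ x : M, TangentSpace (𝓡 n) x, HasSobolevGrad g u X then hu.choose else 0

/-! ### The Yamabe functional, the obstacle problem and the optimal control functional -/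

/-- The form `⟨u, v⟩_g = 4 (n-1)/(n-2) ∫ ∇_g u · ∇_g v dV_g + ∫ R_g u v dV_g`. -/
def form (g : Metric n M) (u v : Lp ℝ 2 (vol g)) : ℝ :=
  4 * (((n : ℝ) - 1) / ((n : ℝ) - 2)) * (∫ x, g.inner x (grad g u x) (grad g v x) ∂(vol g))
    + ∫ x, scalarCurvature g x * u x * v x ∂(vol g)

/-- The norm of `L^q(M, g)` for a real exponent `q`. -/
def normL (g : Metric n M) (q : ℝ) (u : Lp ℝ 2 (vol g)) : ℝ :=
  (eLpNorm u (ENNReal.ofReal q) (vol g)).toReal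

/-- The critical Sobolev exponent `2* = 2n/(n-2)`. -/
def twoStar (n : ℕ) : ℝ := 2 * (n : ℝ) / ((n : ℝ) - 2)

/-- `J_p^g(u) = ⟨u, u⟩_g / ‖u‖²_{L^{p+1}}`; the Yamabe functional is the case `p = 2* - 1`. -/
def J (g : Metric n M) (p : ℝ) (u : Lp ℝ 2 (vol g)) : ℝ :=
  form g u u / normL g (p + 1) u ^ 2

/-- `𝒴^p(M, g) = inf J_p^g` over `H¹₊(M, g)`. -/
def Y (g : Metric n M) (p : ℝ) : ℝ := sInf (J g p '' H1Plus g)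

/-- The Yamabe invariant `𝒴(M, [g])`, the infimum of the Yamabe functional over `H¹₊(M, g)`. -/
def yamabeInvariant (g : Metric n M) : ℝ := Y g (twoStar n - 1)

/-- The conformal class `[g]` of the metrics `w^{4/(n-2)} g` with `w` smooth and positive. -/
def conformalClass (g : Metric n M) : Set (Metric n M) :=
  {h | ∃ w : C^∞⟮𝓡 n, M; ℝ⟯, (∀ x, 0 < w x) ∧
    ∀ (x : M) (a b : TangentSpace (𝓡 n) x),
      h.inner x a b = w x ^ (4 / ((n : ℝ) - 2)) * g.inner x a b}

/-- `v` solves the obstacle problem with obstacle `u`: it minimizes `⟨v, v⟩_g` among the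
`v ∈ H¹₊(M, g)` with `v ≥ u` (almost everywhere). -/
def IsObstacleSolution (g : Metric n M) (u v : Lp ℝ 2 (vol g)) : Prop :=
  (v ∈ H1Plus g ∧ u ≤ v) ∧ ∀ v' ∈ H1Plus g, u ≤ v' → form g v v ≤ form g v' v'

open Classical in
/-- The obstacle operator: `T_g(u)` is the unique solution of the obstacle problem with
obstacle `u` (and `0` should there be no unique solution). -/
def T (g : Metric n M) (u : Lp ℝ 2 (vol g)) : Lp ℝ 2 (vol g) :=
  if hu : ∃! v, IsObstacleSolution g u v then hu.choose else 0

/-- `I_p^g(u) = ⟨u, u⟩_g / ‖T_g(u)‖²_{L^{p+1}}`. -/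
def I (g : Metric n M) (p : ℝ) (u : Lp ℝ 2 (vol g)) : ℝ :=
  form g u u / normL g (p + 1) (T g u) ^ 2

/-- `𝒴_oc^p(M, g) = inf I_p^g` over `H¹₊(M, g)`. -/
def Yoc (g : Metric n M) (p : ℝ) : ℝ := sInf (I g p '' H1Plus g)

end Manifold

end

end Yamabe

/-! Write Q(u) = ⟨u,u⟩_h. The comparison of the two functionals is short. Since T(u) ≥ u > 0, the
norm of T(u) is at least that of u, so I(u) ≤ J(u). Since u is a competitor for its own obstacle,
Q(T(u)) ≤ Q(u), so J(T(u)) ≤ I(u). Hence the two infima agree and a minimizer of J minimizes I.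
Conversely T(T(u)) = T(u), so I(u) and I(T(u)) have the same denominator; if u minimizes I, then
Q(u) ≤ Q(T(u)), so u solves its own obstacle problem, uniqueness gives T(u) = u, and I(u) = J(u).
This is `functionals_compare`.

What has to be supplied is that Q is coercive on H¹ and that H¹ embeds in L^{p+1}. Positivity of the
Yamabe invariant is a Sobolev inequality for positive functions; applying it to √(f² + ε) removes
the sign condition (`sobolevInequality_yamabeInvariant`). Multiplication by the conformal factor w
carries Q_h to Q_g and the L^{2*} norm of h to that of g, so the inequality holds for h with the
same constant (`IsConformalTo.smoothForm_eq`, `IsConformalTo.eLpNorm_twoStar`). Hölder's inequality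
and boundedness of the scalar curvature then give coercivity (`SobolevInequality.exists_normSq_le`),
and the direct method with the parallelogram identity solves the obstacle problem uniquely
(`exists_isObstacleSolution`, `IsObstacleSolution.eq`).

Most of the work is geometric. Conformal invariance of Q needs the transformation law of the scalar
curvature, obtained in coordinates, and Green's formula, glued from charts (`exists_laplacian`).
Curvature and volume are defined through preferred charts, so their independence of the chart is
needed (`scalarCurvature_eq`, `vol_restrict`). The form uses a chosen weak gradient, whose
uniqueness is `HasSobolevGrad.gradient_eq_zero`. -/

namespace Yamabe

noncomputable section

/-! ### Christoffel symbols and curvature in coordinates, and their naturality -/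

section Coordinates

variable {V : Type*} [NormedAddCommGroup V] [NormedSpace ℝ V]

/-- `G` is a smooth Riemannian metric on the open set `U`. -/
structure IsMetricOn (G : V → V →L[ℝ] V →L[ℝ] ℝ) (U : Set V) : Prop where
  isOpen : IsOpen U
  contDiffOn : ContDiffOn ℝ ∞ G U
  symm : ∀ y ∈ U, ∀ u v, G y u v = G y v u
  pos : ∀ y ∈ U, ∀ u, u ≠ 0 → 0 < G y u u

theorem christoffelFirst_apply (G : V → V →L[ℝ] V →L[ℝ] ℝ) (y u v z : V) :
    christoffelFirst G y u v z =
      1 / 2 * (fderiv ℝ G y u v z + fderiv ℝ G y v u z - fderiv ℝ G y z u v) := by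
  simp [christoffelFirst]

namespace IsMetricOn

variable {G : V → V →L[ℝ] V →L[ℝ] ℝ} {U : Set V} {y : V}

theorem contDiffAt (hG : IsMetricOn G U) (hy : y ∈ U) : ContDiffAt ℝ ∞ G y :=
  hG.contDiffOn.contDiffAt (hG.isOpen.mem_nhds hy)

theorem hasFDerivAt (hG : IsMetricOn G U) (hy : y ∈ U) : HasFDerivAt G (fderiv ℝ G y) y :=
  ((hG.contDiffAt hy).differentiableAt (by simp)).hasFDerivAt

theorem hasFDerivAt_apply (hG : IsMetricOn G U) (hy : y ∈ U) (v z : V) :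
    HasFDerivAt (fun x => G x v z) (((fderiv ℝ G y).flip v).flip z) y := by
  have h := ((hG.hasFDerivAt hy).clm_apply (hasFDerivAt_const v y)).clm_apply
    (hasFDerivAt_const z y)
  refine h.congr_fderiv ?_
  ext w
  simp

theorem fderiv_symm (hG : IsMetricOn G U) (hy : y ∈ U) (u v z : V) :
    fderiv ℝ G y u v z = fderiv ℝ G y u z v := by
  have h1 := hG.hasFDerivAt_apply hy v z
  have h2 := hG.hasFDerivAt_apply hy z v
  have h3 : (fun x => G x v z) =ᶠ[𝓝 y] fun x => G x z v := by
    filter_upwards [hG.isOpen.mem_nhds hy] with x hx using hG.symm x hx v z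
  have := congrArg (fun L => L u) (h1.unique (h2.congr_of_eventuallyEq h3))
  simpa using this

theorem injective (hG : IsMetricOn G U) (hy : y ∈ U) : Function.Injective (G y) := by
  rw [injective_iff_map_eq_zero]
  intro a ha
  by_contra h
  have := hG.pos y hy a h
  simp [ha] at this

variable [FiniteDimensional ℝ V]

/-- A positive definite form is injective into the dual, which has the same dimension. Without this,
`ContinuousLinearMap.inverse` would take its default value 0 in the definition of the Christoffel
symbols. -/
theorem isInvertible (hG : IsMetricOn G U) (hy : y ∈ U) : (G y).IsInvertible := by
  have hd : Module.finrank ℝ V = Module.finrank ℝ (V →L[ℝ] ℝ) := by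
    rw [← (LinearMap.toContinuousLinearMap (𝕜 := ℝ) (E := V) (F' := ℝ)).finrank_eq]
    exact (Subspace.dual_finrank_eq (K := ℝ) (V := V)).symm
  let e := LinearEquiv.ofInjectiveOfFinrankEq (G y : V →ₗ[ℝ] V →L[ℝ] ℝ) (hG.injective hy) hd
  exact ⟨e.toContinuousLinearEquiv, by ext v; rfl⟩

theorem apply_inverse (hG : IsMetricOn G U) (hy : y ∈ U) (ξ : V →L[ℝ] ℝ) :
    G y ((G y).inverse ξ) = ξ := by
  rw [(hG.isInvertible hy).self_apply_inverse]

omit [FiniteDimensional ℝ V] in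
theorem ext_apply (hG : IsMetricOn G U) (hy : y ∈ U) {a b : V} (h : ∀ z, G y a z = G y b z) :
    a = b :=
  hG.injective hy (ContinuousLinearMap.ext h)

theorem apply_christoffel (hG : IsMetricOn G U) (hy : y ∈ U) (u v z : V) :
    G y (christoffel G y u v) z =
      1 / 2 * (fderiv ℝ G y u v z + fderiv ℝ G y v u z - fderiv ℝ G y z u v) := by
  rw [← christoffelFirst_apply]
  simp [christoffel, hG.apply_inverse hy]

theorem christoffel_symm (hG : IsMetricOn G U) (hy : y ∈ U) (u v : V) :
    christoffel G y u v = christoffel G y v u := by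
  refine hG.ext_apply hy fun z => ?_
  rw [hG.apply_christoffel hy, hG.apply_christoffel hy, hG.fderiv_symm hy z u v]
  ring

/-- Compatibility of the connection with the metric, ∇G = 0: adding the two Koszul expressions, all
derivatives but one cancel. -/
theorem fderiv_eq_christoffel (hG : IsMetricOn G U) (hy : y ∈ U) (u v z : V) :
    fderiv ℝ G y u v z = G y (christoffel G y u v) z + G y v (christoffel G y u z) := by
  rw [hG.symm y hy v, hG.apply_christoffel hy, hG.apply_christoffel hy, hG.fderiv_symm hy z u v,
    hG.fderiv_symm hy u z v, hG.fderiv_symm hy v u z]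
  ring

theorem contDiffOn_inverse (hG : IsMetricOn G U) : ContDiffOn ℝ ∞ (fun x => (G x).inverse) U := by
  intro x hx
  obtain ⟨e, he⟩ := hG.isInvertible hx
  have h : ContDiffAt ℝ ∞ ContinuousLinearMap.inverse (G x) := by
    rw [← he]; exact contDiffAt_map_inverse e
  exact h.comp_contDiffWithinAt x (hG.contDiffOn x hx)

theorem contDiffOn_christoffel (hG : IsMetricOn G U) : ContDiffOn ℝ ∞ (christoffel G) U := by
  have hd : ContDiffOn ℝ ∞ (fderiv ℝ G) U := hG.contDiffOn.fderiv_of_isOpen hG.isOpen (by simp)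
  have hfl : ContDiffOn ℝ ∞ (fun x => (fderiv ℝ G x).flip) U :=
    (ContinuousLinearMap.flipₗᵢ ℝ V V (V →L[ℝ] ℝ)).contDiff.comp_contDiffOn hd
  have h1 : ContDiffOn ℝ ∞ (christoffelFirst G) U := by
    unfold christoffelFirst
    exact (((hd.add hfl).sub (contDiffOn_const.clm_comp hfl)).const_smul (1 / 2 : ℝ))
  unfold christoffel
  exact ((ContinuousLinearMap.compL ℝ V (V →L[ℝ] ℝ) V).contDiff.comp_contDiffOn
    hG.contDiffOn_inverse).clm_comp h1

theorem hasFDerivAt_christoffel_apply (hG : IsMetricOn G U) (hy : y ∈ U) (u v : V) :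
    HasFDerivAt (fun x => christoffel G x u v)
      (((fderiv ℝ (christoffel G) y).flip u).flip v) y := by
  have h0 : HasFDerivAt (christoffel G) (fderiv ℝ (christoffel G) y) y :=
    ((hG.contDiffOn_christoffel.contDiffAt (hG.isOpen.mem_nhds hy)).differentiableAt
      (by simp)).hasFDerivAt
  have h := (h0.clm_apply (hasFDerivAt_const u y)).clm_apply (hasFDerivAt_const v y)
  refine h.congr_fderiv ?_
  ext w
  simp

end IsMetricOn

/-! ### Naturality of the curvature -/

variable {W : Type*} [NormedAddCommGroup W] [NormedSpace ℝ W]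

/-- `Φ` is a smooth isometric immersion of `(U, G)` into `(U', G')`. -/
structure IsIsometricOn (Φ : V → W) (G : V → V →L[ℝ] V →L[ℝ] ℝ) (U : Set V)
    (G' : W → W →L[ℝ] W →L[ℝ] ℝ) (U' : Set W) : Prop where
  metric : IsMetricOn G U
  metric' : IsMetricOn G' U'
  contDiffOn : ContDiffOn ℝ ∞ Φ U
  mapsTo : MapsTo Φ U U'
  apply : ∀ y ∈ U, ∀ u v, G y u v = G' (Φ y) (fderiv ℝ Φ y u) (fderiv ℝ Φ y v)

namespace IsIsometricOn

variable {G : V → V →L[ℝ] V →L[ℝ] ℝ} {U : Set V} {G' : W → W →L[ℝ] W →L[ℝ] ℝ} {U' : Set W}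
  {Φ : V → W} {y : V}

theorem fderiv_injective (h : IsIsometricOn Φ G U G' U') (hy : y ∈ U) :
    Function.Injective (fderiv ℝ Φ y) := by
  rw [injective_iff_map_eq_zero]
  intro a ha
  by_contra hne
  have := h.metric.pos y hy a hne
  simp [h.apply y hy, ha] at this

theorem hasFDerivAt (h : IsIsometricOn Φ G U G' U') (hy : y ∈ U) :
    HasFDerivAt Φ (fderiv ℝ Φ y) y :=
  ((h.contDiffOn.contDiffAt (h.metric.isOpen.mem_nhds hy)).differentiableAt
    (by simp)).hasFDerivAt

theorem contDiffOn_fderiv (h : IsIsometricOn Φ G U G' U') : ContDiffOn ℝ ∞ (fderiv ℝ Φ) U :=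
  h.contDiffOn.fderiv_of_isOpen h.metric.isOpen (by simp)

theorem hasFDerivAt_fderiv (h : IsIsometricOn Φ G U G' U') (hy : y ∈ U) :
    HasFDerivAt (fderiv ℝ Φ) (fderiv ℝ (fderiv ℝ Φ) y) y :=
  ((h.contDiffOn_fderiv.contDiffAt (h.metric.isOpen.mem_nhds hy)).differentiableAt
    (by simp)).hasFDerivAt

theorem hasFDerivAt_fderiv_fderiv (h : IsIsometricOn Φ G U G' U') (hy : y ∈ U) :
    HasFDerivAt (fderiv ℝ (fderiv ℝ Φ)) (fderiv ℝ (fderiv ℝ (fderiv ℝ Φ)) y) y :=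
  (((h.contDiffOn_fderiv.fderiv_of_isOpen h.metric.isOpen (m := ∞) (by simp)).contDiffAt
    (h.metric.isOpen.mem_nhds hy)).differentiableAt (by simp)).hasFDerivAt

theorem second_symm (h : IsIsometricOn Φ G U G' U') (hy : y ∈ U) (u v : V) :
    fderiv ℝ (fderiv ℝ Φ) y u v = fderiv ℝ (fderiv ℝ Φ) y v u :=
  ((h.contDiffOn.contDiffAt (h.metric.isOpen.mem_nhds hy)).isSymmSndFDerivAt
    (by simpa using ENat.LEInfty.out)).eq u v

theorem third_symm (h : IsIsometricOn Φ G U G' U') (hy : y ∈ U) (u v z : V) :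
    fderiv ℝ (fderiv ℝ (fderiv ℝ Φ)) y u v z = fderiv ℝ (fderiv ℝ (fderiv ℝ Φ)) y v u z := by
  rw [((h.contDiffOn_fderiv.contDiffAt (h.metric.isOpen.mem_nhds hy)).isSymmSndFDerivAt
    (by simpa using ENat.LEInfty.out)).eq u v]

theorem fderiv_apply (h : IsIsometricOn Φ G U G' U') (hy : y ∈ U) (w u v : V) :
    fderiv ℝ G y w u v =
      fderiv ℝ G' (Φ y) (fderiv ℝ Φ y w) (fderiv ℝ Φ y u) (fderiv ℝ Φ y v)
      + G' (Φ y) (fderiv ℝ (fderiv ℝ Φ) y w u) (fderiv ℝ Φ y v)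
      + G' (Φ y) (fderiv ℝ Φ y u) (fderiv ℝ (fderiv ℝ Φ) y w v) := by
  have h1 := h.metric.hasFDerivAt_apply hy u v
  have hD := h.hasFDerivAt_fderiv hy
  have h2 := (((h.metric'.hasFDerivAt (h.mapsTo hy)).comp y (h.hasFDerivAt hy)).clm_apply
    (hD.clm_apply (hasFDerivAt_const u y))).clm_apply (hD.clm_apply (hasFDerivAt_const v y))
  have h3 : (fun x => G x u v) =ᶠ[𝓝 y]
      fun x => (G' ∘ Φ) x (fderiv ℝ Φ x u) (fderiv ℝ Φ x v) := by
    filter_upwards [h.metric.isOpen.mem_nhds hy] with x hx using h.apply x hx u v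
  have := congrArg (fun L => L w) (h1.unique (h2.congr_of_eventuallyEq h3))
  simp only [ContinuousLinearMap.flip_apply] at this
  rw [this]
  simp
  ring

variable [FiniteDimensional ℝ V] [FiniteDimensional ℝ W]

theorem fderiv_surjective (h : IsIsometricOn Φ G U G' U')
    (hd : Module.finrank ℝ V = Module.finrank ℝ W) (hy : y ∈ U) :
    Function.Surjective (fderiv ℝ Φ y) :=
  (LinearMap.injective_iff_surjective_of_finrank_eq_finrank (f := (fderiv ℝ Φ y : V →ₗ[ℝ] W)) hd).1
    (h.fderiv_injective hy)

/-- The second derivative of Φ is the inhomogeneous term in the transformation law. As dΦ is onto,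
it suffices to pair with vectors dΦ(z); the Koszul formula on both sides and the derivative of G =
Φ*G' then give the identity. -/
theorem fderiv_christoffel (h : IsIsometricOn Φ G U G' U')
    (hd : Module.finrank ℝ V = Module.finrank ℝ W) (hy : y ∈ U) (u v : V) :
    fderiv ℝ Φ y (christoffel G y u v) =
      christoffel G' (Φ y) (fderiv ℝ Φ y u) (fderiv ℝ Φ y v) + fderiv ℝ (fderiv ℝ Φ) y u v := by
  refine h.metric'.ext_apply (h.mapsTo hy) fun z' => ?_
  obtain ⟨z, rfl⟩ := h.fderiv_surjective hd hy z'
  rw [← h.apply y hy, h.metric.apply_christoffel hy, map_add, add_apply,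
    h.metric'.apply_christoffel (h.mapsTo hy), h.fderiv_apply hy, h.fderiv_apply hy,
    h.fderiv_apply hy, h.second_symm hy v u, h.second_symm hy z u, h.second_symm hy z v,
    h.metric'.symm _ (h.mapsTo hy) _ (fderiv ℝ Φ y v)]
  ring

theorem fderiv_fderiv_christoffel (h : IsIsometricOn Φ G U G' U')
    (hd : Module.finrank ℝ V = Module.finrank ℝ W) (hy : y ∈ U) (w u v : V) :
    fderiv ℝ Φ y (fderiv ℝ (christoffel G) y w u v)
      + fderiv ℝ (fderiv ℝ Φ) y w (christoffel G y u v) =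
    fderiv ℝ (christoffel G') (Φ y) (fderiv ℝ Φ y w) (fderiv ℝ Φ y u) (fderiv ℝ Φ y v)
      + christoffel G' (Φ y) (fderiv ℝ (fderiv ℝ Φ) y w u) (fderiv ℝ Φ y v)
      + christoffel G' (Φ y) (fderiv ℝ Φ y u) (fderiv ℝ (fderiv ℝ Φ) y w v)
      + fderiv ℝ (fderiv ℝ (fderiv ℝ Φ)) y w u v := by
  have hD := h.hasFDerivAt_fderiv hy
  have hc : HasFDerivAt (christoffel G') (fderiv ℝ (christoffel G') (Φ y)) (Φ y) :=
    ((h.metric'.contDiffOn_christoffel.contDiffAt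
      (h.metric'.isOpen.mem_nhds (h.mapsTo hy))).differentiableAt (by simp)).hasFDerivAt
  have h1 := hD.clm_apply (h.metric.hasFDerivAt_christoffel_apply hy u v)
  have h2 := (((hc.comp y (h.hasFDerivAt hy)).clm_apply
    (hD.clm_apply (hasFDerivAt_const u y))).clm_apply
      (hD.clm_apply (hasFDerivAt_const v y))).add
    (((h.hasFDerivAt_fderiv_fderiv hy).clm_apply (hasFDerivAt_const u y)).clm_apply
      (hasFDerivAt_const v y))
  have h3 : (fun x => fderiv ℝ Φ x (christoffel G x u v)) =ᶠ[𝓝 y]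
      fun x => (christoffel G' ∘ Φ) x (fderiv ℝ Φ x u) (fderiv ℝ Φ x v)
        + fderiv ℝ (fderiv ℝ Φ) x u v := by
    filter_upwards [h.metric.isOpen.mem_nhds hy] with x hx using h.fderiv_christoffel hd hx u v
  have := congrArg (fun L => L w) (h1.unique (h2.congr_of_eventuallyEq h3))
  simp at this
  rw [this]
  abel

/-- Antisymmetrize the derivative of the transformation law in u and v. The third derivatives of Φ
drop out by symmetry, and the terms with a second derivative cancel against those produced by the
products Γ(u, Γ(v, z)). -/
theorem fderiv_riemann (h : IsIsometricOn Φ G U G' U')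
    (hd : Module.finrank ℝ V = Module.finrank ℝ W) (hy : y ∈ U) (u v z : V) :
    fderiv ℝ Φ y (riemann G y u v z) =
      riemann G' (Φ y) (fderiv ℝ Φ y u) (fderiv ℝ Φ y v) (fderiv ℝ Φ y z) := by
  have e1 := h.fderiv_fderiv_christoffel hd hy u v z
  have e2 := h.fderiv_fderiv_christoffel hd hy v u z
  rw [h.second_symm hy v u, h.third_symm hy v u] at e2
  have f1 := h.fderiv_christoffel hd hy u (christoffel G y v z)
  have f2 := h.fderiv_christoffel hd hy v (christoffel G y u z)
  rw [h.fderiv_christoffel hd hy v z, map_add] at f1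
  rw [h.fderiv_christoffel hd hy u z, map_add] at f2
  simp only [riemann, map_sub, map_add]
  rw [f1, f2]
  linear_combination (norm := module) e1 - e2

end IsIsometricOn

end Coordinates

/-! ### Conformal change of the connection and of the Riemann tensor -/

section Conformal

variable {V : Type*} [NormedAddCommGroup V] [NormedSpace ℝ V]

/-- The gradient of `φ` for the metric `G` in coordinates. -/
def gradCoord (G : V → V →L[ℝ] V →L[ℝ] ℝ) (φ : V → ℝ) (y : V) : V :=
  (G y).inverse (fderiv ℝ φ y)

/-- The conformal metric `e^{2φ} G`. -/
def conformalCoord (G : V → V →L[ℝ] V →L[ℝ] ℝ) (φ : V → ℝ) (y : V) : V →L[ℝ] V →L[ℝ] ℝ :=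
  Real.exp (2 * φ y) • G y

/-- The Hessian `∂²φ - Γ dφ` in coordinates. -/
def hessCoord (G : V → V →L[ℝ] V →L[ℝ] ℝ) (φ : V → ℝ) (y u v : V) : ℝ :=
  fderiv ℝ (fderiv ℝ φ) y u v - fderiv ℝ φ y (christoffel G y u v)

/-- The covariant derivative of the gradient of `φ` in coordinates. -/
def covGradCoord (G : V → V →L[ℝ] V →L[ℝ] ℝ) (φ : V → ℝ) (y u : V) : V :=
  fderiv ℝ (gradCoord G φ) y u + christoffel G y u (gradCoord G φ y)

namespace IsMetricOn

variable {G : V → V →L[ℝ] V →L[ℝ] ℝ} {U : Set V} {y : V} {φ : V → ℝ}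

theorem hasFDerivAt_of_contDiffOn (hG : IsMetricOn G U) {F : Type*} [NormedAddCommGroup F]
    [NormedSpace ℝ F] {f : V → F} (hf : ContDiffOn ℝ ∞ f U) (hy : y ∈ U) :
    HasFDerivAt f (fderiv ℝ f y) y :=
  ((hf.contDiffAt (hG.isOpen.mem_nhds hy)).differentiableAt (by simp)).hasFDerivAt

theorem contDiffOn_fderiv (hG : IsMetricOn G U) {F : Type*} [NormedAddCommGroup F]
    [NormedSpace ℝ F] {f : V → F} (hf : ContDiffOn ℝ ∞ f U) : ContDiffOn ℝ ∞ (fderiv ℝ f) U :=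
  hf.fderiv_of_isOpen hG.isOpen (by simp)

theorem conformal (hG : IsMetricOn G U) (hφ : ContDiffOn ℝ ∞ φ U) :
    IsMetricOn (conformalCoord G φ) U where
  isOpen := hG.isOpen
  contDiffOn := (Real.contDiff_exp.comp_contDiffOn (contDiffOn_const.mul hφ)).smul hG.contDiffOn
  symm y hy u v := by simp [conformalCoord, hG.symm y hy u v]
  pos y hy u hu := by
    simpa [conformalCoord] using mul_pos (Real.exp_pos _) (hG.pos y hy u hu)

variable [FiniteDimensional ℝ V]

theorem apply_gradCoord (hG : IsMetricOn G U) (hy : y ∈ U) (v : V) :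
    G y (gradCoord G φ y) v = fderiv ℝ φ y v := by
  simp [gradCoord, hG.apply_inverse hy]

theorem apply_gradCoord' (hG : IsMetricOn G U) (hy : y ∈ U) (v : V) :
    G y v (gradCoord G φ y) = fderiv ℝ φ y v := by
  rw [hG.symm y hy, hG.apply_gradCoord hy]

theorem contDiffOn_gradCoord (hG : IsMetricOn G U) (hφ : ContDiffOn ℝ ∞ φ U) :
    ContDiffOn ℝ ∞ (gradCoord G φ) U :=
  hG.contDiffOn_inverse.clm_apply (hG.contDiffOn_fderiv hφ)

/-- Differentiate G(grad φ, v) = dφ(v) and use ∇G = 0. It allows indices of the Hessian to be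
raised, so that traces become traces of endomorphisms. -/
theorem apply_covGradCoord (hG : IsMetricOn G U) (hφ : ContDiffOn ℝ ∞ φ U) (hy : y ∈ U)
    (u v : V) : G y (covGradCoord G φ y u) v = hessCoord G φ y u v := by
  have h1 := ((hG.hasFDerivAt hy).clm_apply
    (hG.hasFDerivAt_of_contDiffOn (hG.contDiffOn_gradCoord hφ) hy)).clm_apply
      (hasFDerivAt_const v y)
  have h2 := (hG.hasFDerivAt_of_contDiffOn (hG.contDiffOn_fderiv hφ) hy).clm_apply
    (hasFDerivAt_const v y)
  have h3 : (fun x => fderiv ℝ φ x v) =ᶠ[𝓝 y] fun x => G x (gradCoord G φ x) v := by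
    filter_upwards [hG.isOpen.mem_nhds hy] with x hx using (hG.apply_gradCoord hx v).symm
  have := congrArg (fun L => L u) (h2.unique (h1.congr_of_eventuallyEq h3))
  simp at this
  rw [hessCoord, this, ← hG.apply_gradCoord hy, hG.fderiv_eq_christoffel hy]
  simp only [covGradCoord, map_add, add_apply]
  ring

theorem christoffel_conformal (hG : IsMetricOn G U) (hφ : ContDiffOn ℝ ∞ φ U) (hy : y ∈ U)
    (u v : V) : christoffel (conformalCoord G φ) y u v =
      christoffel G y u v + fderiv ℝ φ y u • v + fderiv ℝ φ y v • u
        - G y u v • gradCoord G φ y := by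
  have hd (a b c : V) : fderiv ℝ (conformalCoord G φ) y a b c =
      Real.exp (2 * φ y) * (fderiv ℝ G y a b c + 2 * fderiv ℝ φ y a * G y b c) := by
    have h1 : HasFDerivAt (fun x => Real.exp (2 * φ x))
        (Real.exp (2 * φ y) • (2 : ℝ) • fderiv ℝ φ y) y :=
      ((hG.hasFDerivAt_of_contDiffOn hφ hy).const_mul 2).exp
    have h2 : HasFDerivAt (conformalCoord G φ) _ y := h1.smul (hG.hasFDerivAt hy)
    rw [h2.fderiv]
    simp
    ring
  have hG' := hG.conformal hφ
  refine hG'.ext_apply hy fun z => ?_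
  rw [hG'.apply_christoffel hy, hd, hd, hd]
  simp only [conformalCoord, smul_apply, smul_eq_mul, map_sub, map_add,
    map_smul, sub_apply, add_apply]
  rw [hG.apply_gradCoord hy, hG.apply_christoffel hy]
  ring

theorem fderiv_christoffel_conformal (hG : IsMetricOn G U) (hφ : ContDiffOn ℝ ∞ φ U) (hy : y ∈ U)
    (w u v : V) : fderiv ℝ (christoffel (conformalCoord G φ)) y w u v =
      fderiv ℝ (christoffel G) y w u v + fderiv ℝ (fderiv ℝ φ) y w u • v
        + fderiv ℝ (fderiv ℝ φ) y w v • u - fderiv ℝ G y w u v • gradCoord G φ y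
        - G y u v • fderiv ℝ (gradCoord G φ) y w := by
  have h1 := (hG.conformal hφ).hasFDerivAt_christoffel_apply hy u v
  have hd := hG.hasFDerivAt_of_contDiffOn (hG.contDiffOn_fderiv hφ) hy
  have h2 := (((hG.hasFDerivAt_christoffel_apply hy u v).add
    ((hd.clm_apply (hasFDerivAt_const u y)).smul (hasFDerivAt_const v y))).add
    ((hd.clm_apply (hasFDerivAt_const v y)).smul (hasFDerivAt_const u y))).sub
    ((hG.hasFDerivAt_apply hy u v).smul
      (hG.hasFDerivAt_of_contDiffOn (hG.contDiffOn_gradCoord hφ) hy))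
  have h3 : (fun x => christoffel (conformalCoord G φ) x u v) =ᶠ[𝓝 y] fun x =>
      christoffel G x u v + fderiv ℝ φ x u • v + fderiv ℝ φ x v • u
        - G x u v • gradCoord G φ x := by
    filter_upwards [hG.isOpen.mem_nhds hy] with x hx using hG.christoffel_conformal hφ hx u v
  have := congrArg (fun L => L w) (h1.unique (h2.congr_of_eventuallyEq h3))
  simp at this
  rw [this]
  abel

/-- Obtained by substituting the new Christoffel symbols. The derivatives of G are rewritten through
Γ by metric compatibility, after which they complete the second derivatives of φ to Hessians and
covariant derivatives of the gradient. -/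
theorem riemann_conformal (hG : IsMetricOn G U) (hφ : ContDiffOn ℝ ∞ φ U) (hy : y ∈ U)
    (u v z : V) : riemann (conformalCoord G φ) y u v z = riemann G y u v z
      + (hessCoord G φ y u z - fderiv ℝ φ y u * fderiv ℝ φ y z) • v
      + (fderiv ℝ φ y v * fderiv ℝ φ y z - hessCoord G φ y v z
          - G y v z * fderiv ℝ φ y (gradCoord G φ y)) • u
      + G y u z • (covGradCoord G φ y v + fderiv ℝ φ y (gradCoord G φ y) • v
          - fderiv ℝ φ y v • gradCoord G φ y)
      - G y v z • covGradCoord G φ y u + (fderiv ℝ φ y u * G y v z) • gradCoord G φ y := by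
  have hs : fderiv ℝ (fderiv ℝ φ) y u v = fderiv ℝ (fderiv ℝ φ) y v u :=
    ((hφ.contDiffAt (hG.isOpen.mem_nhds hy)).isSymmSndFDerivAt
      (by simpa using ENat.LEInfty.out)).eq u v
  simp only [riemann, hG.fderiv_christoffel_conformal hφ hy, hG.christoffel_conformal hφ hy,
    map_add, map_sub, map_smul, hG.fderiv_eq_christoffel hy, hessCoord, covGradCoord,
    hG.apply_gradCoord' hy, smul_eq_mul, hs, hG.christoffel_symm hy v u,
    hG.symm y hy v u, hG.symm y hy v (christoffel G y u z)]
  rw [hG.symm y hy (christoffel G y u z) v]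
  module

end IsMetricOn

end Conformal

/-! ### Jacobi's formula for the derivative of a determinant -/

section MatrixLemmas

variable {m : Type*} [Fintype m] [DecidableEq m]

/-- Factor out A and use det(1 + tC) = 1 + t tr C + O(t²), where the remainder is t² times a
polynomial in t. -/
theorem hasDerivAt_det_add_smul (A B : Matrix m m ℝ) (hA : IsUnit A.det) :
    HasDerivAt (fun t : ℝ => (A + t • B).det) (A.det * (A⁻¹ * B).trace) 0 := by
  have h (t : ℝ) : (A + t • B).det = A.det * (1 + (A⁻¹ * B).trace * t +
      ((1 + (Polynomial.X : Polynomial ℝ) • (A⁻¹ * B).map Polynomial.C).det).divX.divX.eval t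
        * t ^ 2) := by
    rw [← Matrix.det_one_add_smul, ← Matrix.det_mul, mul_add, mul_one, Matrix.mul_smul,
      Matrix.mul_nonsing_inv_cancel_left _ _ hA]
  rw [funext h]
  generalize ((1 + (Polynomial.X : Polynomial ℝ) • (A⁻¹ * B).map Polynomial.C).det).divX.divX = q
  have h1 := ((((hasDerivAt_id (0 : ℝ)).const_mul (A⁻¹ * B).trace).const_add 1).add
    ((q.hasDerivAt 0).mul ((hasDerivAt_id (0 : ℝ)).pow 2))).const_mul A.det
  refine (h1.congr_deriv ?_)
  simp

theorem contDiff_det_of_contDiffOn {V : Type*} [NormedAddCommGroup V] [NormedSpace ℝ V]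
    {A : V → Matrix m m ℝ} {U : Set V} (hA : ∀ i j, ContDiffOn ℝ ∞ (fun x => A x i j) U) :
    ContDiffOn ℝ ∞ (fun x => (A x).det) U := by
  simp only [Matrix.det_apply]
  refine ContDiffOn.sum fun σ _ => ContDiffOn.const_smul _ ?_
  exact contDiffOn_prod fun i _ => hA _ _

theorem hasFDerivAt_det_apply {V : Type*} [NormedAddCommGroup V] [NormedSpace ℝ V]
    {A : V → Matrix m m ℝ} {A' : m → m → V →L[ℝ] ℝ} {x : V}
    (hA : ∀ i j, HasFDerivAt (fun x => A x i j) (A' i j) x) (hx : IsUnit (A x).det) (v : V) :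
    fderiv ℝ (fun x => (A x).det) x v =
      (A x).det * ((A x)⁻¹ * Matrix.of fun i j => A' i j v).trace := by
  let D : (m → m → ℝ) → ℝ := fun B => (Matrix.of B).det
  have hD : ContDiffOn ℝ ∞ D univ := contDiff_det_of_contDiffOn fun i j => by
    simp only [Matrix.of_apply]
    exact (contDiff_apply_apply ℝ ℝ i j).contDiffOn
  have hD' (B : m → m → ℝ) : HasFDerivAt D (fderiv ℝ D B) B :=
    ((hD.contDiffAt univ_mem).differentiableAt (by simp)).hasFDerivAt
  have h1 : HasFDerivAt (fun x i j => A x i j)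
      (ContinuousLinearMap.pi fun i => ContinuousLinearMap.pi (A' i)) x :=
    hasFDerivAt_pi.2 fun i => hasFDerivAt_pi.2 fun j => hA i j
  have h2 : HasFDerivAt (fun x => (A x).det) _ x :=
    HasFDerivAt.comp (g := D) (f := fun x i j => A x i j) x (hD' fun i j => A x i j) h1
  rw [h2.fderiv]
  set B : m → m → ℝ := fun i j => A' i j v
  -- The differential of the determinant, evaluated on the matrix B, is read off along the line A +
  -- tB.
  have h3 : HasDerivAt (fun t : ℝ => D ((fun i j => A x i j) + t • B))
      (fderiv ℝ D (fun i j => A x i j) B) 0 := by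
    have h0 : HasDerivAt (fun t : ℝ => (fun i j => A x i j) + t • B) B 0 := by
      have := ((hasDerivAt_id (0 : ℝ)).smul_const B).const_add (fun i j => A x i j)
      simpa using this
    have hD0 : HasFDerivAt D (fderiv ℝ D (fun i j => A x i j))
        ((fun i j => A x i j) + (0 : ℝ) • B) := by
      simpa using hD' fun i j => A x i j
    exact hD0.comp_hasDerivAt (0 : ℝ) h0
  exact h3.unique (hasDerivAt_det_add_smul (A x) (Matrix.of B) hx)

end MatrixLemmas

/-! ### Traces: Ricci tensor, scalar curvature, Laplacian and integration by parts -/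

section Trace

variable {n : ℕ}

/-- The standard basis vectors of `ℝⁿ`. -/
abbrev stdVec (i : Fin n) : E n := EuclideanSpace.single i 1

theorem sum_smul_stdVec (v : E n) : ∑ i, v i • stdVec i = v := by
  ext j
  simp [Pi.single_apply]

theorem sum_map_stdVec_mul (ξ : E n →ₗ[ℝ] ℝ) (v : E n) : ∑ i, ξ (stdVec i) * v i = ξ v := by
  conv_rhs => rw [← sum_smul_stdVec v]
  simp [mul_comm]

theorem sum_stdVec_apply : ∑ i : Fin n, (stdVec i : E n) i = n := by
  simp

theorem sum_stdVec_eq_trace (f : E n →ₗ[ℝ] E n) :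
    ∑ i, f (stdVec i) i = LinearMap.trace ℝ (E n) f := by
  rw [LinearMap.trace_eq_matrix_trace ℝ (EuclideanSpace.basisFun (Fin n) ℝ).toBasis]
  simp [Matrix.trace, LinearMap.toMatrix_apply]

theorem sum_stdVec_conj (f f' D : E n →ₗ[ℝ] E n) (hD : Function.Injective D)
    (h : ∀ v, D (f v) = f' (D v)) : ∑ i, f (stdVec i) i = ∑ i, f' (stdVec i) i := by
  rw [sum_stdVec_eq_trace, sum_stdVec_eq_trace]
  let e := LinearEquiv.ofInjectiveEndo D hD
  rw [← LinearMap.trace_conj' f e]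
  congr 1
  ext1 v
  obtain ⟨w, rfl⟩ := e.surjective v
  rw [LinearEquiv.conj_apply_apply, e.symm_apply_apply]
  exact h w

theorem gram_apply (B : E n →L[ℝ] E n →L[ℝ] ℝ) (i j : Fin n) :
    gram B i j = B (stdVec i) (stdVec j) := rfl

theorem sum_gram (B : E n →L[ℝ] E n →L[ℝ] ℝ) (v : E n) (j : Fin n) :
    ∑ i, v i * gram B i j = B v (stdVec j) := by
  conv_rhs => rw [← sum_smul_stdVec v]
  simp [gram_apply]

theorem sum_sum_gram (B : E n →L[ℝ] E n →L[ℝ] ℝ) (v w : E n) :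
    ∑ i, ∑ j, v i * gram B i j * w j = B v w := by
  rw [Finset.sum_comm]
  simp only [← Finset.sum_mul, sum_gram]
  exact sum_map_stdVec_mul (B v : E n →ₗ[ℝ] ℝ) w

theorem posDef_gram {B : E n →L[ℝ] E n →L[ℝ] ℝ} (hs : ∀ u v, B u v = B v u)
    (hp : ∀ u, u ≠ 0 → 0 < B u u) : (gram B).PosDef := by
  refine Matrix.PosDef.of_dotProduct_mulVec_pos (by ext i j; simp [gram_apply, hs]) fun x hx => ?_
  have := hp (WithLp.toLp 2 x) (by simpa using hx)
  rw [← sum_sum_gram] at this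
  simpa [dotProduct, Matrix.mulVec, Finset.mul_sum, mul_assoc] using this

/-- The trace of a bilinear form with respect to the metric `A` on `ℝⁿ`. -/
def metricTrace (A : E n →L[ℝ] E n →L[ℝ] ℝ) (B : E n → E n → ℝ) : ℝ :=
  ∑ j, ∑ k, (gram A)⁻¹ j k * B (stdVec j) (stdVec k)

/-- Contracting with the inverse metric is the trace of the endomorphism S obtained by raising an
index. In this form the scalar curvature is visibly independent of the basis, and its conformal
change can be computed term by term. -/
theorem metricTrace_eq {A : E n →L[ℝ] E n →L[ℝ] ℝ} {B : E n → E n → ℝ} {S : E n → E n}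
    (hs : ∀ u v, A u v = A v u) (hp : ∀ u, u ≠ 0 → 0 < A u u) (h : ∀ u v, A (S u) v = B u v) :
    metricTrace A B = ∑ i, S (stdVec i) i := by
  have hP := posDef_gram hs hp
  have hsym : (gram A)⁻¹.transpose = (gram A)⁻¹ := by
    rw [Matrix.transpose_nonsing_inv]
    congr 1
    ext i j
    simp [gram_apply, hs]
  refine Finset.sum_congr rfl fun j _ => ?_
  simp only [← h, ← sum_gram]
  have : ∀ k, (gram A)⁻¹ j k * ∑ i, S (stdVec j) i * gram A i k =
      ∑ i, S (stdVec j) i * (gram A i k * (gram A)⁻¹ k j) := fun k => by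
    rw [← congrFun (congrFun hsym j) k, Matrix.transpose_apply, Finset.mul_sum]
    exact Finset.sum_congr rfl fun i _ => by ring
  simp only [this]
  rw [Finset.sum_comm]
  simp only [← Finset.mul_sum, ← Matrix.mul_apply]
  rw [Matrix.mul_nonsing_inv _ hP.det_pos.ne'.isUnit]
  simp [Matrix.one_apply]

theorem metricTrace_add (A : E n →L[ℝ] E n →L[ℝ] ℝ) (B C : E n → E n → ℝ) :
    metricTrace A (fun u v => B u v + C u v) = metricTrace A B + metricTrace A C := by
  simp [metricTrace, mul_add, Finset.sum_add_distrib]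

theorem metricTrace_swap {A : E n →L[ℝ] E n →L[ℝ] ℝ} (hs : ∀ u v, A u v = A v u)
    (B : E n → E n → ℝ) : metricTrace A (fun u v => B v u) = metricTrace A B := by
  have hsym : (gram A)⁻¹.transpose = (gram A)⁻¹ := by
    rw [Matrix.transpose_nonsing_inv]
    congr 1
    ext i j
    simp [gram_apply, hs]
  unfold metricTrace
  rw [Finset.sum_comm]
  refine Finset.sum_congr rfl fun j _ => Finset.sum_congr rfl fun k _ => ?_
  rw [← congrFun (congrFun hsym j) k, Matrix.transpose_apply]

theorem scalarCurvatureCoord_eq (G : E n → E n →L[ℝ] E n →L[ℝ] ℝ) (y : E n) :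
    scalarCurvatureCoord G y = metricTrace (G y) (ricci G y) := rfl

/-- The endomorphism `u ↦ R(u, v)z`. -/
def riemannEnd {V : Type*} [NormedAddCommGroup V] [NormedSpace ℝ V]
    (G : V → V →L[ℝ] V →L[ℝ] ℝ) (y v z : V) : V →ₗ[ℝ] V :=
  IsLinearMap.mk' (fun u => riemann G y u v z)
    ⟨fun a b => by simp only [riemann, map_add, add_apply]; abel,
     fun c a => by simp only [riemann, map_smul, smul_apply]; module⟩

/-- The Ricci tensor as a bilinear map. -/
def ricciBilin (G : E n → E n →L[ℝ] E n →L[ℝ] ℝ) (y : E n) : E n →ₗ[ℝ] E n →ₗ[ℝ] ℝ :=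
  LinearMap.mk₂ ℝ (ricci G y)
    (fun a b z => by
      simp only [ricci, riemann, map_add, add_apply, ← Finset.sum_add_distrib]
      refine Finset.sum_congr rfl fun i _ => ?_
      simp only [PiLp.add_apply, PiLp.sub_apply]; ring)
    (fun c a z => by
      simp only [ricci, riemann, map_smul, smul_apply, smul_eq_mul, Finset.mul_sum]
      refine Finset.sum_congr rfl fun i _ => ?_
      simp only [PiLp.add_apply, PiLp.sub_apply, PiLp.smul_apply, smul_eq_mul]; ring)
    (fun v a b => by
      simp only [ricci, riemann, map_add, ← Finset.sum_add_distrib]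
      refine Finset.sum_congr rfl fun i _ => ?_
      simp only [PiLp.add_apply, PiLp.sub_apply]; ring)
    (fun c v a => by
      simp only [ricci, riemann, map_smul, smul_eq_mul, Finset.mul_sum]
      refine Finset.sum_congr rfl fun i _ => ?_
      simp only [PiLp.add_apply, PiLp.sub_apply, PiLp.smul_apply, smul_eq_mul]; ring)

/-- The Ricci endomorphism, obtained from the Ricci tensor by raising an index. -/
def ricciEnd (G : E n → E n →L[ℝ] E n →L[ℝ] ℝ) (y : E n) : E n →ₗ[ℝ] E n :=
  ((G y).inverse : (E n →L[ℝ] ℝ) →ₗ[ℝ] E n) ∘ₗ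
    (LinearMap.toContinuousLinearMap : (E n →ₗ[ℝ] ℝ) ≃ₗ[ℝ] (E n →L[ℝ] ℝ)).toLinearMap ∘ₗ
      ricciBilin G y

namespace IsMetricOn

variable {G : E n → E n →L[ℝ] E n →L[ℝ] ℝ} {U : Set (E n)} {y : E n} {φ : E n → ℝ}

theorem apply_ricciEnd (hG : IsMetricOn G U) (hy : y ∈ U) (v z : E n) :
    G y (ricciEnd G y v) z = ricci G y v z := by
  simp [ricciEnd, hG.apply_inverse hy, ricciBilin]

theorem scalarCurvatureCoord_eq_sum (hG : IsMetricOn G U) (hy : y ∈ U) :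
    scalarCurvatureCoord G y = ∑ i, ricciEnd G y (stdVec i) i :=
  metricTrace_eq (hG.symm y hy) (hG.pos y hy) (hG.apply_ricciEnd hy)

end IsMetricOn

/-- Two conjugations by dΦ: one for the trace defining Ricci, by naturality of the Riemann tensor,
and one for the trace of the Ricci endomorphism. -/
theorem IsIsometricOn.scalarCurvatureCoord_eq {G G' : E n → E n →L[ℝ] E n →L[ℝ] ℝ}
    {U U' : Set (E n)} {Φ : E n → E n} (h : IsIsometricOn Φ G U G' U') {y : E n} (hy : y ∈ U) :
    scalarCurvatureCoord G y = scalarCurvatureCoord G' (Φ y) := by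
  rw [h.metric.scalarCurvatureCoord_eq_sum hy,
    h.metric'.scalarCurvatureCoord_eq_sum (h.mapsTo hy)]
  have hric (v z : E n) : ricci G y v z = ricci G' (Φ y) (fderiv ℝ Φ y v) (fderiv ℝ Φ y z) :=
    sum_stdVec_conj (riemannEnd G y v z)
      (riemannEnd G' (Φ y) (fderiv ℝ Φ y v) (fderiv ℝ Φ y z)) (fderiv ℝ Φ y)
      (h.fderiv_injective hy) fun u => h.fderiv_riemann rfl hy u v z
  refine sum_stdVec_conj _ _ (fderiv ℝ Φ y) (h.fderiv_injective hy) fun v => ?_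
  refine h.metric'.ext_apply (h.mapsTo hy) fun z' => ?_
  obtain ⟨z, rfl⟩ := h.fderiv_surjective rfl hy z'
  rw [h.metric'.apply_ricciEnd (h.mapsTo hy)]
  exact (h.apply y hy _ _).symm.trans ((h.metric.apply_ricciEnd hy _ _).trans (hric v z))

/-- The Laplacian of `φ` in coordinates. -/
def laplacianCoord (G : E n → E n →L[ℝ] E n →L[ℝ] ℝ) (φ : E n → ℝ) (y : E n) : ℝ :=
  ∑ i, covGradCoord G φ y (stdVec i) i

namespace IsMetricOn

variable {G : E n → E n →L[ℝ] E n →L[ℝ] ℝ} {U : Set (E n)} {y : E n} {φ : E n → ℝ}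

/-- Trace of the formula for the Riemann tensor over its first argument; each sum over the basis is
the evaluation of a linear form or the dimension n. -/
theorem ricci_conformal (hG : IsMetricOn G U) (hφ : ContDiffOn ℝ ∞ φ U) (hy : y ∈ U)
    (v z : E n) : ricci (conformalCoord G φ) y v z = ricci G y v z
      + ((n : ℝ) - 2) * (fderiv ℝ φ y v * fderiv ℝ φ y z - hessCoord G φ y v z
          - fderiv ℝ φ y (gradCoord G φ y) * G y v z)
      - laplacianCoord G φ y * G y v z := by
  set N := gradCoord G φ y
  have hdφ (w : E n) : ∑ i, fderiv ℝ φ y (stdVec i) * w i = fderiv ℝ φ y w :=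
    sum_map_stdVec_mul (fderiv ℝ φ y : E n →ₗ[ℝ] ℝ) w
  have hGz (w : E n) : ∑ i, G y (stdVec i) z * w i = G y w z := by
    simpa using sum_map_stdVec_mul ((G y).flip z : E n →ₗ[ℝ] ℝ) w
  have hH : ∑ i, hessCoord G φ y (stdVec i) z * v i = hessCoord G φ y v z := by
    simpa [hessCoord] using sum_map_stdVec_mul ((((fderiv ℝ (fderiv ℝ φ) y).flip z) -
      (fderiv ℝ φ y) ∘L (christoffel G y).flip z : E n →L[ℝ] ℝ) : E n →ₗ[ℝ] ℝ) v
  have key : ricci (conformalCoord G φ) y v z = ∑ i, (riemann G y (stdVec i) v z i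
      + (hessCoord G φ y (stdVec i) z * v i - fderiv ℝ φ y z * (fderiv ℝ φ y (stdVec i) * v i))
      + (fderiv ℝ φ y v * fderiv ℝ φ y z - hessCoord G φ y v z
          - G y v z * fderiv ℝ φ y N) * (stdVec i : E n) i
      + G y (stdVec i) z * (covGradCoord G φ y v + fderiv ℝ φ y N • v
          - fderiv ℝ φ y v • N : E n) i
      - G y v z * covGradCoord G φ y (stdVec i) i
      + G y v z * (fderiv ℝ φ y (stdVec i) * N i)) := by
    unfold ricci
    refine Finset.sum_congr rfl fun i _ => ?_
    rw [hG.riemann_conformal hφ hy]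
    simp only [PiLp.add_apply, PiLp.sub_apply, PiLp.smul_apply, smul_eq_mul]
    ring
  rw [key]
  simp only [Finset.sum_add_distrib, Finset.sum_sub_distrib, ← Finset.mul_sum, hdφ, hGz, hH,
    sum_stdVec_apply]
  simp only [map_add, map_sub, map_smul, add_apply, sub_apply, smul_apply, smul_eq_mul,
    hG.apply_covGradCoord hφ hy]
  rw [hG.apply_gradCoord hy]
  simp only [ricci, laplacianCoord]
  ring

theorem scalarCurvatureCoord_conformal (hG : IsMetricOn G U) (hφ : ContDiffOn ℝ ∞ φ U)
    (hy : y ∈ U) : Real.exp (2 * φ y) * scalarCurvatureCoord (conformalCoord G φ) y =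
      scalarCurvatureCoord G y - 2 * ((n : ℝ) - 1) * laplacianCoord G φ y
        - ((n : ℝ) - 2) * ((n : ℝ) - 1) * fderiv ℝ φ y (gradCoord G φ y) := by
  set N := gradCoord G φ y
  have hG' := hG.conformal hφ
  have h : scalarCurvatureCoord (conformalCoord G φ) y = ∑ i, (Real.exp (-(2 * φ y)) •
      (ricciEnd G y (stdVec i) + ((n : ℝ) - 2) • (fderiv ℝ φ y (stdVec i) • N
        - covGradCoord G φ y (stdVec i) - fderiv ℝ φ y N • stdVec i)
        - laplacianCoord G φ y • stdVec i)) i := by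
    rw [scalarCurvatureCoord_eq]
    refine metricTrace_eq (S := fun u => Real.exp (-(2 * φ y)) •
      (ricciEnd G y u + ((n : ℝ) - 2) • (fderiv ℝ φ y u • N
        - covGradCoord G φ y u - fderiv ℝ φ y N • u) - laplacianCoord G φ y • u))
      (hG'.symm y hy) (hG'.pos y hy) fun u v => ?_
    rw [hG.ricci_conformal hφ hy, conformalCoord]
    simp only [map_add, map_sub, map_smul, add_apply, sub_apply, smul_apply, smul_eq_mul,
      hG.apply_covGradCoord hφ hy, hG.apply_ricciEnd hy]
    rw [hG.apply_gradCoord hy, Real.exp_neg]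
    field_simp
    ring
  have hdφ (w : E n) : ∑ i, fderiv ℝ φ y (stdVec i) * w i = fderiv ℝ φ y w :=
    sum_map_stdVec_mul (fderiv ℝ φ y : E n →ₗ[ℝ] ℝ) w
  rw [h, hG.scalarCurvatureCoord_eq_sum hy]
  simp only [PiLp.add_apply, PiLp.sub_apply, PiLp.smul_apply, smul_eq_mul,
    Finset.sum_add_distrib, Finset.sum_sub_distrib, ← Finset.mul_sum, hdφ,
    sum_stdVec_apply]
  rw [Real.exp_neg, mul_inv_cancel_left₀ (Real.exp_pos _).ne']
  simp only [laplacianCoord]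
  ring

theorem det_gram_pos (hG : IsMetricOn G U) (hy : y ∈ U) : 0 < (gram (G y)).det :=
  (posDef_gram (hG.symm y hy) (hG.pos y hy)).det_pos

theorem contDiffOn_apply (hG : IsMetricOn G U) (u v : E n) :
    ContDiffOn ℝ ∞ (fun y => G y u v) U :=
  (hG.contDiffOn.clm_apply contDiffOn_const).clm_apply contDiffOn_const

theorem contDiffOn_sqrt_det (hG : IsMetricOn G U) :
    ContDiffOn ℝ ∞ (fun y => √(gram (G y)).det) U :=
  (contDiff_det_of_contDiffOn fun i j => hG.contDiffOn_apply (stdVec i) (stdVec j)).sqrt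
    fun _ hy => (hG.det_gram_pos hy).ne'

/-- In the Koszul formula the two terms other than ∂_v G form an antisymmetric tensor, whose trace
against the symmetric inverse metric vanishes. -/
theorem sum_christoffel (hG : IsMetricOn G U) (hy : y ∈ U) (v : E n) :
    ∑ i, christoffel G y (stdVec i) v i =
      metricTrace (G y) (fun a b => 1 / 2 * fderiv ℝ G y v a b) := by
  rw [← metricTrace_eq (hG.symm y hy) (hG.pos y hy) (S := fun u => christoffel G y u v)
    fun a b => hG.apply_christoffel hy a v b]
  have e : (fun a b => 1 / 2 * (fderiv ℝ G y a v b + fderiv ℝ G y v a b - fderiv ℝ G y b a v))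
      = fun a b => 1 / 2 * fderiv ℝ G y v a b
        + (1 / 2 * fderiv ℝ G y a v b + -(1 / 2) * fderiv ℝ G y b v a) := by
    ext a b
    rw [hG.fderiv_symm hy b a v]
    ring
  rw [e, metricTrace_add, metricTrace_add,
    metricTrace_swap (hG.symm y hy) fun a b => -(1 / 2) * fderiv ℝ G y a v b,
    ← metricTrace_add]
  simp [metricTrace]

/-- Jacobi's formula turns the logarithmic derivative of the density into half the trace of G⁻¹ ∂_v
G, which is the trace of Γ. Hence the Laplacian is a divergence with respect to √det G. -/
theorem fderiv_sqrt_det (hG : IsMetricOn G U) (hy : y ∈ U) (v : E n) :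
    fderiv ℝ (fun y => √(gram (G y)).det) y v =
      √(gram (G y)).det * ∑ i, christoffel G y (stdVec i) v i := by
  have hpos := hG.det_gram_pos hy
  have h1 : HasFDerivAt (fun y => (gram (G y)).det) _ y := hG.hasFDerivAt_of_contDiffOn
    (contDiff_det_of_contDiffOn fun i j => hG.contDiffOn_apply (stdVec i) (stdVec j)) hy
  have hdet := hasFDerivAt_det_apply (A := fun x => gram (G x))
    (fun i j => hG.hasFDerivAt_apply hy (stdVec i) (stdVec j)) hpos.ne'.isUnit v
  rw [(h1.sqrt hpos.ne').fderiv, hG.sum_christoffel hy, smul_apply, hdet]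
  have h2 : ((gram (G y))⁻¹ * Matrix.of fun i j =>
      (((fderiv ℝ G y).flip (stdVec i)).flip (stdVec j)) v).trace =
      2 * metricTrace (G y) (fun a b => 1 / 2 * fderiv ℝ G y v a b) := by
    simp only [Matrix.trace, Matrix.diag, Matrix.mul_apply, metricTrace, Finset.mul_sum]
    refine Finset.sum_congr rfl fun j _ => Finset.sum_congr rfl fun k _ => ?_
    simp only [Matrix.of_apply, ContinuousLinearMap.flip_apply]
    rw [hG.fderiv_symm hy]
    ring
  rw [h2]
  have := Real.sq_sqrt hpos.le
  have hs := Real.sqrt_pos.2 hpos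
  simp only [smul_eq_mul]
  field_simp
  rw [this]

theorem integral_laplacianCoord (hG : IsMetricOn G U) (hφ : ContDiffOn ℝ ∞ φ U) {ψ : E n → ℝ}
    (hψ : ContDiff ℝ ∞ ψ) (hc : HasCompactSupport ψ) (hs : tsupport ψ ⊆ U) :
    ∫ y, √(gram (G y)).det * (ψ y * laplacianCoord G φ y) =
      -∫ y, √(gram (G y)).det * fderiv ℝ ψ y (gradCoord G φ y) := by
  set F : Fin n → E n → ℝ := fun i y => √(gram (G y)).det * gradCoord G φ y i with hF
  have hN := hG.contDiffOn_gradCoord hφ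
  have hFs (i : Fin n) : ContDiffOn ℝ ∞ (F i) U :=
    hG.contDiffOn_sqrt_det.mul
      ((EuclideanSpace.proj (𝕜 := ℝ) i).contDiff.comp_contDiffOn hN)
  have int {a b : E n → ℝ} (ha : Continuous a) (hat : tsupport a ⊆ tsupport ψ)
      (hb : ContinuousOn b U) : Integrable (fun y => a y * b y) := by
    -- The metric quantities are controlled on U only, so integrability is checked on the compact
    -- support of ψ.
    rw [← integrableOn_iff_integrable_of_support_subset (s := tsupport ψ)]
    · exact (ha.continuousOn.mul (hb.mono hs)).integrableOn_compact hc
    · intro y hy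
      refine hat (subset_tsupport a ?_)
      intro h
      simp [h] at hy
  have hdψ (i : Fin n) : Continuous fun y => fderiv ℝ ψ y (stdVec i) :=
    (hψ.continuous_fderiv (by simp)).clm_apply continuous_const
  have hdψs (i : Fin n) : tsupport (fun y => fderiv ℝ ψ y (stdVec i)) ⊆ tsupport ψ := by
    refine closure_minimal (fun y hy => ?_) (isClosed_tsupport ψ)
    refine support_fderiv_subset ℝ (f := ψ) (fun h => ?_)
    simp [h] at hy
  have hdF (i : Fin n) : ContinuousOn (fun y => fderiv ℝ (F i) y (stdVec i)) U :=
    ((hG.contDiffOn_fderiv (hFs i)).continuousOn).clm_apply continuousOn_const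
  have ibp (i : Fin n) : ∫ y, ψ y * fderiv ℝ (F i) y (stdVec i) =
      -∫ y, fderiv ℝ ψ y (stdVec i) * F i y :=
    integral_mul_fderiv_eq_neg_fderiv_mul_of_integrable
      (int (hdψ i) (hdψs i) (hFs i).continuousOn)
      (int hψ.continuous subset_rfl (hdF i)) (int hψ.continuous subset_rfl (hFs i).continuousOn)
      (fun y _ => hψ.differentiable (by simp) y)
      (fun y hy => (hG.hasFDerivAt_of_contDiffOn (hFs i) (hs hy)).differentiableAt)
  -- On the support of ψ, √det G · Δφ = ∑ ∂ᵢ(√det G · (grad φ)ⁱ): the derivative of the density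
  -- supplies exactly the Christoffel term of the covariant derivative. Off the support both sides
  -- are 0.
  have e1 : (fun y => √(gram (G y)).det * (ψ y * laplacianCoord G φ y)) =
      fun y => ∑ i, ψ y * fderiv ℝ (F i) y (stdVec i) := by
    ext y
    by_cases hy : y ∈ tsupport ψ
    · have hyU := hs hy
      have hFd (i : Fin n) : fderiv ℝ (F i) y (stdVec i) =
          √(gram (G y)).det * fderiv ℝ (gradCoord G φ) y (stdVec i) i
          + √(gram (G y)).det * ((∑ j, christoffel G y (stdVec j) (stdVec i) j)
            * gradCoord G φ y i) := by
        have h1 := hG.hasFDerivAt_of_contDiffOn hG.contDiffOn_sqrt_det hyU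
        have h2 : HasFDerivAt (fun x => gradCoord G φ x i) _ y :=
          (EuclideanSpace.proj (𝕜 := ℝ) i).hasFDerivAt.comp y
            (hG.hasFDerivAt_of_contDiffOn hN hyU)
        have h3 : HasFDerivAt (F i) _ y := h1.mul h2
        rw [h3.fderiv]
        simp [hG.fderiv_sqrt_det hyU]
        ring
      have hch : ∑ i, (∑ j, christoffel G y (stdVec j) (stdVec i) j) * gradCoord G φ y i =
          ∑ j, christoffel G y (stdVec j) (gradCoord G φ y) j := by
        simp only [Finset.sum_mul]
        rw [Finset.sum_comm]
        refine Finset.sum_congr rfl fun j _ => ?_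
        exact sum_map_stdVec_mul (((EuclideanSpace.proj (𝕜 := ℝ) j) ∘L
          christoffel G y (stdVec j) : E n →L[ℝ] ℝ) : E n →ₗ[ℝ] ℝ) _
      simp only [hFd, ← Finset.mul_sum, Finset.sum_add_distrib, hch]
      simp only [laplacianCoord, covGradCoord, PiLp.add_apply, Finset.sum_add_distrib]
      ring
    · simp [image_eq_zero_of_notMem_tsupport hy]
  have e2 : (fun y => √(gram (G y)).det * fderiv ℝ ψ y (gradCoord G φ y)) =
      fun y => ∑ i, fderiv ℝ ψ y (stdVec i) * F i y := by
    ext y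
    have h : ∑ i, fderiv ℝ ψ y (stdVec i) * gradCoord G φ y i = fderiv ℝ ψ y (gradCoord G φ y) :=
      sum_map_stdVec_mul (fderiv ℝ ψ y : E n →ₗ[ℝ] ℝ) _
    rw [← h, Finset.mul_sum]
    exact Finset.sum_congr rfl fun i _ => by simp only [hF]; ring
  rw [e1, e2, integral_finsetSum _ fun i _ => int hψ.continuous subset_rfl (hdF i),
    integral_finsetSum _ fun i _ => int (hdψ i) (hdψs i) (hFs i).continuousOn,
    ← Finset.sum_neg_distrib]
  exact Finset.sum_congr rfl fun i _ => ibp i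

end IsMetricOn

end Trace

/-! ### The metric in charts; independence of the chart -/

section ChartMetric

open Bundle

variable {n : ℕ} {M : Type*} [TopologicalSpace M] [ChartedSpace (E n) M] [IsManifold (𝓡 n) ∞ M]

/-- The derivative of the inverse of the preferred chart around `x`. -/
def chartDeriv (x : M) (y : E n) : E n →L[ℝ] E n :=
  mfderiv 𝓘(ℝ, E n) (𝓡 n) (extChartAt (𝓡 n) x).symm y

theorem contMDiffAt_chartInv {x : M} {y : E n} (hy : y ∈ (extChartAt (𝓡 n) x).target) :
    ContMDiffAt 𝓘(ℝ, E n) (𝓡 n) ∞ (extChartAt (𝓡 n) x).symm y :=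
  (contMDiffOn_extChartAt_symm x).contMDiffAt ((isOpen_extChartAt_target x).mem_nhds hy)

theorem mdifferentiableAt_chartInv {x : M} {y : E n} (hy : y ∈ (extChartAt (𝓡 n) x).target) :
    MDifferentiableAt 𝓘(ℝ, E n) (𝓡 n) (extChartAt (𝓡 n) x).symm y :=
  (contMDiffAt_chartInv hy).mdifferentiableAt (by simp)

theorem chartDeriv_isInvertible {x : M} {y : E n} (hy : y ∈ (extChartAt (𝓡 n) x).target) :
    (chartDeriv x y).IsInvertible := by
  have : IsManifold (𝓡 n) 1 M := IsManifold.of_le (n := ∞) (by simp)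
  have h := isInvertible_mfderivWithin_extChartAt_symm (I := 𝓡 n) hy
  rw [ModelWithCorners.range_eq_univ, mfderivWithin_univ] at h
  exact h

theorem chartMetric_apply (g : Metric n M) (x : M) (y u v : E n) :
    chartMetric g x y u v =
      g.inner ((extChartAt (𝓡 n) x).symm y) (chartDeriv x y u) (chartDeriv x y v) := rfl

/-- The constant fields of ℝⁿ are pushed forward by the tangent map of the inverse chart to smooth
sections along it; evaluating the smooth bundle metric on two such sections gives a smooth function.
-/
theorem contDiffOn_chartMetric_apply (g : Metric n M) (x : M) (u v : E n) :
    ContDiffOn ℝ ∞ (fun y => chartMetric g x y u v) (extChartAt (𝓡 n) x).target := by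
  have : IsManifold (𝓡 n) 1 M := IsManifold.of_le (n := ∞) (by simp)
  have hψ : ContMDiffOn 𝓘(ℝ, E n) (𝓡 n) ∞ (extChartAt (𝓡 n) x).symm
      (extChartAt (𝓡 n) x).target := contMDiffOn_extChartAt_symm x
  have hU : IsOpen (extChartAt (𝓡 n) x).target := isOpen_extChartAt_target x
  have hfield (w : E n) : ContMDiffOn 𝓘(ℝ, E n) (𝓡 n).tangent ∞
      (fun y => TotalSpace.mk' (E n) (E := (TangentSpace (𝓡 n) : M → Type _))
        ((extChartAt (𝓡 n) x).symm y) (chartDeriv x y w)) (extChartAt (𝓡 n) x).target := by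
    have h1 := hψ.contMDiffOn_tangentMapWithin (m := ∞) (by simp) hU.uniqueMDiffOn
    have h2 : ContMDiffOn 𝓘(ℝ, E n) 𝓘(ℝ, E n).tangent ∞
        (fun y : E n => (⟨y, w⟩ : TangentBundle 𝓘(ℝ, E n) (E n)))
        (extChartAt (𝓡 n) x).target :=
      contMDiffOn_vectorSpace_iff_contDiffOn.2 contDiffOn_const
    refine (h1.comp h2 fun y hy => hy).congr fun y hy => ?_
    simp only [Function.comp, tangentMapWithin, chartDeriv]
    rw [mfderivWithin_of_isOpen hU hy]
    rfl
  have h := ContMDiffOn.clm_bundle_apply₂ (F₁ := E n) (F₂ := E n) (F₃ := ℝ)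
    (E₃ := Bundle.Trivial M ℝ) (g.contMDiff.comp_contMDiffOn hψ) (hfield u) (hfield v)
  rw [← contMDiffOn_iff_contDiffOn]
  intro y hy
  have h3 := h y hy
  simp only [contMDiffWithinAt_totalSpace] at h3
  exact h3.2

theorem isMetricOn_chartMetric (g : Metric n M) (x : M) :
    IsMetricOn (chartMetric g x) (extChartAt (𝓡 n) x).target where
  isOpen := isOpen_extChartAt_target x
  contDiffOn := by
    rw [contDiffOn_clm_apply]
    intro u
    rw [contDiffOn_clm_apply]
    intro v
    exact contDiffOn_chartMetric_apply g x u v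
  symm y _ u v := g.symm ((extChartAt (𝓡 n) x).symm y) (chartDeriv x y u) (chartDeriv x y v)
  pos y hy u hu := by
    refine g.pos _ _ fun h => hu ?_
    exact (chartDeriv_isInvertible hy).injective (h.trans (map_zero _).symm)

/-- The inner product of a Riemannian metric, as a constant metric on `ℝⁿ`. -/
theorem isMetricOn_inner (g : Metric n M) (m : M) :
    IsMetricOn (fun _ : E n => (g.inner m : E n →L[ℝ] E n →L[ℝ] ℝ)) univ where
  isOpen := isOpen_univ
  contDiffOn := contDiffOn_const
  symm _ _ := g.symm m
  pos _ _ := g.pos m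

theorem inner_self_nonneg (g : Metric n M) (m : M) (v : TangentSpace (𝓡 n) m) :
    0 ≤ g.inner m v v := by
  by_cases h : v = 0
  · simp [h]
  · exact (g.pos m v h).le

theorem inner_smoothGrad (g : Metric n M) (f : M → ℝ) (m : M) (v : TangentSpace (𝓡 n) m) :
    g.inner m (smoothGrad g f m) v = mfderiv (𝓡 n) 𝓘(ℝ, ℝ) f m v :=
  congrArg (fun L : E n →L[ℝ] ℝ => L v)
    ((isMetricOn_inner g m).apply_inverse (mem_univ (0 : E n)) (mfderiv (𝓡 n) 𝓘(ℝ, ℝ) f m))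

/-- The transition map from the preferred chart around `x` to the one around `x'`. -/
def transition (n : ℕ) {M : Type*} [TopologicalSpace M] [ChartedSpace (E n) M] (x x' : M) (y : E n) :
    E n := extChartAt (𝓡 n) x' ((extChartAt (𝓡 n) x).symm y)

/-- The domain of the transition map from the preferred chart around `x` to the one around `x'`. -/
def transitionDomain (n : ℕ) {M : Type*} [TopologicalSpace M] [ChartedSpace (E n) M] (x x' : M) :
    Set (E n) :=
  (extChartAt (𝓡 n) x).target ∩ (extChartAt (𝓡 n) x).symm ⁻¹' (extChartAt (𝓡 n) x').source

omit [IsManifold (𝓡 n) ∞ M] in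
theorem isOpen_transitionDomain (x x' : M) : IsOpen (transitionDomain n x x') :=
  (continuousOn_extChartAt_symm x).isOpen_inter_preimage (isOpen_extChartAt_target x)
    (isOpen_extChartAt_source x')

theorem contDiffOn_transition (x x' : M) :
    ContDiffOn ℝ ∞ (transition n x x') (transitionDomain n x x') := by
  rw [← contMDiffOn_iff_contDiffOn]
  exact (contMDiffOn_extChartAt (I := 𝓡 n) (x := x')).comp
    ((contMDiffOn_extChartAt_symm x).mono inter_subset_left) fun y hy => by
      simpa using hy.2

omit [IsManifold (𝓡 n) ∞ M] in
theorem transition_mem {x x' : M} {y : E n} (hy : y ∈ transitionDomain n x x') :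
    transition n x x' y ∈ (extChartAt (𝓡 n) x').target :=
  (extChartAt (𝓡 n) x').map_source hy.2

omit [IsManifold (𝓡 n) ∞ M] in
theorem chartInv_transition {x x' : M} {y : E n} (hy : y ∈ transitionDomain n x x') :
    (extChartAt (𝓡 n) x').symm (transition n x x' y) = (extChartAt (𝓡 n) x).symm y :=
  (extChartAt (𝓡 n) x').left_inv hy.2

theorem chartDeriv_transition {x x' : M} {y : E n} (hy : y ∈ transitionDomain n x x') (u : E n) :
    chartDeriv x y u =
      chartDeriv x' (transition n x x' y) (fderiv ℝ (transition n x x') y u) := by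
  have hU := (isOpen_transitionDomain x x').mem_nhds hy
  have hd : DifferentiableAt ℝ (transition n x x') y :=
    ((contDiffOn_transition x x').contDiffAt hU).differentiableAt (by simp)
  have h1 : HasMFDerivAt 𝓘(ℝ, E n) (𝓡 n) ((extChartAt (𝓡 n) x').symm ∘ transition n x x') y _ :=
    (mdifferentiableAt_chartInv (transition_mem hy)).hasMFDerivAt.comp y
      hd.hasFDerivAt.hasMFDerivAt
  have h2 : (extChartAt (𝓡 n) x).symm =ᶠ[𝓝 y]
      (extChartAt (𝓡 n) x').symm ∘ transition n x x' := by
    filter_upwards [hU] with z hz using (chartInv_transition hz).symm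
  exact congrArg (fun L : E n →L[ℝ] E n => L u) (h1.congr_of_eventuallyEq h2).mfderiv

theorem isIsometricOn_transition (g : Metric n M) (x x' : M) :
    IsIsometricOn (transition n x x') (chartMetric g x) (transitionDomain n x x')
      (chartMetric g x') (extChartAt (𝓡 n) x').target where
  metric :=
    { isOpen := isOpen_transitionDomain x x'
      contDiffOn := (isMetricOn_chartMetric g x).contDiffOn.mono inter_subset_left
      symm := fun y hy => (isMetricOn_chartMetric g x).symm y hy.1
      pos := fun y hy => (isMetricOn_chartMetric g x).pos y hy.1 }
  metric' := isMetricOn_chartMetric g x'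
  contDiffOn := contDiffOn_transition x x'
  mapsTo y hy := transition_mem hy
  apply y hy u v := by
    simp only [chartMetric_apply]
    rw [← chartDeriv_transition hy, ← chartDeriv_transition hy, chartInv_transition hy]

/-- The definition changes chart with the point. Transition maps are isometries of the chart
metrics, so near a given point a single chart may be used; continuity and the conformal formula
depend on this. -/
theorem scalarCurvature_eq (g : Metric n M) {x m : M} (hm : m ∈ (extChartAt (𝓡 n) x).source) :
    scalarCurvature g m = scalarCurvatureCoord (chartMetric g x) (extChartAt (𝓡 n) x m) := by
  have hy : extChartAt (𝓡 n) m m ∈ transitionDomain n m x :=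
    ⟨mem_extChartAt_target m, by simpa [extChartAt_to_inv] using hm⟩
  have h := (isIsometricOn_transition g m x).scalarCurvatureCoord_eq hy
  rw [transition, extChartAt_to_inv] at h
  exact h

theorem scalarCurvature_chartInv (g : Metric n M) {x : M} {y : E n}
    (hy : y ∈ (extChartAt (𝓡 n) x).target) :
    scalarCurvature g ((extChartAt (𝓡 n) x).symm y) =
      scalarCurvatureCoord (chartMetric g x) y := by
  rw [scalarCurvature_eq g ((extChartAt (𝓡 n) x).map_target hy), (extChartAt (𝓡 n) x).right_inv hy]

theorem IsMetricOn.continuousOn_scalarCurvatureCoord {G : E n → E n →L[ℝ] E n →L[ℝ] ℝ}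
    {U : Set (E n)} (hG : IsMetricOn G U) : ContinuousOn (scalarCurvatureCoord G) U := by
  have hΓ := hG.contDiffOn_christoffel.continuousOn
  have hdΓ := (hG.contDiffOn_fderiv hG.contDiffOn_christoffel).continuousOn
  have hR (u v z : E n) : ContinuousOn (fun y => riemann G y u v z) U := by
    unfold riemann
    fun_prop
  have hRic (v z : E n) : ContinuousOn (fun y => ricci G y v z) U :=
    continuousOn_finsetSum _ fun i _ =>
      (EuclideanSpace.proj (𝕜 := ℝ) i).continuous.comp_continuousOn (hR _ v z)
  have hS (v : E n) : ContinuousOn (fun y => ricciEnd G y v) U := by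
    refine hG.contDiffOn_inverse.continuousOn.clm_apply ?_
    rw [continuousOn_clm_apply]
    exact fun z => hRic v z
  refine ContinuousOn.congr (f := fun y => ∑ i, ricciEnd G y (stdVec i) i) ?_
    fun y hy => hG.scalarCurvatureCoord_eq_sum hy
  exact continuousOn_finsetSum _ fun i _ =>
    (EuclideanSpace.proj (𝕜 := ℝ) i).continuous.comp_continuousOn (hS _)

omit [IsManifold (𝓡 n) ∞ M] in
theorem continuous_of_chart {F : M → ℝ}
    (h : ∀ x : M, ContinuousOn (fun y => F ((extChartAt (𝓡 n) x).symm y))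
      (extChartAt (𝓡 n) x).target) : Continuous F := by
  rw [continuous_iff_continuousAt]
  intro x
  have h1 : ContinuousOn (fun m => F ((extChartAt (𝓡 n) x).symm (extChartAt (𝓡 n) x m)))
      (extChartAt (𝓡 n) x).source :=
    (h x).comp (continuousOn_extChartAt x) fun m hm => (extChartAt (𝓡 n) x).map_source hm
  have h2 : ContinuousOn F (extChartAt (𝓡 n) x).source :=
    h1.congr fun m hm => by simp only [(extChartAt (𝓡 n) x).left_inv hm]
  exact h2.continuousAt (extChartAt_source_mem_nhds x)

theorem continuous_scalarCurvature (g : Metric n M) : Continuous (scalarCurvature g) :=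
  continuous_of_chart fun x =>
    (isMetricOn_chartMetric g x).continuousOn_scalarCurvatureCoord.congr
      fun _ hy => scalarCurvature_chartInv g hy

/-- A function on `M` read in the preferred chart around `x`. -/
def inChart (n : ℕ) {M : Type*} [TopologicalSpace M] [ChartedSpace (E n) M] (x : M) (f : M → ℝ)
    (y : E n) : ℝ := f ((extChartAt (𝓡 n) x).symm y)

theorem contDiffOn_inChart (x : M) {f : M → ℝ} (hf : ContMDiff (𝓡 n) 𝓘(ℝ, ℝ) ∞ f) :
    ContDiffOn ℝ ∞ (inChart n x f) (extChartAt (𝓡 n) x).target := by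
  rw [← contMDiffOn_iff_contDiffOn]
  exact hf.comp_contMDiffOn (contMDiffOn_extChartAt_symm x)

theorem fderiv_inChart {x : M} {f : M → ℝ} (hf : ContMDiff (𝓡 n) 𝓘(ℝ, ℝ) ∞ f) {y : E n}
    (hy : y ∈ (extChartAt (𝓡 n) x).target) (v : E n) :
    fderiv ℝ (inChart n x f) y v =
      mfderiv (𝓡 n) 𝓘(ℝ, ℝ) f ((extChartAt (𝓡 n) x).symm y) (chartDeriv x y v) := by
  have h : HasMFDerivAt 𝓘(ℝ, E n) 𝓘(ℝ, ℝ) (f ∘ (extChartAt (𝓡 n) x).symm) y _ :=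
    ((hf _).mdifferentiableAt (by simp)).hasMFDerivAt.comp y
      (mdifferentiableAt_chartInv hy).hasMFDerivAt
  have h' : mfderiv 𝓘(ℝ, E n) 𝓘(ℝ, ℝ) (inChart n x f) y = _ := h.mfderiv
  rw [mfderiv_eq_fderiv] at h'
  exact congrArg (fun L : E n →L[ℝ] ℝ => L v) h'

theorem chartDeriv_gradCoord (g : Metric n M) {x : M} {f : M → ℝ}
    (hf : ContMDiff (𝓡 n) 𝓘(ℝ, ℝ) ∞ f) {y : E n} (hy : y ∈ (extChartAt (𝓡 n) x).target) :
    chartDeriv x y (gradCoord (chartMetric g x) (inChart n x f) y) =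
      smoothGrad g f ((extChartAt (𝓡 n) x).symm y) := by
  refine (isMetricOn_inner g ((extChartAt (𝓡 n) x).symm y)).ext_apply (mem_univ (0 : E n))
    fun z' => ?_
  obtain ⟨z, rfl⟩ := (chartDeriv_isInvertible hy).surjective z'
  have h1 := (isMetricOn_chartMetric g x).apply_gradCoord (φ := inChart n x f) hy z
  rw [fderiv_inChart hf hy] at h1
  exact h1.trans (inner_smoothGrad g f _ _).symm

theorem inner_smoothGrad_chartInv (g : Metric n M) {x : M} {f k : M → ℝ}
    (hf : ContMDiff (𝓡 n) 𝓘(ℝ, ℝ) ∞ f) (hk : ContMDiff (𝓡 n) 𝓘(ℝ, ℝ) ∞ k) {y : E n}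
    (hy : y ∈ (extChartAt (𝓡 n) x).target) :
    g.inner ((extChartAt (𝓡 n) x).symm y) (smoothGrad g f ((extChartAt (𝓡 n) x).symm y))
        (smoothGrad g k ((extChartAt (𝓡 n) x).symm y)) =
      fderiv ℝ (inChart n x f) y (gradCoord (chartMetric g x) (inChart n x k) y) := by
  rw [fderiv_inChart hf hy, inner_smoothGrad, ← chartDeriv_gradCoord g hk hy]

theorem continuous_inner_smoothGrad (g : Metric n M) {f k : M → ℝ}
    (hf : ContMDiff (𝓡 n) 𝓘(ℝ, ℝ) ∞ f) (hk : ContMDiff (𝓡 n) 𝓘(ℝ, ℝ) ∞ k) :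
    Continuous fun m => g.inner m (smoothGrad g f m) (smoothGrad g k m) := by
  refine continuous_of_chart (n := n) fun x => ?_
  have hG := isMetricOn_chartMetric g x
  refine ContinuousOn.congr ?_ fun y hy => inner_smoothGrad_chartInv g hf hk hy
  exact (hG.contDiffOn_fderiv (contDiffOn_inChart x hf)).continuousOn.clm_apply
    (hG.contDiffOn_gradCoord (contDiffOn_inChart x hk)).continuousOn

end ChartMetric

/-- The supremum of a family of measures, each carried by a measurable set, which agree on the
overlaps, restricts to the given measures. -/
theorem restrict_iSup_eq {X ι : Type*} [MeasurableSpace X] {μ : ι → Measure X} {U : ι → Set X}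
    (hU : ∀ i, MeasurableSet (U i)) (h0 : ∀ i, μ i (U i)ᶜ = 0)
    (hμ : ∀ i j A, MeasurableSet A → A ⊆ U i → A ⊆ U j → μ i A = μ j A)
    {k : ℕ} {c : Fin k → ι} (hc : ⋃ j, U (c j) = univ) (i : ι) :
    (⨆ i, μ i).restrict (U i) = μ i := by
  -- The P j cut the space into disjoint measurable pieces P j ⊆ U (c j). The restrictions of the μ
  -- (c j) to these pieces add up to a measure that dominates every μ i, hence dominates the
  -- supremum, and that agrees with μ i inside U i.
  set P : Fin k → Set X := disjointed fun j => U (c j)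
  have hPm (j : Fin k) : MeasurableSet (P j) :=
    disjointedRec (fun _ _ ht => ht.diff (hU _)) (hU _)
  have hPs (j : Fin k) : P j ⊆ U (c j) := disjointed_subset _ j
  have hPd : Pairwise (Function.onFun Disjoint P) := disjoint_disjointed _
  have hPc : ⋃ j, P j = univ := (iUnion_disjointed).trans hc
  have split (ν : Measure X) {A : Set X} (hA : MeasurableSet A) : ν A = ∑ j, ν (A ∩ P j) := by
    rw [← tsum_fintype (L := .unconditional _), ← measure_iUnion
      (fun a b hab => (hPd hab).mono inter_subset_right inter_subset_right)
      fun j => hA.inter (hPm j), ← inter_iUnion, hPc, inter_univ]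
  have key (i : ι) {A : Set X} (hA : MeasurableSet A) :
      μ i A ≤ ∑ j, μ (c j) (A ∩ P j) := by
    have h1 : μ i A = μ i (A ∩ U i) := by
      refine le_antisymm ?_ (measure_mono inter_subset_left)
      refine (measure_mono (t := A ∩ U i ∪ (U i)ᶜ) fun a ha => ?_).trans
        ((measure_union_le _ _).trans (by rw [h0, add_zero]))
      by_cases h : a ∈ U i
      · exact Or.inl ⟨ha, h⟩
      · exact Or.inr h
    rw [h1, split _ (hA.inter (hU i))]
    refine Finset.sum_le_sum fun j _ => ?_
    rw [hμ i (c j) _ ((hA.inter (hU i)).inter (hPm j)) (fun a ha => ha.1.2)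
      fun a ha => hPs j ha.2]
    exact measure_mono fun a ha => ⟨ha.1.1, ha.2⟩
  ext A hA
  rw [Measure.restrict_apply hA]
  refine le_antisymm ?_ ?_
  · have hle : ⨆ i, μ i ≤ Measure.sum fun j => (μ (c j)).restrict (P j) := by
      refine iSup_le fun i => Measure.le_iff.2 fun B hB => (key i hB).trans ?_
      rw [Measure.sum_apply _ hB, tsum_fintype]
      exact Finset.sum_le_sum fun j _ => by rw [Measure.restrict_apply hB]
    refine (Measure.le_iff.1 hle _ (hA.inter (hU i))).trans ?_
    rw [Measure.sum_apply _ (hA.inter (hU i)), tsum_fintype]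
    calc ∑ j, (μ (c j)).restrict (P j) (A ∩ U i) = ∑ j, μ i (A ∩ U i ∩ P j) := by
          refine Finset.sum_congr rfl fun j _ => ?_
          rw [Measure.restrict_apply (hA.inter (hU i))]
          exact hμ _ _ _ ((hA.inter (hU i)).inter (hPm j)) (fun a ha => hPs j ha.2)
            fun a ha => ha.1.2
      _ = μ i (A ∩ U i) := (split _ (hA.inter (hU i))).symm
      _ ≤ μ i A := measure_mono inter_subset_left
  · calc μ i A ≤ μ i (A ∩ U i) + μ i (U i)ᶜ := by
          refine (measure_mono (t := A ∩ U i ∪ (U i)ᶜ) fun a ha => ?_).trans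
            (measure_union_le _ _)
          by_cases h : a ∈ U i
          · exact Or.inl ⟨ha, h⟩
          · exact Or.inr h
      _ = μ i (A ∩ U i) := by rw [h0, add_zero]
      _ ≤ (⨆ i, μ i) (A ∩ U i) := Measure.le_iff'.1 (le_iSup μ i) _

theorem det_gram_comp {n : ℕ} {A B : E n →L[ℝ] E n →L[ℝ] ℝ} {D : E n →L[ℝ] E n}
    (h : ∀ u v, A u v = B (D u) (D v)) : (gram A).det = D.det ^ 2 * (gram B).det := by
  set b := (EuclideanSpace.basisFun (Fin n) ℝ).toBasis
  set P : Matrix (Fin n) (Fin n) ℝ := LinearMap.toMatrix b b (D : E n →ₗ[ℝ] E n) with hP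
  have hPe (i j : Fin n) : P i j = D (stdVec j) i := by
    simp [hP, b, LinearMap.toMatrix_apply]
  have hg : gram A = P.transpose * gram B * P := by
    ext i j
    rw [gram_apply, h, ← sum_sum_gram, Matrix.mul_apply]
    simp only [Matrix.mul_apply, Matrix.transpose_apply, hPe, Finset.sum_mul]
    rw [Finset.sum_comm]
  have hdet : P.det = D.det := LinearMap.det_toMatrix b (D : E n →ₗ[ℝ] E n)
  rw [hg, Matrix.det_mul, Matrix.det_mul, Matrix.det_transpose, hdet]
  ring

/-! ### The Riemannian measure -/

section Volume

variable {n : ℕ} {M : Type*} [TopologicalSpace M] [ChartedSpace (E n) M] [IsManifold (𝓡 n) ∞ M]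

/-- The volume density in the preferred chart around `x`. -/
def chartDensity (g : Metric n M) (x : M) (y : E n) : ℝ := √(gram (chartMetric g x y)).det

theorem continuousOn_chartDensity (g : Metric n M) (x : M) :
    ContinuousOn (chartDensity g x) (extChartAt (𝓡 n) x).target :=
  (isMetricOn_chartMetric g x).contDiffOn_sqrt_det.continuousOn

omit [IsManifold (𝓡 n) ∞ M] in
theorem measurableSet_target (x : M) : MeasurableSet (extChartAt (𝓡 n) x).target :=
  (isOpen_extChartAt_target x).measurableSet

theorem aemeasurable_chartDensity (g : Metric n M) (x : M) :
    AEMeasurable (fun y => ENNReal.ofReal (chartDensity g x y))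
      (volume.restrict (extChartAt (𝓡 n) x).target) :=
  ((continuousOn_chartDensity g x).aemeasurable (measurableSet_target x)).ennreal_ofReal

variable [MeasurableSpace M]

theorem chartVolume_eq (g : Metric n M) (x : M) : chartVolume g x =
    ((volume.restrict (extChartAt (𝓡 n) x).target).withDensity
      fun y => ENNReal.ofReal (chartDensity g x y)).map (extChartAt (𝓡 n) x).symm := by
  rw [chartVolume, restrict_withDensity (measurableSet_target x)]
  rfl

variable [BorelSpace M]

omit [IsManifold (𝓡 n) ∞ M] in
theorem aemeasurable_chartInv (x : M) : AEMeasurable (extChartAt (𝓡 n) x).symm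
    (volume.restrict (extChartAt (𝓡 n) x).target) :=
  (continuousOn_extChartAt_symm x).aemeasurable (measurableSet_target x)

theorem aemeasurable_chartInv' (g : Metric n M) (x : M) : AEMeasurable (extChartAt (𝓡 n) x).symm
    ((volume.restrict (extChartAt (𝓡 n) x).target).withDensity
      fun y => ENNReal.ofReal (chartDensity g x y)) :=
  (aemeasurable_chartInv x).mono_ac (withDensity_absolutelyContinuous _ _)

theorem lintegral_chartVolume (g : Metric n M) (x : M) {F : M → ℝ≥0∞} (hF : Measurable F) :
    ∫⁻ m, F m ∂(chartVolume g x) = ∫⁻ y in (extChartAt (𝓡 n) x).target,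
      ENNReal.ofReal (chartDensity g x y) * F ((extChartAt (𝓡 n) x).symm y) := by
  rw [chartVolume_eq, lintegral_map' hF.aemeasurable (aemeasurable_chartInv' g x)]
  exact lintegral_withDensity_eq_lintegral_mul₀ (aemeasurable_chartDensity g x)
    (hF.comp_aemeasurable (aemeasurable_chartInv x))

theorem integral_chartVolume (g : Metric n M) (x : M) {F : M → ℝ} (hF : StronglyMeasurable F) :
    ∫ m, F m ∂(chartVolume g x) = ∫ y in (extChartAt (𝓡 n) x).target,
      chartDensity g x y * F ((extChartAt (𝓡 n) x).symm y) := by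
  rw [chartVolume_eq, integral_map (aemeasurable_chartInv' g x) hF.aestronglyMeasurable,
    integral_withDensity_eq_integral_toReal_smul₀ (aemeasurable_chartDensity g x)
      (ae_of_all _ fun _ => ENNReal.ofReal_lt_top)]
  refine integral_congr_ae (ae_of_all _ fun y => ?_)
  simp only [smul_eq_mul]
  rw [chartDensity, ENNReal.toReal_ofReal (Real.sqrt_nonneg _)]

theorem chartVolume_apply (g : Metric n M) (x : M) {A : Set M} (hA : MeasurableSet A) :
    chartVolume g x A =
      ∫⁻ y in (extChartAt (𝓡 n) x).target ∩ (extChartAt (𝓡 n) x).symm ⁻¹' A,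
        ENNReal.ofReal (chartDensity g x y) := by
  have hnull : NullMeasurableSet ((extChartAt (𝓡 n) x).symm ⁻¹' A)
      (volume.restrict (extChartAt (𝓡 n) x).target) :=
    (aemeasurable_chartInv x).nullMeasurableSet_preimage hA
  rw [chartVolume_eq, Measure.map_apply_of_aemeasurable (aemeasurable_chartInv' g x) hA,
    withDensity_apply', Measure.restrict_restrict₀ hnull, inter_comm]

omit [IsManifold (𝓡 n) ∞ M] in
theorem measurableSet_target_inter (x : M) {A : Set M} (hA : MeasurableSet A) :
    MeasurableSet ((extChartAt (𝓡 n) x).target ∩ (extChartAt (𝓡 n) x).symm ⁻¹' A) := by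
  have h : Measurable ((extChartAt (𝓡 n) x).target.domRestrict (extChartAt (𝓡 n) x).symm) :=
    (continuousOn_iff_continuous_domRestrict.1 (continuousOn_extChartAt_symm x)).measurable
  have := (measurableSet_target (n := n) x).subtype_image (h hA)
  rwa [domRestrict_eq, preimage_comp, Subtype.image_preimage_coe] at this

/-- Change of variables under the transition map Φ: its Jacobian |det dΦ| is compensated by det G =
(det dΦ)² det G' in the densities. -/
theorem chartVolume_eq_on_overlap (g : Metric n M) (x x' : M) {A : Set M} (hA : MeasurableSet A)
    (hx : A ⊆ (extChartAt (𝓡 n) x).source) (hx' : A ⊆ (extChartAt (𝓡 n) x').source) :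
    chartVolume g x A = chartVolume g x' A := by
  rw [chartVolume_apply g x hA, chartVolume_apply g x' hA]
  set B := (extChartAt (𝓡 n) x).target ∩ (extChartAt (𝓡 n) x).symm ⁻¹' A
  have hBs : B ⊆ transitionDomain n x x' := fun y hy => ⟨hy.1, hx' hy.2⟩
  have himg : (extChartAt (𝓡 n) x').target ∩ (extChartAt (𝓡 n) x').symm ⁻¹' A =
      transition n x x' '' B := by
    ext z
    constructor
    · rintro ⟨hz, hzA⟩
      refine ⟨extChartAt (𝓡 n) x ((extChartAt (𝓡 n) x').symm z),
        ⟨(extChartAt (𝓡 n) x).map_source (hx hzA), ?_⟩, ?_⟩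
      · rw [mem_preimage, (extChartAt (𝓡 n) x).left_inv (hx hzA)]
        exact hzA
      · rw [transition, (extChartAt (𝓡 n) x).left_inv (hx hzA), (extChartAt (𝓡 n) x').right_inv hz]
    · rintro ⟨y, hy, rfl⟩
      refine ⟨transition_mem (hBs hy), ?_⟩
      rw [mem_preimage, chartInv_transition (hBs hy)]
      exact hy.2
  have hinj : InjOn (transition n x x') B := fun y hy z hz h => by
    have h1 := congrArg (extChartAt (𝓡 n) x').symm h
    rw [chartInv_transition (hBs hy), chartInv_transition (hBs hz)] at h1
    exact (extChartAt (𝓡 n) x).symm.injOn hy.1 hz.1 h1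
  have hiso := isIsometricOn_transition g x x'
  rw [himg, lintegral_image_eq_lintegral_abs_det_fderiv_mul volume
    (measurableSet_target_inter x hA)
    (fun y hy => (hiso.hasFDerivAt (hBs hy)).hasFDerivWithinAt) hinj]
  refine setLIntegral_congr_fun (measurableSet_target_inter x hA) fun y hy => ?_
  simp only [chartDensity]
  rw [← ENNReal.ofReal_mul (abs_nonneg _), det_gram_comp (hiso.apply y (hBs hy)),
    Real.sqrt_mul (sq_nonneg _), Real.sqrt_sq_eq_abs]

variable [CompactSpace M]

omit [IsManifold (𝓡 n) ∞ M] [MeasurableSpace M] [BorelSpace M] in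
variable (n M) in
theorem exists_chart_cover : ∃ (k : ℕ) (c : Fin k → M),
    ⋃ j, (extChartAt (𝓡 n) (c j)).source = univ := by
  obtain ⟨t, ht⟩ := CompactSpace.elim_nhds_subcover
    (fun x : M => (extChartAt (𝓡 n) x).source) fun x => extChartAt_source_mem_nhds x
  refine ⟨t.card, fun j => t.equivFin.symm j, ?_⟩
  rw [eq_univ_iff_forall]
  intro m
  have hm : m ∈ ⋃ x ∈ t, (extChartAt (𝓡 n) x).source := ht ▸ mem_univ m
  simp only [mem_iUnion] at hm ⊢
  obtain ⟨x, hx, hm⟩ := hm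
  exact ⟨t.equivFin ⟨x, hx⟩, by simpa using hm⟩

theorem vol_restrict (g : Metric n M) (x : M) :
    (vol g).restrict (extChartAt (𝓡 n) x).source = chartVolume g x := by
  obtain ⟨k, c, hc⟩ := exists_chart_cover n M
  refine restrict_iSup_eq (U := fun x : M => (extChartAt (𝓡 n) x).source)
    (fun x => (isOpen_extChartAt_source x).measurableSet) (fun x => ?_)
    (fun x x' A hA h h' => chartVolume_eq_on_overlap g x x' hA h h') hc x
  rw [chartVolume_apply g x (isOpen_extChartAt_source x).measurableSet.compl]
  have : (extChartAt (𝓡 n) x).target ∩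
      (extChartAt (𝓡 n) x).symm ⁻¹' ((extChartAt (𝓡 n) x).source)ᶜ = ∅ := by
    ext y
    simp only [mem_inter_iff, mem_preimage, mem_compl_iff, mem_empty_iff_false, iff_false, not_and,
      not_not]
    exact fun hy => (extChartAt (𝓡 n) x).map_target hy
  rw [this, Measure.restrict_empty, lintegral_zero_measure]

instance isFiniteMeasure_vol (g : Metric n M) : IsFiniteMeasure (vol g) := by
  have : IsLocallyFiniteMeasure (vol g) := by
    refine ⟨fun m => ?_⟩
    -- A neighbourhood of m whose image lies in a compact part K of the target: the continuous
    -- density is integrable there. Local finiteness and compactness of M give a finite measure.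
    obtain ⟨K, hKc, hKm, hKT⟩ := exists_compact_subset (isOpen_extChartAt_target (I := 𝓡 n) m)
      (mem_extChartAt_target m)
    set A := (extChartAt (𝓡 n) m).source ∩ extChartAt (𝓡 n) m ⁻¹' interior K with hA
    have hAo : IsOpen A := (continuousOn_extChartAt m).isOpen_inter_preimage
      (isOpen_extChartAt_source m) isOpen_interior
    refine ⟨A, hAo.mem_nhds ⟨mem_extChartAt_source m, hKm⟩, ?_⟩
    have h1 : vol g A = chartVolume g m A := by
      rw [← vol_restrict, Measure.restrict_apply hAo.measurableSet, inter_eq_left.2]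
      exact inter_subset_left
    have hsub : (extChartAt (𝓡 n) m).target ∩ (extChartAt (𝓡 n) m).symm ⁻¹' A ⊆ K := by
      rintro y ⟨hy, -, hyK⟩
      rw [mem_preimage, (extChartAt (𝓡 n) m).right_inv hy] at hyK
      exact interior_subset hyK
    rw [h1, chartVolume_apply g m hAo.measurableSet]
    refine (lintegral_mono_set hsub).trans_lt ?_
    exact (((continuousOn_chartDensity g m).mono hKT).integrableOn_compact hKc).lintegral_lt_top
  infer_instance

end Volume

/-! ### Calculus of differentials and of inner products of gradients -/

section Differential

variable {n : ℕ} {M : Type*} [TopologicalSpace M] [ChartedSpace (E n) M]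

/-- Smooth real functions on `M`. -/
abbrev IsSmooth (n : ℕ) {M : Type*} [TopologicalSpace M] [ChartedSpace (E n) M] (f : M → ℝ) :
    Prop := ContMDiff (𝓡 n) 𝓘(ℝ, ℝ) ∞ f

/-- The differential of a real function on `M`. -/
def dif (n : ℕ) {M : Type*} [TopologicalSpace M] [ChartedSpace (E n) M] (f : M → ℝ) (m : M) :
    E n →L[ℝ] ℝ := mfderiv (𝓡 n) 𝓘(ℝ, ℝ) f m

theorem IsSmooth.hasMFDerivAt {f : M → ℝ} (hf : IsSmooth n f) (m : M) :
    HasMFDerivAt (𝓡 n) 𝓘(ℝ, ℝ) f m (dif n f m) :=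
  ((hf m).mdifferentiableAt (by simp)).hasMFDerivAt

theorem dif_add {f k : M → ℝ} (hf : IsSmooth n f) (hk : IsSmooth n k) (m : M) :
    dif n (fun x => f x + k x) m = dif n f m + dif n k m :=
  ((hf.hasMFDerivAt m).add (hk.hasMFDerivAt m)).mfderiv

theorem dif_sub {f k : M → ℝ} (hf : IsSmooth n f) (hk : IsSmooth n k) (m : M) :
    dif n (fun x => f x - k x) m = dif n f m - dif n k m :=
  ((hf.hasMFDerivAt m).sub (hk.hasMFDerivAt m)).mfderiv

theorem dif_mul {f k : M → ℝ} (hf : IsSmooth n f) (hk : IsSmooth n k) (m : M) :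
    dif n (fun x => f x * k x) m = f m • dif n k m + k m • dif n f m :=
  ((hf.hasMFDerivAt m).mul (hk.hasMFDerivAt m)).mfderiv

theorem dif_comp {f : M → ℝ} (hf : IsSmooth n f) {F : ℝ → ℝ} {F' : ℝ} {m : M}
    (hF : HasDerivAt F F' (f m)) : dif n (fun x => F (f x)) m = F' • dif n f m := by
  have h := (hF.hasFDerivAt.hasMFDerivAt.comp m (hf.hasMFDerivAt m)).mfderiv
  refine Eq.trans (b := (ContinuousLinearMap.toSpanSingleton ℝ F').comp (dif n f m)) h ?_
  ext v
  simp [mul_comm]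

theorem dif_const_mul {f : M → ℝ} (hf : IsSmooth n f) (c : ℝ) (m : M) :
    dif n (fun x => c * f x) m = c • dif n f m :=
  dif_comp hf (by simpa using (hasDerivAt_id (f m)).const_mul c)

theorem dif_const (c : ℝ) (m : M) : dif n (fun _ : M => c) m = 0 :=
  (hasMFDerivAt_const c m).mfderiv

theorem IsSmooth.sum {ι : Type*} (t : Finset ι) {f : ι → M → ℝ} (hf : ∀ i, IsSmooth n (f i)) :
    IsSmooth n (fun x => ∑ i ∈ t, f i x) :=
  ContMDiff.sum fun i _ => hf i

theorem dif_sum {ι : Type*} (t : Finset ι) {f : ι → M → ℝ} (hf : ∀ i, IsSmooth n (f i)) (m : M) :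
    dif n (fun x => ∑ i ∈ t, f i x) m = ∑ i ∈ t, dif n (f i) m := by
  classical
  induction t using Finset.induction_on with
  | empty => simpa using dif_const 0 m
  | insert a t ha ih =>
    simp only [Finset.sum_insert ha]
    rw [dif_add (hf a) (IsSmooth.sum t hf), ih]

theorem IsSmooth.mul {f k : M → ℝ} (hf : IsSmooth n f) (hk : IsSmooth n k) :
    IsSmooth n (fun x => f x * k x) := ContMDiff.mul hf hk

theorem IsSmooth.comp {f : M → ℝ} (hf : IsSmooth n f) {F : ℝ → ℝ}
    (hF : ∀ x, ContDiffAt ℝ ∞ F (f x)) : IsSmooth n (fun x => F (f x)) :=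
  fun x => (hF x).contMDiffAt.comp x (hf x)

variable [IsManifold (𝓡 n) ∞ M]

/-- The inner product of the gradients of two functions. -/
def gradInner (g : Metric n M) (f k : M → ℝ) (m : M) : ℝ :=
  g.inner m (smoothGrad g f m) (smoothGrad g k m)

theorem gradInner_eq (g : Metric n M) (f k : M → ℝ) (m : M) :
    gradInner g f k m = dif n f m (smoothGrad g k m) := inner_smoothGrad g f m _

theorem gradInner_comm (g : Metric n M) (f k : M → ℝ) (m : M) :
    gradInner g f k m = gradInner g k f m := g.symm _ _ _

theorem gradInner_self_nonneg (g : Metric n M) (f : M → ℝ) (m : M) : 0 ≤ gradInner g f f m :=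
  inner_self_nonneg g m _

theorem continuous_gradInner (g : Metric n M) {f k : M → ℝ} (hf : IsSmooth n f)
    (hk : IsSmooth n k) : Continuous (gradInner g f k) := continuous_inner_smoothGrad g hf hk

theorem gradInner_mul_left (g : Metric n M) {f k : M → ℝ} (hf : IsSmooth n f) (hk : IsSmooth n k)
    (l : M → ℝ) (m : M) : gradInner g (fun x => f x * k x) l m =
      f m * gradInner g k l m + k m * gradInner g f l m := by
  rw [gradInner_eq, gradInner_eq, gradInner_eq, dif_mul hf hk]
  rfl

theorem gradInner_comp_left (g : Metric n M) {f : M → ℝ} (hf : IsSmooth n f) {F : ℝ → ℝ} {F' : ℝ}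
    {m : M} (hF : HasDerivAt F F' (f m)) (l : M → ℝ) :
    gradInner g (fun x => F (f x)) l m = F' * gradInner g f l m := by
  rw [gradInner_eq, gradInner_eq, dif_comp hf hF]
  rfl

theorem gradInner_sum_left (g : Metric n M) {ι : Type*} (t : Finset ι) {f : ι → M → ℝ}
    (hf : ∀ i, IsSmooth n (f i)) (l : M → ℝ) (m : M) :
    gradInner g (fun x => ∑ i ∈ t, f i x) l m = ∑ i ∈ t, gradInner g (f i) l m := by
  have h (v : E n) : (∑ i ∈ t, dif n (f i) m) v = ∑ i ∈ t, dif n (f i) m v := by simp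
  simp only [gradInner_eq, dif_sum t hf]
  exact h _

end Differential

/-! ### Green's formula on the manifold -/

section Green

variable {n : ℕ} {M : Type*} [TopologicalSpace M] [ChartedSpace (E n) M] [IsManifold (𝓡 n) ∞ M]

/-- The Laplacian of `f` computed in the preferred chart around `x`. -/
def chartLaplacian (g : Metric n M) (x : M) (f : M → ℝ) (m : M) : ℝ :=
  laplacianCoord (chartMetric g x) (inChart n x f) (extChartAt (𝓡 n) x m)

theorem continuousOn_laplacianCoord {G : E n → E n →L[ℝ] E n →L[ℝ] ℝ} {U : Set (E n)}
    (hG : IsMetricOn G U) {φ : E n → ℝ} (hφ : ContDiffOn ℝ ∞ φ U) :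
    ContinuousOn (laplacianCoord G φ) U := by
  have hN := (hG.contDiffOn_gradCoord hφ).continuousOn
  have hdN := (hG.contDiffOn_fderiv (hG.contDiffOn_gradCoord hφ)).continuousOn
  have hΓ := hG.contDiffOn_christoffel.continuousOn
  refine continuousOn_finsetSum _ fun i _ =>
    (EuclideanSpace.proj (𝕜 := ℝ) i).continuous.comp_continuousOn
      (f := fun y => covGradCoord G φ y (stdVec i)) ?_
  unfold covGradCoord
  fun_prop

theorem continuousOn_chartLaplacian (g : Metric n M) (x : M) {f : M → ℝ} (hf : IsSmooth n f) :
    ContinuousOn (chartLaplacian g x f) (extChartAt (𝓡 n) x).source :=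
  (continuousOn_laplacianCoord (isMetricOn_chartMetric g x) (contDiffOn_inChart x hf)).comp
    (continuousOn_extChartAt x) fun _ hm => (extChartAt (𝓡 n) x).map_source hm

theorem continuous_mul_of_tsupport_subset {X : Type*} [TopologicalSpace X] {a b : X → ℝ}
    {U : Set X} (hU : IsOpen U) (ha : Continuous a) (hb : ContinuousOn b U)
    (h : tsupport a ⊆ U) : Continuous fun x => a x * b x := by
  rw [continuous_iff_continuousAt]
  intro x
  by_cases hx : x ∈ tsupport a
  · exact ha.continuousAt.mul (hb.continuousAt (hU.mem_nhds (h hx)))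
  · have : (fun x => a x * b x) =ᶠ[𝓝 x] fun _ => 0 := by
      filter_upwards [(isClosed_tsupport a).isOpen_compl.mem_nhds hx] with z hz
      rw [image_eq_zero_of_notMem_tsupport hz, zero_mul]
    exact continuousAt_const.congr this.symm

variable [MeasurableSpace M] [BorelSpace M] [CompactSpace M]

theorem integral_vol_eq_chart (g : Metric n M) (x : M) {F : M → ℝ} (hF : Continuous F)
    (hs : ∀ m, m ∉ (extChartAt (𝓡 n) x).source → F m = 0) :
    ∫ m, F m ∂(vol g) = ∫ y in (extChartAt (𝓡 n) x).target,
      chartDensity g x y * F ((extChartAt (𝓡 n) x).symm y) := by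
  have : SecondCountableTopology M := ChartedSpace.secondCountable_of_sigmaCompact (E n) M
  rw [← integral_chartVolume g x hF.stronglyMeasurable, ← vol_restrict,
    setIntegral_eq_integral_of_forall_compl_eq_zero hs]

variable [T2Space M]

theorem integrable_of_continuous (g : Metric n M) {F : M → ℝ} (hF : Continuous F) :
    Integrable F (vol g) := by
  rw [← integrableOn_univ]
  exact hF.continuousOn.integrableOn_compact isCompact_univ

omit [T2Space M] in
theorem integral_mul_chartLaplacian (g : Metric n M) (x : M) {f ψ : M → ℝ} (hf : IsSmooth n f)
    (hψ : IsSmooth n ψ) (hs : tsupport ψ ⊆ (extChartAt (𝓡 n) x).source) :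
    ∫ m, ψ m * chartLaplacian g x f m ∂(vol g) = -∫ m, gradInner g ψ f m ∂(vol g) := by
  set T := (extChartAt (𝓡 n) x).target with hT
  have hTo : IsOpen T := isOpen_extChartAt_target x
  set K := extChartAt (𝓡 n) x '' tsupport ψ with hK
  have hKT : K ⊆ T := by
    rintro _ ⟨m, hm, rfl⟩
    exact (extChartAt (𝓡 n) x).map_source (hs hm)
  have hKc : IsCompact K :=
    (isClosed_tsupport ψ).isCompact.image_of_continuousOn ((continuousOn_extChartAt x).mono hs)
  -- The chart expression of ψ is meaningful on the target only. Extended by zero it is smooth on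
  -- ℝⁿ, since it vanishes off the compact image K of the support of ψ.
  set Ψ : E n → ℝ := T.indicator (inChart n x ψ) with hΨ
  have hΨT : EqOn Ψ (inChart n x ψ) T := fun y hy => indicator_of_mem hy _
  have hΨK (y : E n) (hy : y ∉ K) : Ψ y = 0 := by
    by_cases hyT : y ∈ T
    · rw [hΨT hyT]
      refine image_eq_zero_of_notMem_tsupport (f := ψ) fun h => hy ⟨_, h, ?_⟩
      exact (extChartAt (𝓡 n) x).right_inv hyT
    · exact indicator_of_notMem hyT _
  have hts : tsupport Ψ ⊆ K :=
    closure_minimal (fun y hy => by_contra fun h => hy (hΨK y h)) hKc.isClosed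
  have hsm : ContDiff ℝ ∞ Ψ := by
    rw [contDiff_iff_contDiffAt]
    intro y
    by_cases hy : y ∈ K
    · exact ((contDiffOn_inChart x hψ).contDiffAt (hTo.mem_nhds (hKT hy))).congr_of_eventuallyEq
        (hΨT.eventuallyEq_of_mem (hTo.mem_nhds (hKT hy)))
    · refine (contDiffAt_const (c := (0 : ℝ))).congr_of_eventuallyEq ?_
      filter_upwards [hKc.isClosed.isOpen_compl.mem_nhds hy] with z hz using hΨK z hz
  have key := (isMetricOn_chartMetric g x).integral_laplacianCoord (contDiffOn_inChart x hf) hsm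
    (hKc.of_isClosed_subset (isClosed_tsupport _) hts) (hts.trans hKT)
  rw [integral_vol_eq_chart g x (continuous_mul_of_tsupport_subset (isOpen_extChartAt_source x)
      hψ.continuous (continuousOn_chartLaplacian g x hf) hs) fun m hm => by
        rw [image_eq_zero_of_notMem_tsupport fun h => hm (hs h), zero_mul],
    integral_vol_eq_chart g x (continuous_gradInner g hψ hf) fun m hm => ?_]
  · have e1 : ∫ y in T, chartDensity g x y * (ψ ((extChartAt (𝓡 n) x).symm y) *
        chartLaplacian g x f ((extChartAt (𝓡 n) x).symm y)) =
        ∫ y, √(gram (chartMetric g x y)).det *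
          (Ψ y * laplacianCoord (chartMetric g x) (inChart n x f) y) := by
      refine Eq.trans ?_ (setIntegral_eq_integral_of_forall_compl_eq_zero (s := T)
        fun y hy => by rw [hΨ, indicator_of_notMem hy]; simp)
      refine setIntegral_congr_fun hTo.measurableSet fun y hy => ?_
      simp only [chartLaplacian]
      rw [(extChartAt (𝓡 n) x).right_inv hy, hΨT hy]
      rfl
    have e2 : ∫ y in T, chartDensity g x y * gradInner g ψ f ((extChartAt (𝓡 n) x).symm y) =
        ∫ y, √(gram (chartMetric g x y)).det *
          fderiv ℝ Ψ y (gradCoord (chartMetric g x) (inChart n x f) y) := by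
      refine Eq.trans ?_ (setIntegral_eq_integral_of_forall_compl_eq_zero (s := T)
        fun y hy => by rw [fderiv_of_notMem_tsupport ℝ fun h => hy (hKT (hts h))]; simp)
      refine setIntegral_congr_fun hTo.measurableSet fun y hy => ?_
      rw [gradInner, inner_smoothGrad_chartInv g hψ hf hy,
        (hΨT.eventuallyEq_of_mem (hTo.mem_nhds hy)).fderiv_eq]
      rfl
    rw [e1, e2, key]
  · have h0 : ψ =ᶠ[𝓝 m] fun _ => 0 := by
      filter_upwards [(isClosed_tsupport ψ).isOpen_compl.mem_nhds fun h => hm (hs h)] with z hz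
        using image_eq_zero_of_notMem_tsupport hz
    have h1 : dif n ψ m = 0 := h0.mfderiv_eq.trans (dif_const 0 m)
    rw [gradInner_eq, h1]
    rfl

/-- L is the sum of the chart Laplacians weighted by a partition of unity, which makes Green's
formula global without comparing these Laplacians on overlaps. The last clause recovers the value of
L wherever a formula shows that the chart Laplacians have a common value. -/
theorem exists_laplacian (g : Metric n M) {f : M → ℝ} (hf : IsSmooth n f) :
    ∃ L : M → ℝ, Continuous L ∧
      (∀ ψ, IsSmooth n ψ → ∫ m, ψ m * L m ∂(vol g) = -∫ m, gradInner g ψ f m ∂(vol g)) ∧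
      ∀ m a, (∀ x, m ∈ (extChartAt (𝓡 n) x).source → chartLaplacian g x f m = a) → L m = a := by
  obtain ⟨k, c, hc⟩ := exists_chart_cover n M
  obtain ⟨ρ, hρ⟩ := SmoothPartitionOfUnity.exists_isSubordinate (𝓡 n) isClosed_univ
    (fun j : Fin k => (extChartAt (𝓡 n) (c j)).source) (fun j => isOpen_extChartAt_source _)
    hc.ge
  have hρs (j : Fin k) : IsSmooth n (ρ j) := (ρ j).contMDiff
  have hρ1 (m : M) : ∑ j, ρ j m = 1 := by
    rw [← finsum_eq_sum_of_fintype]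
    exact ρ.sum_eq_one (mem_univ m)
  have hcont (j : Fin k) : Continuous fun m => ρ j m * chartLaplacian g (c j) f m :=
    continuous_mul_of_tsupport_subset (isOpen_extChartAt_source _) (hρs j).continuous
      (continuousOn_chartLaplacian g _ hf) (hρ j)
  refine ⟨fun m => ∑ j, ρ j m * chartLaplacian g (c j) f m,
    continuous_finsetSum _ fun j _ => hcont j, fun ψ hψ => ?_, fun m a h => ?_⟩
  · have e1 (j : Fin k) : ∫ m, ψ m * (ρ j m * chartLaplacian g (c j) f m) ∂(vol g) =
        -∫ m, gradInner g (fun m => ψ m * ρ j m) f m ∂(vol g) := by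
      rw [← integral_mul_chartLaplacian g (c j) hf (hψ.mul (hρs j))
        ((tsupport_mul_subset_right).trans (hρ j))]
      simp only [mul_assoc]
    simp only [Finset.mul_sum]
    rw [integral_finsetSum (f := fun j m => ψ m * (ρ j m * chartLaplacian g (c j) f m)) _
      fun j _ => integrable_of_continuous g (hψ.continuous.mul (hcont j))]
    simp only [e1]
    rw [Finset.sum_neg_distrib, ← integral_finsetSum _ fun j _ =>
      integrable_of_continuous g (continuous_gradInner g (hψ.mul (hρs j)) hf)]
    -- As the ρ j add up to 1, the gradients of the ψ ρ j add up to that of ψ.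
    congr 2
    ext m
    rw [← gradInner_sum_left g _ fun j => hψ.mul (hρs j)]
    simp only [← Finset.mul_sum, hρ1, mul_one]
  · have h2 (j : Fin k) : ρ j m * chartLaplacian g (c j) f m = ρ j m * a := by
      by_cases hm : m ∈ tsupport (ρ j)
      · rw [h _ (hρ j hm)]
      · rw [image_eq_zero_of_notMem_tsupport hm, zero_mul, zero_mul]
    simp only [h2, ← Finset.sum_mul, hρ1, one_mul]

end Green

/-! ### Conformal invariance of the quadratic form -/

section ConformalChange

variable {n : ℕ} {M : Type*} [TopologicalSpace M] [ChartedSpace (E n) M] [IsManifold (𝓡 n) ∞ M]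

/-- `h = e^{2φ} g`. -/
def IsConformalTo (g h : Metric n M) (φ : M → ℝ) : Prop :=
  ∀ (x : M) (a b : TangentSpace (𝓡 n) x), h.inner x a b = Real.exp (2 * φ x) * g.inner x a b

/-- The quadratic form `⟨f, f⟩_g` for smooth functions. -/
def smoothForm [MeasurableSpace M] (g : Metric n M) (f : M → ℝ) : ℝ :=
  4 * (((n : ℝ) - 1) / ((n : ℝ) - 2)) * (∫ m, gradInner g f f m ∂(vol g))
    + ∫ m, scalarCurvature g m * (f m) ^ 2 ∂(vol g)

namespace IsConformalTo

variable {g h : Metric n M} {φ : M → ℝ}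

theorem chartMetric_eq (hc : IsConformalTo g h φ) (x : M) :
    chartMetric h x = conformalCoord (chartMetric g x) (inChart n x φ) := by
  ext y u v
  exact hc _ _ _

theorem gradInner_eq (hc : IsConformalTo g h φ) (f k : M → ℝ) (m : M) :
    gradInner h f k m = Real.exp (-(2 * φ m)) * gradInner g f k m := by
  have h1 : smoothGrad h k m = (Real.exp (-(2 * φ m)) • smoothGrad g k m : E n) := by
    refine (isMetricOn_inner h m).ext_apply (mem_univ (0 : E n)) fun z => ?_
    refine (inner_smoothGrad h k m z).trans ?_
    refine Eq.trans ?_ (hc m (Real.exp (-(2 * φ m)) • smoothGrad g k m : E n) z).symm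
    have h2 : g.inner m (Real.exp (-(2 * φ m)) • smoothGrad g k m : E n) z =
        Real.exp (-(2 * φ m)) * g.inner m (smoothGrad g k m) z := by
      have := congrArg (fun L : E n →L[ℝ] ℝ => L z)
        ((g.inner m : E n →L[ℝ] E n →L[ℝ] ℝ).map_smul (Real.exp (-(2 * φ m))) (smoothGrad g k m))
      exact this
    rw [h2, Real.exp_neg, mul_inv_cancel_left₀ (Real.exp_pos _).ne']
    exact (inner_smoothGrad g k m z).symm
  rw [Yamabe.gradInner_eq, Yamabe.gradInner_eq, h1]
  exact (dif n f m).map_smul _ _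

theorem scalarCurvature_eq (hc : IsConformalTo g h φ) (hφ : IsSmooth n φ) {x m : M}
    (hm : m ∈ (extChartAt (𝓡 n) x).source) : Real.exp (2 * φ m) * scalarCurvature h m =
      scalarCurvature g m - 2 * ((n : ℝ) - 1) * chartLaplacian g x φ m
        - ((n : ℝ) - 2) * ((n : ℝ) - 1) * gradInner g φ φ m := by
  have hy := (extChartAt (𝓡 n) x).map_source hm
  have h1 := (isMetricOn_chartMetric g x).scalarCurvatureCoord_conformal
    (contDiffOn_inChart x hφ) hy
  have h2 : gradInner g φ φ _ = _ := inner_smoothGrad_chartInv g hφ hφ hy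
  rw [← chartMetric_eq hc, ← Yamabe.scalarCurvature_eq h hm, ← Yamabe.scalarCurvature_eq g hm,
    ← h2, inChart, (extChartAt (𝓡 n) x).left_inv hm] at h1
  exact h1

theorem chartDensity_eq (hc : IsConformalTo g h φ) (x : M) (y : E n) :
    chartDensity h x y = Real.exp (n * φ ((extChartAt (𝓡 n) x).symm y)) * chartDensity g x y := by
  have hg : gram (chartMetric h x y) =
      Real.exp (2 * φ ((extChartAt (𝓡 n) x).symm y)) • gram (chartMetric g x y) := by
    rw [chartMetric_eq hc]
    rfl
  have he : Real.exp (2 * φ ((extChartAt (𝓡 n) x).symm y)) ^ n =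
      Real.exp (n * φ ((extChartAt (𝓡 n) x).symm y)) ^ 2 := by
    rw [← Real.exp_nat_mul, ← Real.exp_nat_mul]
    congr 1
    push_cast
    ring
  rw [chartDensity, hg, Matrix.det_smul, Fintype.card_fin, he, Real.sqrt_mul (sq_nonneg _),
    Real.sqrt_sq (Real.exp_pos _).le]
  rfl

variable [MeasurableSpace M] [BorelSpace M] [CompactSpace M]

theorem vol_eq (hc : IsConformalTo g h φ) (hφ : Continuous φ) :
    vol h = (vol g).withDensity fun m => ENNReal.ofReal (Real.exp (n * φ m)) := by
  obtain ⟨k, c, hcov⟩ := exists_chart_cover n M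
  have hw : Measurable fun m => ENNReal.ofReal (Real.exp (n * φ m)) :=
    (Real.continuous_exp.comp (continuous_const.mul hφ)).measurable.ennreal_ofReal
  refine Measure.ext_of_iUnion_eq_univ hcov fun j => ?_
  rw [restrict_withDensity (isOpen_extChartAt_source _).measurableSet, vol_restrict, vol_restrict]
  ext A hA
  rw [withDensity_apply _ hA, ← lintegral_indicator hA,
    lintegral_chartVolume g _ (hw.indicator hA), ← lintegral_indicator_one hA,
    lintegral_chartVolume h _ (measurable_one.indicator hA)]
  refine lintegral_congr fun y => ?_
  rw [chartDensity_eq hc, ENNReal.ofReal_mul (Real.exp_pos _).le]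
  by_cases hy : (extChartAt (𝓡 n) (c j)).symm y ∈ A
  · simp only [indicator_of_mem hy, Pi.one_apply]
    ring
  · simp only [indicator_of_notMem hy, mul_zero]

theorem integral_vol_eq (hc : IsConformalTo g h φ) (hφ : Continuous φ) (F : M → ℝ) :
    ∫ m, F m ∂(vol h) = ∫ m, Real.exp (n * φ m) * F m ∂(vol g) := by
  have hw : Measurable fun m => ENNReal.ofReal (Real.exp (n * φ m)) :=
    (Real.continuous_exp.comp (continuous_const.mul hφ)).measurable.ennreal_ofReal
  rw [vol_eq hc hφ, integral_withDensity_eq_integral_toReal_smul hw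
    (ae_of_all _ fun _ => ENNReal.ofReal_lt_top)]
  simp [ENNReal.toReal_ofReal (Real.exp_pos _).le]

variable [T2Space M]

/-- Conformal invariance of the quadratic form: `⟨f, f⟩_h = ⟨wf, wf⟩_g` for
`h = w^{4/(n-2)} g`. -/
theorem smoothForm_eq (hn : 3 ≤ n) (hc : IsConformalTo g h φ) (hφ : IsSmooth n φ) {f : M → ℝ}
    (hf : IsSmooth n f) :
    smoothForm h f = smoothForm g fun m => Real.exp (((n : ℝ) - 2) / 2 * φ m) * f m := by
  have hn2 : (n : ℝ) - 2 ≠ 0 := by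
    have : (3 : ℝ) ≤ n := by exact_mod_cast hn
    linarith
  obtain ⟨L, hLc, hL, hLa⟩ := exists_laplacian g hφ
  have hR (m : M) : Real.exp (2 * φ m) * scalarCurvature h m = scalarCurvature g m
      - 2 * ((n : ℝ) - 1) * L m - ((n : ℝ) - 2) * ((n : ℝ) - 1) * gradInner g φ φ m := by
    have hn1 : (n : ℝ) - 1 ≠ 0 := by
      have : (3 : ℝ) ≤ n := by exact_mod_cast hn
      linarith
    -- The conformal formula in any chart, solved for the Laplacian of φ: the result does not
    -- mention the chart.
    have := hLa m ((scalarCurvature g m - ((n : ℝ) - 2) * ((n : ℝ) - 1) * gradInner g φ φ m -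
      Real.exp (2 * φ m) * scalarCurvature h m) / (2 * ((n : ℝ) - 1))) fun x hm => by
        rw [scalarCurvature_eq hc hφ hm]
        field_simp
        ring
    rw [this]
    field_simp
    ring
  set W : M → ℝ := fun m => Real.exp (((n : ℝ) - 2) * φ m) with hW
  have hWs : IsSmooth n W := hφ.comp (F := fun t => Real.exp (((n : ℝ) - 2) * t)) fun _ => by
    fun_prop
  set w : M → ℝ := fun m => Real.exp (((n : ℝ) - 2) / 2 * φ m) with hw
  have hws : IsSmooth n w := hφ.comp (F := fun t => Real.exp (((n : ℝ) - 2) / 2 * t)) fun _ => by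
    fun_prop
  have hwW (m : M) : w m ^ 2 = W m := by
    rw [hw, hW, ← Real.exp_nat_mul]
    congr 1
    push_cast
    ring
  have hdW (l : M → ℝ) (m : M) : gradInner g W l m = ((n : ℝ) - 2) * W m * gradInner g φ l m :=
    gradInner_comp_left g hφ (F := fun t => Real.exp (((n : ℝ) - 2) * t)) (by
      have := ((hasDerivAt_id (φ m)).const_mul ((n : ℝ) - 2)).exp
      simpa [hW, mul_comm] using this) l
  have hdw (l : M → ℝ) (m : M) : gradInner g w l m =
      ((n : ℝ) - 2) / 2 * w m * gradInner g φ l m :=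
    gradInner_comp_left g hφ (F := fun t => Real.exp (((n : ℝ) - 2) / 2 * t)) (by
      have := ((hasDerivAt_id (φ m)).const_mul (((n : ℝ) - 2) / 2)).exp
      simpa [hw, mul_comm] using this) l
  have hff : IsSmooth n fun m => f m * f m := hf.mul hf
  -- Testing with W f², where W = w² = e^{(n-2)φ}, replaces the Laplacian of φ by first-order terms:
  -- a cross term 4(n-1) W f ∇f·∇φ and a multiple of W f² |∇φ|². Together with the curvature formula
  -- they complete 4(n-1)/(n-2) W |∇f|² to 4(n-1)/(n-2) |∇(wf)|².
  have hgreen := hL (fun m => W m * (f m * f m)) (hWs.mul hff)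
  have hgrad (m : M) : gradInner g (fun m => W m * (f m * f m)) φ m =
      W m * (2 * f m * gradInner g f φ m + ((n : ℝ) - 2) * f m ^ 2 * gradInner g φ φ m) := by
    rw [gradInner_mul_left g hWs hff, gradInner_mul_left g hf hf, hdW]
    ring
  have hgradwf (m : M) : gradInner g (fun m => w m * f m) (fun m => w m * f m) m =
      W m * (gradInner g f f m + ((n : ℝ) - 2) * f m * gradInner g f φ m
        + (((n : ℝ) - 2) / 2) ^ 2 * f m ^ 2 * gradInner g φ φ m) := by
    rw [gradInner_mul_left g hws hf, gradInner_comm g f, gradInner_comm g w,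
      gradInner_mul_left g hws hf, gradInner_mul_left g hws hf, hdw, gradInner_comm g f w, hdw,
      hdw w, gradInner_comm g φ w, hdw φ,
      gradInner_comm g φ f, ← hwW]
    ring
  have cW := hWs.continuous
  have cf := hf.continuous
  have cRg := continuous_scalarCurvature g
  have c1 := continuous_gradInner g hf hf
  have c2 := continuous_gradInner g hf hφ
  have c3 := continuous_gradInner g hφ hφ
  have e1 : smoothForm h f = (∫ m, W m * (4 * (((n : ℝ) - 1) / ((n : ℝ) - 2)) * gradInner g f f m
      + f m ^ 2 * scalarCurvature g m
      - ((n : ℝ) - 2) * ((n : ℝ) - 1) * (f m ^ 2 * gradInner g φ φ m)) ∂(vol g))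
      - 2 * ((n : ℝ) - 1) * ∫ m, W m * (f m * f m) * L m ∂(vol g) := by
    rw [smoothForm, integral_vol_eq hc hφ.continuous, integral_vol_eq hc hφ.continuous,
      ← integral_const_mul, ← integral_const_mul, ← integral_add, ← integral_sub]
    · refine integral_congr_ae (ae_of_all _ fun m => ?_)
      -- The volume contributes e^{nφ}; a factor e^{2φ} is used up by the gradient term or by the
      -- scalar curvature, and W remains.
      have h2 : Real.exp (n * φ m) = W m * Real.exp (2 * φ m) := by
        rw [hW, ← Real.exp_add]
        congr 1
        ring
      have h3 : Real.exp (n * φ m) * gradInner h f f m = W m * gradInner g f f m := by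
        rw [IsConformalTo.gradInner_eq hc, h2, Real.exp_neg]
        have := (Real.exp_pos (2 * φ m)).ne'
        field_simp
      have h4 : Real.exp (n * φ m) * (scalarCurvature h m * f m ^ 2) =
          W m * f m ^ 2 * (Real.exp (2 * φ m) * scalarCurvature h m) := by
        rw [h2]
        ring
      simp only [h3, h4, hR]
      ring
    · exact integrable_of_continuous g (by fun_prop)
    · exact integrable_of_continuous g (by fun_prop)
    · refine integrable_of_continuous g ?_
      have := continuous_gradInner h hf hf
      have := hφ.continuous
      fun_prop
    · refine integrable_of_continuous g ?_
      have := continuous_scalarCurvature h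
      have := hφ.continuous
      fun_prop
  change _ = smoothForm g fun m => w m * f m
  rw [e1, hgreen, smoothForm]
  simp only [hgrad, hgradwf]
  rw [mul_neg, sub_neg_eq_add, ← integral_const_mul, ← integral_const_mul, ← integral_add,
    ← integral_add]
  · refine integral_congr_ae (ae_of_all _ fun m => ?_)
    simp only [mul_pow, hwW]
    field_simp
    ring
  all_goals
    refine integrable_of_continuous g ?_
    have := hws.continuous
    fun_prop

end IsConformalTo

theorem exists_isConformalTo (hn : 3 ≤ n) {g h : Metric n M} (hh : h ∈ conformalClass g) :
    ∃ φ : M → ℝ, IsSmooth n φ ∧ IsConformalTo g h φ := by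
  obtain ⟨w, hw, hgh⟩ := hh
  have hn2 : (n : ℝ) - 2 ≠ 0 := by
    have : (3 : ℝ) ≤ n := by exact_mod_cast hn
    linarith
  refine ⟨fun m => 2 / ((n : ℝ) - 2) * Real.log (w m), ?_, fun x a b => ?_⟩
  · exact IsSmooth.comp (F := fun t => 2 / ((n : ℝ) - 2) * Real.log t) w.contMDiff fun x =>
      contDiffAt_const.mul (Real.contDiffAt_log.2 (hw x).ne')
  · rw [hgh, Real.rpow_def_of_pos (hw x)]
    congr 2
    field_simp
    ring

end ConformalChange

/-! ### Measurable vector fields -/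

section Fields

variable {n : ℕ} {M : Type*} [TopologicalSpace M] [ChartedSpace (E n) M] [IsManifold (𝓡 n) ∞ M]

/-- The inner product `g_x` as a bilinear form on `ℝⁿ`. -/
def ip (g : Metric n M) (x : M) : E n →L[ℝ] E n →L[ℝ] ℝ := g.inner x

/-- The gradient of `f` as an `ℝⁿ`-valued function. -/
def gr (g : Metric n M) (f : M → ℝ) (x : M) : E n := smoothGrad g f x

theorem ip_symm (g : Metric n M) (x : M) (v w : E n) : ip g x v w = ip g x w v := g.symm x v w

theorem ip_self_nonneg (g : Metric n M) (x : M) (v : E n) : 0 ≤ ip g x v v :=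
  inner_self_nonneg g x v

theorem ip_gr (g : Metric n M) (f : M → ℝ) (x : M) (v : E n) :
    ip g x (gr g f x) v = dif n f x v := inner_smoothGrad g f x v

theorem gradInner_eq_ip (g : Metric n M) (f k : M → ℝ) (x : M) :
    gradInner g f k x = ip g x (gr g f x) (gr g k x) := rfl

theorem ip_ext (g : Metric n M) (x : M) {v w : E n} (h : ∀ z, ip g x v z = ip g x w z) : v = w :=
  (isMetricOn_inner g x).ext_apply (mem_univ (0 : E n)) h

theorem gr_sub (g : Metric n M) {f k : M → ℝ} (hf : IsSmooth n f) (hk : IsSmooth n k) (x : M) :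
    gr g (fun x => f x - k x) x = gr g f x - gr g k x := by
  refine ip_ext g x fun z => ?_
  rw [map_sub, sub_apply, ip_gr, ip_gr, ip_gr, dif_sub hf hk, sub_apply]

theorem gr_const_mul (g : Metric n M) {f : M → ℝ} (hf : IsSmooth n f) (c : ℝ) (x : M) :
    gr g (fun x => c * f x) x = c • gr g f x := by
  refine ip_ext g x fun z => ?_
  rw [map_smul, smul_apply, ip_gr, ip_gr, dif_const_mul hf, smul_apply]

theorem two_ip_le (g : Metric n M) (x : M) (v w : E n) {ε : ℝ} (hε : 0 < ε) :
    |2 * ip g x v w| ≤ ε * ip g x v v + ε⁻¹ * ip g x w w := by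
  -- Expansion of ε⁻¹ |εv + sw|² ≥ 0, used with s = 1 and s = -1.
  have h (s : ℝ) (hs : s ^ 2 = 1) :
      0 ≤ ε * ip g x v v + 2 * s * ip g x v w + ε⁻¹ * ip g x w w := by
    have h1 := ip_self_nonneg g x (ε • v + s • w)
    have h2 := mul_nonneg (inv_pos.2 hε).le h1
    simp only [map_add, map_smul, add_apply, smul_apply, smul_eq_mul, ip_symm g x w v] at h2
    have h3 : ε⁻¹ * (ε * (ε * ip g x v v) + s * (ε * ip g x v w)
        + (ε * (s * ip g x v w) + s * (s * ip g x w w))) =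
        ε * ip g x v v + 2 * s * ip g x v w + s ^ 2 * (ε⁻¹ * ip g x w w) := by
      field_simp
      ring
    rw [hs, one_mul] at h3
    linarith
  rw [abs_le]
  constructor
  · linarith [h 1 (by norm_num)]
  · linarith [h (-1) (by norm_num)]

theorem exists_norm_sq_le_ip (g : Metric n M) (x : M) :
    ∃ C : ℝ, 0 ≤ C ∧ ∀ v : E n, ‖v‖ ^ 2 ≤ C * ip g x v v := by
  have hb : Bornology.IsVonNBounded ℝ {v : E n | ip g x v v < 1} := g.isVonNBounded x
  obtain ⟨r, hr⟩ := (NormedSpace.isVonNBounded_iff ℝ).1 hb |>.subset_closedBall 0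
  refine ⟨2 * r ^ 2, by positivity, fun v => ?_⟩
  by_cases hv : v = 0
  · simp [hv]
  have hp : 0 < ip g x v v := g.pos x v hv
  -- Scaled so that g(sv, sv) = 1/2, which puts sv in the bounded unit ball of the metric and
  -- accounts for the constant 2r².
  set s := (√(2 * ip g x v v))⁻¹ with hs
  have hs2 : s ^ 2 * (2 * ip g x v v) = 1 := by
    rw [hs, inv_pow, Real.sq_sqrt (by positivity), inv_mul_cancel₀ (by positivity)]
  have h1 : s • v ∈ Metric.closedBall (0 : E n) r := by
    refine hr ?_
    simp only [mem_ofPred_eq, map_smul, smul_apply, smul_eq_mul]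
    nlinarith
  rw [mem_closedBall_zero_iff, norm_smul] at h1
  have h2 : s ^ 2 * ‖v‖ ^ 2 ≤ r ^ 2 := by
    have := pow_le_pow_left₀ (by positivity) h1 2
    rwa [mul_pow, Real.norm_eq_abs, sq_abs] at this
  have h3 := mul_le_mul_of_nonneg_right h2 (by positivity : 0 ≤ 2 * ip g x v v)
  nlinarith [sq_nonneg ‖v‖]

variable [T2Space M] [CompactSpace M]

variable (n M) in
/-- There are finitely many smooth functions on `M` whose differentials span all cotangent
spaces. -/
theorem exists_frame : ∃ (N : ℕ) (e : Fin N → M → ℝ), (∀ j, IsSmooth n (e j)) ∧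
    ∀ x (v : E n), (∀ j, dif n (e j) x v = 0) → v = 0 := by
  -- Coordinates of a Whitney embedding; its differential is injective.
  obtain ⟨N, e, he, -, hinj⟩ := exists_embedding_euclidean_of_compact (I := 𝓡 n) (M := M)
  refine ⟨N, fun j x => e x j, fun j => ?_, fun x v hv => ?_⟩
  · exact (EuclideanSpace.proj (𝕜 := ℝ) j : E N →L[ℝ] ℝ).contDiff.contMDiff.comp he
  · refine hinj x (Eq.trans ?_ (map_zero _).symm)
    set D : E n →L[ℝ] E N := mfderiv (𝓡 n) (𝓡 N) e x with hD
    change D v = 0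
    ext j
    have h1 : HasMFDerivAt (𝓡 n) 𝓘(ℝ, ℝ) (fun x => e x j) x
        ((EuclideanSpace.proj (𝕜 := ℝ) j : E N →L[ℝ] ℝ).comp D) :=
      (EuclideanSpace.proj (𝕜 := ℝ) j : E N →L[ℝ] ℝ).hasFDerivAt.hasMFDerivAt.comp x
        ((he x).mdifferentiableAt (by simp)).hasMFDerivAt
    have h2 : dif n (fun x => e x j) x = (EuclideanSpace.proj (𝕜 := ℝ) j : E N →L[ℝ] ℝ).comp D :=
      h1.mfderiv
    have h3 := hv j
    rw [h2] at h3
    exact h3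

/-- `g_x(v, v)` is the supremum of `2 dk_x(v) - |∇k(x)|²` over the rational linear combinations `k`
of a frame. -/
theorem exists_countable_sup (g : Metric n M) : ∃ (ι : Type) (_ : Countable ι) (k : ι → M → ℝ),
    (∀ q, IsSmooth n (k q)) ∧
    ∀ x (v : E n), ip g x v v = ⨆ q, (2 * dif n (k q) x v - gradInner g (k q) (k q) x) := by
  obtain ⟨N, e, he, hspan⟩ := exists_frame n M
  refine ⟨Fin N → ℚ, inferInstance, fun q x => ∑ j, (q j : ℝ) * e j x,
    fun q => IsSmooth.sum _ fun j => contMDiff_const.mul (he j), fun x v => ?_⟩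
  have hdif (q : Fin N → ℚ) : dif n (fun x => ∑ j, (q j : ℝ) * e j x) x =
      ∑ j, (q j : ℝ) • dif n (e j) x := by
    rw [dif_sum Finset.univ (f := fun j x => (q j : ℝ) * e j x)
      fun j => contMDiff_const.mul (he j)]
    exact Finset.sum_congr rfl fun j _ => dif_const_mul (he j) _ x
  let T : (Fin N → ℝ) →ₗ[ℝ] E n := Fintype.linearCombination ℝ fun j => gr g (e j) x
  have hT (c : Fin N → ℝ) : T c = ∑ j, c j • gr g (e j) x :=
    Fintype.linearCombination_apply ℝ _ c
  have hgr (q : Fin N → ℚ) : gr g (fun x => ∑ j, (q j : ℝ) * e j x) x = T fun j => (q j : ℝ) := by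
    refine ip_ext g x fun z => ?_
    rw [ip_gr, hdif, hT]
    simp [ip_gr]
  -- If the gradients of the frame did not span, a nonzero functional ξ would kill them; its metric
  -- dual w is then annihilated by all differentials of the frame, so w = 0 and ξ = 0.
  have hTsurj : Function.Surjective T := by
    rw [← LinearMap.range_eq_top]
    by_contra hne
    obtain ⟨ξ, hξ, hker⟩ := Submodule.exists_le_ker_of_lt_top _ (lt_top_iff_ne_top.2 hne)
    set w : E n := (ip g x).inverse ξ.toContinuousLinearMap with hw
    have hwξ (z : E n) : ip g x w z = ξ z := by
      have := (isMetricOn_inner g x).apply_inverse (mem_univ (0 : E n)) ξ.toContinuousLinearMap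
      exact congrArg (fun L : E n →L[ℝ] ℝ => L z) this
    refine hξ (LinearMap.ext fun z => ?_)
    have hw0 : w = 0 := hspan x w fun j => by
      rw [← ip_gr g, ip_symm, hwξ]
      have : T (Pi.single j 1) ∈ LinearMap.ker ξ := hker (LinearMap.mem_range_self T _)
      rw [LinearMap.mem_ker, hT, Finset.sum_eq_single j] at this
      · simpa using this
      · intro i _ hij
        simp [hij]
      · simp
    rw [← hwξ, hw0]
    simp
  set F : (Fin N → ℝ) → ℝ := fun c => 2 * ip g x (T c) v - ip g x (T c) (T c) with hF
  have hFq (q : Fin N → ℚ) : 2 * dif n (fun x => ∑ j, (q j : ℝ) * e j x) x v -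
      gradInner g (fun x => ∑ j, (q j : ℝ) * e j x) (fun x => ∑ j, (q j : ℝ) * e j x) x =
      F fun j => (q j : ℝ) := by
    rw [gradInner_eq_ip, ← ip_gr g, hgr]
  -- Completing the square: F(c) = g(v,v) - g(Tc - v, Tc - v). The supremum is attained at a real c
  -- with Tc = v and is approached by rational ones.
  have hFle (c : Fin N → ℝ) : F c ≤ ip g x v v := by
    have := ip_self_nonneg g x (T c - v)
    simp only [map_sub, sub_apply, ip_symm g x v (T c)] at this
    simp only [hF]
    linarith
  simp only [hFq]
  have hbdd : BddAbove (range fun q : Fin N → ℚ => F fun j => (q j : ℝ)) :=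
    ⟨ip g x v v, by rintro _ ⟨q, rfl⟩; exact hFle _⟩
  refine le_antisymm (le_of_forall_lt fun a ha => ?_) (ciSup_le fun q => hFle _)
  obtain ⟨c, hc⟩ := hTsurj v
  have hFc : Continuous F := by
    have hTc : Continuous T := T.continuous_of_finiteDimensional
    simp only [hF]
    exact (continuous_const.mul (((ip g x).continuous.comp hTc).clm_apply continuous_const)).sub
      (((ip g x).continuous.comp hTc).clm_apply hTc)
  have hmem : c ∈ F ⁻¹' Ioi a := by
    simp only [hF, mem_preimage, hc, mem_Ioi]
    linarith
  have hdense : DenseRange (Pi.map fun (_ : Fin N) (q : ℚ) => (q : ℝ)) :=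
    DenseRange.piMap fun _ => Rat.denseRange_cast
  obtain ⟨q, hq⟩ := hdense.exists_mem_open (isOpen_Ioi.preimage hFc) ⟨c, hmem⟩
  exact lt_of_lt_of_le hq (le_ciSup hbdd q)

variable [MeasurableSpace M] [BorelSpace M]

/-- The measurable vector fields. -/
def IsMeasurableField (g : Metric n M) (X : M → E n) : Prop :=
  ∀ f : M → ℝ, IsSmooth n f → AEMeasurable (fun x => dif n f x (X x)) (vol g)

namespace IsMeasurableField

variable {g : Metric n M} {X Y : M → E n}

omit [T2Space M] [CompactSpace M] [BorelSpace M] in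
theorem add (hX : IsMeasurableField g X) (hY : IsMeasurableField g Y) :
    IsMeasurableField g fun x => X x + Y x := fun f hf => by
  simp only [map_add]
  exact (hX f hf).add (hY f hf)

omit [T2Space M] [CompactSpace M] [BorelSpace M] in
theorem sub (hX : IsMeasurableField g X) (hY : IsMeasurableField g Y) :
    IsMeasurableField g fun x => X x - Y x := fun f hf => by
  simp only [map_sub]
  exact (hX f hf).sub (hY f hf)

omit [T2Space M] [CompactSpace M] [BorelSpace M] in
theorem const_smul (hX : IsMeasurableField g X) (c : ℝ) :
    IsMeasurableField g fun x => c • X x := fun f hf => by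
  simpa only [map_smul, smul_eq_mul] using (hX f hf).const_mul c

omit [T2Space M] [CompactSpace M] in
theorem smooth (g : Metric n M) {k : M → ℝ} (hk : IsSmooth n k) : IsMeasurableField g (gr g k) :=
  fun f hf => by
    have : (fun x => dif n f x (gr g k x)) = gradInner g f k := by
      ext x
      rw [← ip_gr g, gradInner_eq_ip]
    rw [this]
    exact (continuous_gradInner g hf hk).aemeasurable

/-- Measurability of a field is known only after pairing with differentials, so |X|² is written as a
countable supremum of such pairings. Polarization extends this to two fields. -/
theorem aemeasurable_ip_self (hX : IsMeasurableField g X) :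
    AEMeasurable (fun x => ip g x (X x) (X x)) (vol g) := by
  obtain ⟨ι, _, k, hk, h⟩ := exists_countable_sup g
  simp only [h]
  exact AEMeasurable.iSup fun q =>
    ((hX _ (hk q)).const_mul 2).sub (continuous_gradInner g (hk q) (hk q)).aemeasurable

theorem aemeasurable_ip (hX : IsMeasurableField g X) (hY : IsMeasurableField g Y) :
    AEMeasurable (fun x => ip g x (X x) (Y x)) (vol g) := by
  have h : (fun x => ip g x (X x) (Y x)) = fun x => 1 / 4 * (ip g x (X x + Y x) (X x + Y x)
      - ip g x (X x - Y x) (X x - Y x)) := by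
    ext x
    simp only [map_add, map_sub, add_apply, sub_apply, ip_symm g x (Y x) (X x)]
    ring
  rw [h]
  exact ((hX.add hY).aemeasurable_ip_self.sub (hX.sub hY).aemeasurable_ip_self).const_mul _

end IsMeasurableField

end Fields

/-! ### Quadratic forms on pairs of a function and a vector field -/

section Sobolev

variable {n : ℕ} {M : Type*} [TopologicalSpace M] [ChartedSpace (E n) M] [IsManifold (𝓡 n) ∞ M]
  [T2Space M] [CompactSpace M] [MeasurableSpace M] [BorelSpace M]

/-- A square integrable function together with a square integrable vector field. -/
structure IsL2Pair (g : Metric n M) (u : M → ℝ) (X : M → E n) : Prop where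
  memLp : MemLp u 2 (vol g)
  field : IsMeasurableField g X
  integrable_ip_self : Integrable (fun x => ip g x (X x) (X x)) (vol g)

/-- The quadratic form `∫ (a |X|² + R u²)`. -/
def quad (g : Metric n M) (a : ℝ) (R : M → ℝ) (u : M → ℝ) (X : M → E n) : ℝ :=
  ∫ x, (a * ip g x (X x) (X x) + R x * u x ^ 2) ∂(vol g)

/-- The square of the Sobolev norm. -/
def normSq (g : Metric n M) (u : M → ℝ) (X : M → E n) : ℝ := quad g 1 (fun _ => 1) u X

omit [T2Space M] [MeasurableSpace M] [BorelSpace M] [ChartedSpace (E n) M]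
  [IsManifold (𝓡 n) ∞ M] in
theorem exists_abs_le {R : M → ℝ} (hR : Continuous R) : ∃ K, 0 ≤ K ∧ ∀ x, |R x| ≤ K := by
  obtain ⟨K, hK⟩ := isCompact_univ.exists_bound_of_continuousOn hR.continuousOn
  exact ⟨max K 0, le_max_right _ _, fun x => (hK x (mem_univ x)).trans (le_max_left _ _)⟩

variable {g : Metric n M} {u v : M → ℝ} {X Y : M → E n}

namespace IsL2Pair

theorem smooth (g : Metric n M) {f : M → ℝ} (hf : IsSmooth n f) : IsL2Pair g f (gr g f) where
  memLp := hf.continuous.memLp_of_hasCompactSupport (HasCompactSupport.of_compactSpace f)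
  field := .smooth g hf
  integrable_ip_self := integrable_of_continuous g (continuous_gradInner g hf hf)

omit [T2Space M] [CompactSpace M] [BorelSpace M] in
theorem integrable_sq (hu : IsL2Pair g u X) : Integrable (fun x => u x ^ 2) (vol g) :=
  hu.memLp.integrable_sq

omit [T2Space M] [CompactSpace M] [BorelSpace M] in
theorem integrable_mul (hu : IsL2Pair g u X) (hv : IsL2Pair g v Y) :
    Integrable (fun x => u x * v x) (vol g) :=
  hu.memLp.integrable_mul hv.memLp

theorem integrable_ip (hu : IsL2Pair g u X) (hv : IsL2Pair g v Y) :
    Integrable (fun x => ip g x (X x) (Y x)) (vol g) := by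
  refine (hu.integrable_ip_self.add hv.integrable_ip_self).mono'
    (hu.field.aemeasurable_ip hv.field).aestronglyMeasurable (ae_of_all _ fun x => ?_)
  have := two_ip_le g x (X x) (Y x) one_pos
  rw [abs_mul, abs_two, inv_one, one_mul, one_mul] at this
  have h0 := abs_nonneg (ip g x (X x) (Y x))
  simp only [Real.norm_eq_abs, Pi.add_apply]
  linarith

theorem add (hu : IsL2Pair g u X) (hv : IsL2Pair g v Y) :
    IsL2Pair g (fun x => u x + v x) (fun x => X x + Y x) where
  memLp := hu.memLp.add hv.memLp
  field := hu.field.add hv.field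
  integrable_ip_self := by
    have : (fun x => ip g x (X x + Y x) (X x + Y x)) = fun x => ip g x (X x) (X x)
        + 2 * ip g x (X x) (Y x) + ip g x (Y x) (Y x) := by
      ext x
      simp only [map_add, add_apply, ip_symm g x (Y x) (X x)]
      ring
    rw [this]
    exact (hu.integrable_ip_self.add ((hu.integrable_ip hv).const_mul 2)).add
      hv.integrable_ip_self

omit [T2Space M] [CompactSpace M] [BorelSpace M] in
theorem const_mul (hu : IsL2Pair g u X) (c : ℝ) :
    IsL2Pair g (fun x => c * u x) (fun x => c • X x) where
  memLp := hu.memLp.const_mul c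
  field := hu.field.const_smul c
  integrable_ip_self := by
    simp only [map_smul, smul_apply, smul_eq_mul]
    exact (hu.integrable_ip_self.const_mul c).const_mul c

theorem sub (hu : IsL2Pair g u X) (hv : IsL2Pair g v Y) :
    IsL2Pair g (fun x => u x - v x) (fun x => X x - Y x) := by
  simpa only [neg_one_mul, neg_one_smul, ← sub_eq_add_neg] using hu.add (hv.const_mul (-1))

omit [T2Space M] in
theorem integrable_quad (hu : IsL2Pair g u X) (a : ℝ) {R : M → ℝ} (hR : Continuous R) :
    Integrable (fun x => a * ip g x (X x) (X x) + R x * u x ^ 2) (vol g) := by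
  obtain ⟨K, -, hK⟩ := exists_abs_le hR
  exact (hu.integrable_ip_self.const_mul a).add
    (hu.integrable_sq.bdd_mul (c := K) hR.aestronglyMeasurable (ae_of_all _ hK))

end IsL2Pair

omit [T2Space M] [CompactSpace M] [BorelSpace M] in
theorem normSq_nonneg (g : Metric n M) (u : M → ℝ) (X : M → E n) : 0 ≤ normSq g u X :=
  integral_nonneg fun x => by have := ip_self_nonneg g x (X x); positivity

omit [T2Space M] [CompactSpace M] [BorelSpace M] in
theorem quad_const_mul (a : ℝ) (R : M → ℝ) (c : ℝ) :
    quad g a R (fun x => c * u x) (fun x => c • X x) = c ^ 2 * quad g a R u X := by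
  rw [quad, quad, ← integral_const_mul]
  congr 1
  ext x
  simp only [map_smul, smul_apply, smul_eq_mul]
  ring

theorem quad_parallelogram (a : ℝ) {R : M → ℝ} (hR : Continuous R) (hu : IsL2Pair g u X)
    (hv : IsL2Pair g v Y) :
    quad g a R (fun x => u x + v x) (fun x => X x + Y x)
      + quad g a R (fun x => u x - v x) (fun x => X x - Y x)
      = 2 * quad g a R u X + 2 * quad g a R v Y := by
  simp only [quad]
  rw [← integral_const_mul, ← integral_const_mul,
    ← integral_add ((hu.add hv).integrable_quad a hR) ((hu.sub hv).integrable_quad a hR),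
    ← integral_add ((hu.integrable_quad a hR).const_mul 2) ((hv.integrable_quad a hR).const_mul 2)]
  congr 1
  ext x
  simp only [map_add, map_sub, add_apply, sub_apply]
  ring

theorem normSq_add_le (hu : IsL2Pair g u X) (hv : IsL2Pair g v Y) :
    normSq g (fun x => u x + v x) (fun x => X x + Y x) ≤ 2 * normSq g u X + 2 * normSq g v Y := by
  have := quad_parallelogram 1 (R := fun _ => 1) continuous_const hu hv
  have h2 := normSq_nonneg g (fun x => u x - v x) (fun x => X x - Y x)
  simp only [normSq] at *
  linarith

theorem normSq_sub_le (hu : IsL2Pair g u X) (hv : IsL2Pair g v Y) :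
    normSq g (fun x => u x - v x) (fun x => X x - Y x) ≤ 2 * normSq g u X + 2 * normSq g v Y := by
  have := quad_parallelogram 1 (R := fun _ => 1) continuous_const hu hv
  have h2 := normSq_nonneg g (fun x => u x + v x) (fun x => X x + Y x)
  simp only [normSq] at *
  linarith

/-- Young's inequality with a free parameter ε. No sign of a or R enters, so it yields continuity of
the indefinite form in the Sobolev norm. -/
theorem abs_quad_add_sub_le {a K : ℝ} {R : M → ℝ} (hR : Continuous R) (ha : |a| ≤ K)
    (hK : ∀ x, |R x| ≤ K) (hu : IsL2Pair g u X) (hv : IsL2Pair g v Y) {ε : ℝ} (hε : 0 < ε) :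
    |quad g a R (fun x => u x + v x) (fun x => X x + Y x) - quad g a R u X| ≤
      K * (ε * normSq g u X + (1 + ε⁻¹) * normSq g v Y) := by
  have h1 := hu.integrable_quad 1 (R := fun _ => 1) continuous_const
  have h2 := hv.integrable_quad 1 (R := fun _ => 1) continuous_const
  simp only [normSq, quad]
  rw [← integral_const_mul, ← integral_const_mul, ← integral_sub
    ((hu.add hv).integrable_quad a hR) (hu.integrable_quad a hR), ← integral_add
    (h1.const_mul _) (h2.const_mul _), ← integral_const_mul]
  refine abs_integral_le_integral_abs.trans (integral_mono_of_nonneg (ae_of_all _ fun x =>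
    abs_nonneg _) (((h1.const_mul _).add (h2.const_mul _)).const_mul _) (ae_of_all _ fun x => ?_))
  have e : a * ip g x (X x + Y x) (X x + Y x) + R x * (u x + v x) ^ 2
      - (a * ip g x (X x) (X x) + R x * u x ^ 2) =
      a * (2 * ip g x (X x) (Y x) + ip g x (Y x) (Y x)) + R x * (2 * (u x * v x) + v x ^ 2) := by
    simp only [map_add, add_apply, ip_symm g x (Y x) (X x)]
    ring
  have i1 : |2 * ip g x (X x) (Y x) + ip g x (Y x) (Y x)| ≤ ε * ip g x (X x) (X x)
      + (1 + ε⁻¹) * ip g x (Y x) (Y x) := by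
    refine (abs_add_le _ _).trans ?_
    rw [abs_of_nonneg (ip_self_nonneg g x (Y x))]
    linarith [two_ip_le g x (X x) (Y x) hε]
  have i2 : |2 * (u x * v x) + v x ^ 2| ≤ ε * u x ^ 2 + (1 + ε⁻¹) * v x ^ 2 := by
    refine (abs_add_le _ _).trans ?_
    rw [abs_of_nonneg (sq_nonneg (v x))]
    have : |2 * (u x * v x)| ≤ ε * u x ^ 2 + ε⁻¹ * v x ^ 2 := by
      have e1 : ε⁻¹ * (ε * u x + v x) ^ 2 = ε * u x ^ 2 + ε⁻¹ * v x ^ 2 + 2 * (u x * v x) := by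
        field_simp
        ring
      have e2 : ε⁻¹ * (ε * u x - v x) ^ 2 = ε * u x ^ 2 + ε⁻¹ * v x ^ 2 - 2 * (u x * v x) := by
        field_simp
        ring
      have p1 : 0 ≤ ε⁻¹ * (ε * u x + v x) ^ 2 := by positivity
      have p2 : 0 ≤ ε⁻¹ * (ε * u x - v x) ^ 2 := by positivity
      rw [abs_le]
      constructor <;> linarith
    linarith
  have hK0 : 0 ≤ K := (abs_nonneg a).trans ha
  simp only [e]
  calc _ ≤ |a| * |2 * ip g x (X x) (Y x) + ip g x (Y x) (Y x)|
        + |R x| * |2 * (u x * v x) + v x ^ 2| := by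
        rw [← abs_mul, ← abs_mul]; exact abs_add_le _ _
    _ ≤ K * (ε * ip g x (X x) (X x) + (1 + ε⁻¹) * ip g x (Y x) (Y x))
        + K * (ε * u x ^ 2 + (1 + ε⁻¹) * v x ^ 2) :=
        add_le_add (mul_le_mul ha i1 (abs_nonneg _) hK0)
          (mul_le_mul (hK x) i2 (abs_nonneg _) hK0)
    _ = _ := by ring

theorem tendsto_quad (a : ℝ) {R : M → ℝ} (hR : Continuous R) {w : ℕ → M → ℝ} {W : ℕ → M → E n}
    (hu : IsL2Pair g u X) (hw : ∀ k, IsL2Pair g (w k) (W k))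
    (h : Tendsto (fun k => normSq g (fun x => w k x - u x) fun x => W k x - X x) atTop (𝓝 0)) :
    Tendsto (fun k => quad g a R (w k) (W k)) atTop (𝓝 (quad g a R u X)) := by
  obtain ⟨K₁, hK₁0, hK₁⟩ := exists_abs_le hR
  set K := max |a| K₁
  have hKa : |a| ≤ K := le_max_left _ _
  have hKR x : |R x| ≤ K := (hK₁ x).trans (le_max_right _ _)
  have hK0 : 0 ≤ K := (abs_nonneg a).trans hKa
  have key (k : ℕ) {ε : ℝ} (hε : 0 < ε) : |quad g a R (w k) (W k) - quad g a R u X| ≤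
      K * (ε * normSq g u X
        + (1 + ε⁻¹) * normSq g (fun x => w k x - u x) fun x => W k x - X x) := by
    have := abs_quad_add_sub_le hR hKa hKR hu ((hw k).sub hu) hε
    simpa only [add_sub_cancel] using this
  rw [Metric.tendsto_nhds]
  intro η hη
  have hN := normSq_nonneg g u X
  -- Chosen so that the term K ε ‖u‖² is at most η/2; the other term tends to 0 for this fixed ε.
  set ε := η / (2 * (K * normSq g u X + 1)) with hε
  have hε0 : 0 < ε := by positivity
  have h2 : Tendsto (fun k => K * ((1 + ε⁻¹) *
      normSq g (fun x => w k x - u x) fun x => W k x - X x)) atTop (𝓝 0) := by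
    simpa using (h.const_mul (1 + ε⁻¹)).const_mul K
  filter_upwards [h2.eventually_lt_const (half_pos hη)] with k hk
  rw [Real.dist_eq]
  have h3 : K * (ε * normSq g u X) ≤ η / 2 := by
    have : ε * (K * normSq g u X + 1) = η / 2 := by
      rw [hε]
      field_simp
    nlinarith
  have := key k hε0
  rw [mul_add] at this
  linarith

/-- Polarization: twice the pairing is ‖u + w‖² - ‖w‖² - ‖u‖² in Sobolev norms, and the first and
last terms cancel in the limit. -/
theorem tendsto_pairing {w : ℕ → M → ℝ} {W : ℕ → M → E n} (hu : IsL2Pair g u X)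
    (hw : ∀ k, IsL2Pair g (w k) (W k))
    (h : Tendsto (fun k => normSq g (w k) (W k)) atTop (𝓝 0)) :
    Tendsto (fun k => ∫ x, u x * w k x ∂(vol g) + ∫ x, ip g x (X x) (W k x) ∂(vol g))
      atTop (𝓝 0) := by
  have h1 := tendsto_quad (w := fun k x => u x + w k x) (W := fun k x => X x + W k x) 1
    (R := fun _ => 1) continuous_const hu (fun k => hu.add (hw k))
    (by simpa only [add_sub_cancel_left] using h)
  have h2 := ((h1.sub h).sub_const (quad g 1 (fun _ => 1) u X)).div_const 2
  simp only [sub_zero, sub_self, zero_div] at h2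
  refine h2.congr fun k => ?_
  have hc := continuous_const (X := M) (y := (1 : ℝ))
  have hi : Integrable (fun x => 1 * ip g x (X x + W k x) (X x + W k x) + 1 * (u x + w k x) ^ 2 -
      (1 * ip g x (W k x) (W k x) + 1 * w k x ^ 2)) (vol g) :=
    ((hu.add (hw k)).integrable_quad 1 hc).sub ((hw k).integrable_quad 1 hc)
  simp only [normSq, quad]
  rw [← integral_sub ((hu.add (hw k)).integrable_quad 1 hc) ((hw k).integrable_quad 1 hc),
    ← integral_sub hi (hu.integrable_quad 1 hc), ← integral_add (hu.integrable_mul (hw k))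
      (hu.integrable_ip (hw k)), ← integral_div]
  congr 1
  ext x
  simp only [map_add, add_apply, ip_symm g x (W k x) (X x)]
  ring

end Sobolev

theorem exists_tendsto_of_dist_sq_le {α : Type*} [PseudoMetricSpace α] [CompleteSpace α]
    {s : ℕ → α} {K : ℝ} (h : ∀ k, dist (s k) (s (k + 1)) ^ 2 ≤ K * (1 / 2) ^ k) :
    ∃ a, Tendsto s atTop (𝓝 a) := by
  have hK : 0 ≤ K := by simpa using (sq_nonneg _).trans (h 0)
  refine cauchySeq_tendsto_of_complete (cauchySeq_of_le_geometric (√(1 / 2)) (√K)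
    ((Real.sqrt_lt' one_pos).2 (by norm_num)) fun k => ?_)
  refine abs_le_of_sq_le_sq' ?_ (by positivity) |>.2
  rw [mul_pow, ← pow_mul, mul_comm k 2, pow_mul, Real.sq_sqrt hK, Real.sq_sqrt (by norm_num)]
  exact h k

theorem eLpNorm_two_sq {α : Type*} [MeasurableSpace α] (μ : Measure α) (u : α → ℝ) :
    eLpNorm u 2 μ ^ 2 = ∫⁻ x, ENNReal.ofReal (u x ^ 2) ∂μ := by
  have := eLpNorm_nnreal_pow_eq_lintegral (f := u) (μ := μ) (p := 2) (by norm_num)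
  simp only [NNReal.coe_ofNat, ENNReal.coe_ofNat, ENNReal.rpow_ofNat] at this
  rw [this]
  refine lintegral_congr fun x => ?_
  rw [Real.enorm_eq_ofReal_abs, ← ENNReal.ofReal_pow (abs_nonneg _), sq_abs]

/-! ### Completeness of H¹ and uniqueness of the weak gradient -/

section Completeness

set_option linter.unusedSectionVars false

variable {n : ℕ} {M : Type*} [TopologicalSpace M] [ChartedSpace (E n) M] [IsManifold (𝓡 n) ∞ M]
  [T2Space M] [CompactSpace M] [MeasurableSpace M] [BorelSpace M]

variable {g : Metric n M} {u v : M → ℝ} {X Y : M → E n}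

/-- The pair `(u, X)` is a limit of smooth functions and their gradients. -/
def IsSobolevLimit (g : Metric n M) (f : ℕ → M → ℝ) (u : M → ℝ) (X : M → E n) : Prop :=
  (∀ k, IsSmooth n (f k)) ∧
    Tendsto (fun k => normSq g (fun x => f k x - u x) fun x => gr g (f k) x - X x) atTop (𝓝 0)

theorem IsL2Pair.ofReal_normSq (hu : IsL2Pair g u X) : ENNReal.ofReal (normSq g u X) =
    ∫⁻ x, ENNReal.ofReal (1 * ip g x (X x) (X x) + 1 * u x ^ 2) ∂(vol g) :=
  ofReal_integral_eq_lintegral_ofReal (hu.integrable_quad 1 continuous_const)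
    (ae_of_all _ fun x => by
      have := ip_self_nonneg g x (X x)
      simp only [Pi.zero_apply]
      positivity)

theorem lintegral_ofReal_ip_add (hu : AEMeasurable u (vol g)) :
    ∫⁻ x, ENNReal.ofReal (1 * ip g x (X x) (X x) + 1 * u x ^ 2) ∂(vol g) =
      (∫⁻ x, ENNReal.ofReal (ip g x (X x) (X x)) ∂(vol g)) + eLpNorm u 2 (vol g) ^ 2 := by
  rw [eLpNorm_two_sq, ← lintegral_add_right' _ (hu.pow_const 2).ennreal_ofReal]
  refine lintegral_congr fun x => ?_
  rw [one_mul, one_mul, ENNReal.ofReal_add (ip_self_nonneg g x (X x)) (sq_nonneg _)]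

theorem isL2Pair_of_lintegral_ne_top (hu : AEMeasurable u (vol g)) (hX : IsMeasurableField g X)
    (h : ∫⁻ x, ENNReal.ofReal (1 * ip g x (X x) (X x) + 1 * u x ^ 2) ∂(vol g) ≠ ⊤) :
    IsL2Pair g u X := by
  rw [lintegral_ofReal_ip_add hu, ENNReal.add_ne_top] at h
  refine ⟨⟨hu.aestronglyMeasurable, ?_⟩, hX, ⟨hX.aemeasurable_ip_self.aestronglyMeasurable, ?_⟩⟩
  · rw [lt_top_iff_ne_top]
    intro h'
    simp [h'] at h
  · rw [hasFiniteIntegral_iff_ofReal (ae_of_all _ fun x => ip_self_nonneg g x (X x))]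
    exact lt_top_iff_ne_top.2 h.1

theorem tendsto_zero_of_normSq {w : ℕ → M → ℝ} {W : ℕ → M → E n} (hw : ∀ k, IsL2Pair g (w k) (W k))
    (h : Tendsto (fun k => normSq g (w k) (W k)) atTop (𝓝 0)) :
    Tendsto (fun k => eLpNorm (w k) 2 (vol g)) atTop (𝓝 0) ∧
    Tendsto (fun k => ∫⁻ x, ENNReal.ofReal (ip g x (W k x) (W k x)) ∂(vol g)) atTop (𝓝 0) := by
  have h3 := ENNReal.tendsto_ofReal h
  simp only [(hw _).ofReal_normSq, lintegral_ofReal_ip_add (hw _).memLp.1.aemeasurable,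
    ENNReal.ofReal_zero] at h3
  refine ⟨?_, tendsto_of_tendsto_of_tendsto_of_le_of_le tendsto_const_nhds h3 (fun _ => zero_le)
    fun _ => le_self_add⟩
  have h4 : Tendsto (fun k => eLpNorm (w k) 2 (vol g) ^ 2) atTop (𝓝 0) :=
    tendsto_of_tendsto_of_tendsto_of_le_of_le tendsto_const_nhds h3 (fun _ => zero_le)
      fun _ => le_add_self
  have h5 := h4.ennrpow_const (1 / 2)
  rw [ENNReal.zero_rpow_of_pos (by norm_num)] at h5
  refine h5.congr fun k => ?_
  rw [← ENNReal.rpow_two, ← ENNReal.rpow_mul]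
  norm_num

theorem exists_subseq_tendsto_ae {w : ℕ → M → ℝ} {W : ℕ → M → E n}
    (hw : ∀ k, IsL2Pair g (w k) (W k)) (hu : IsL2Pair g u X)
    (h : Tendsto (fun k => normSq g (fun x => w k x - u x) fun x => W k x - X x) atTop (𝓝 0)) :
    ∃ ns : ℕ → ℕ, ∀ᵐ x ∂(vol g), Tendsto (fun i => w (ns i) x) atTop (𝓝 (u x)) := by
  obtain ⟨ns, -, hns⟩ := (tendstoInMeasure_of_tendsto_eLpNorm two_ne_zero
    (fun k => (hw k).memLp.1) hu.memLp.1
    (tendsto_zero_of_normSq (fun k => (hw k).sub hu) h).1).exists_seq_tendsto_ae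
  exact ⟨ns, hns⟩

theorem hasSobolevGrad_iff : HasSobolevGrad g u X ↔
    IsL2Pair g u X ∧ ∃ f, IsSobolevLimit g f u X := by
  constructor
  · rintro ⟨hu, hX, f, hf, hf'⟩
    have hX' : IsMeasurableField g X := fun e he => hX ⟨e, he⟩
    have hs k : IsSmooth n (f k) := (f k).contMDiff
    -- Square integrability of X is not part of the definition. It comes from one approximant f k at
    -- finite distance: X = ∇f k - (∇f k - X).
    have hL : IsL2Pair g u X := by
      obtain ⟨k, hk⟩ := (hf'.eventually_lt_const ENNReal.zero_lt_top).exists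
      have h1 : IsL2Pair g (fun x => f k x - u x) (fun x => gr g (f k) x - X x) := by
        have hd : MemLp (fun x => f k x - u x) 2 (vol g) := (IsL2Pair.smooth g (hs k)).memLp.sub hu
        refine isL2Pair_of_lintegral_ne_top hd.1.aemeasurable
          ((IsMeasurableField.smooth g (hs k)).sub hX') ?_
        rw [lintegral_ofReal_ip_add hd.1.aemeasurable]
        exact ENNReal.add_ne_top.2 ⟨hk.ne, ENNReal.pow_ne_top hd.2.ne⟩
      simpa only [sub_sub_cancel] using (IsL2Pair.smooth g (hs k)).sub h1
    refine ⟨hL, fun k => f k, hs, ?_⟩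
    have h2 k : IsL2Pair g (fun x => f k x - u x) (fun x => gr g (f k) x - X x) :=
      (IsL2Pair.smooth g (hs k)).sub hL
    have h3 : Tendsto (fun k => ENNReal.ofReal (normSq g (fun x => f k x - u x)
        fun x => gr g (f k) x - X x)) atTop (𝓝 0) := by
      simp only [(h2 _).ofReal_normSq, lintegral_ofReal_ip_add (h2 _).memLp.1.aemeasurable]
      have h4 := hf'.add (ENNReal.Tendsto.pow (n := 2) hf)
      rw [zero_pow two_ne_zero, add_zero] at h4
      exact h4
    have h4 := (ENNReal.tendsto_toReal ENNReal.zero_ne_top).comp h3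
    simpa [Function.comp_def, ENNReal.toReal_ofReal (normSq_nonneg g _ _)] using h4
  · rintro ⟨hL, f, hf⟩
    obtain ⟨h1, h2⟩ := tendsto_zero_of_normSq (fun k => (IsL2Pair.smooth g (hf.1 k)).sub hL) hf.2
    exact ⟨hL.memLp, fun e => hL.field e e.contMDiff, fun k => ⟨f k, hf.1 k⟩, h1, h2⟩

theorem HasSobolevGrad.isL2Pair (h : HasSobolevGrad g u X) : IsL2Pair g u X :=
  (hasSobolevGrad_iff.1 h).1

theorem HasSobolevGrad.smooth (g : Metric n M) {f : M → ℝ} (hf : IsSmooth n f) :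
    HasSobolevGrad g f (gr g f) :=
  hasSobolevGrad_iff.2 ⟨.smooth g hf, fun _ => f, fun _ => hf, by simp [normSq, quad]⟩

theorem HasSobolevGrad.congr (h : HasSobolevGrad g u X) (huv : u =ᵐ[vol g] v) :
    HasSobolevGrad g v X where
  memLp := h.memLp.ae_eq huv
  measurable := h.measurable
  approx := by
    obtain ⟨f, hf, hf'⟩ := h.approx
    refine ⟨f, hf.congr fun k => eLpNorm_congr_ae ?_, hf'⟩
    filter_upwards [huv] with x hx
    rw [hx]

theorem HasSobolevGrad.sub (hu : HasSobolevGrad g u X) (hv : HasSobolevGrad g v Y) :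
    HasSobolevGrad g (fun x => u x - v x) (fun x => X x - Y x : M → E n) := by
  obtain ⟨hu, f, hf, hfu⟩ := hasSobolevGrad_iff.1 hu
  obtain ⟨hv, k, hk, hkv⟩ := hasSobolevGrad_iff.1 hv
  refine hasSobolevGrad_iff.2 ⟨hu.sub hv, fun i x => f i x - k i x,
    fun i => (hf i).sub (hk i), ?_⟩
  have h1 := (hfu.const_mul 2).add (hkv.const_mul 2)
  simp only [mul_zero, add_zero] at h1
  refine squeeze_zero (fun _ => normSq_nonneg g _ _) (fun i => ?_) h1
  refine le_trans (le_of_eq ?_) (normSq_sub_le ((IsL2Pair.smooth g (hf i)).sub hu)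
    ((IsL2Pair.smooth g (hk i)).sub hv))
  congr 1
  · ext x
    ring
  · ext1 x
    rw [gr_sub g (hf i) (hk i)]
    module

theorem HasSobolevGrad.const_mul (hu : HasSobolevGrad g u X) (c : ℝ) :
    HasSobolevGrad g (fun x => c * u x) (fun x => c • X x : M → E n) := by
  obtain ⟨hu, f, hf, hfu⟩ := hasSobolevGrad_iff.1 hu
  refine hasSobolevGrad_iff.2 ⟨hu.const_mul c, fun i x => c * f i x,
    fun i => contMDiff_const.mul (hf i), ?_⟩
  have h1 := hfu.const_mul (c ^ 2)
  rw [mul_zero] at h1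
  refine h1.congr fun i => ?_
  rw [normSq, ← quad_const_mul]
  simp only [gr_const_mul g (hf i), ← mul_sub, ← smul_sub]
  rfl

theorem HasSobolevGrad.add (hu : HasSobolevGrad g u X) (hv : HasSobolevGrad g v Y) :
    HasSobolevGrad g (fun x => u x + v x) (fun x => X x + Y x : M → E n) := by
  simpa only [neg_one_mul, neg_one_smul, sub_neg_eq_add] using hu.sub (hv.const_mul (-1))

/-- Closability of the gradient. By Green's formula the pair (χ L + ∇χ·∇e, χ∇e), with L the
Laplacian of a frame function e, is orthogonal to (f, ∇f) for every smooth f. Along f k → 0 with ∇f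
k → X this leaves ∫ χ de(X) = 0 for every test function χ. The differentials of the frame span, so X
= 0. -/
theorem HasSobolevGrad.gradient_eq_zero (h : HasSobolevGrad g (fun _ => 0) X) :
    ∀ᵐ x ∂(vol g), X x = 0 := by
  obtain ⟨hu, f, hf, hfu⟩ := hasSobolevGrad_iff.1 h
  obtain ⟨N, e, he, hspan⟩ := exists_frame n M
  have key (j : Fin N) : ∀ᵐ x ∂(vol g), dif n (e j) x (X x) = 0 := by
    have hint : Integrable (fun x => dif n (e j) x (X x)) (vol g) := by
      have := (IsL2Pair.smooth g (he j)).integrable_ip hu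
      simpa only [ip_gr] using this
    refine ae_eq_zero_of_integral_contMDiff_smul_eq_zero (𝓡 n) hint.locallyIntegrable
      fun χ hχ _ => ?_
    obtain ⟨L, hLc, hL, -⟩ := exists_laplacian g (he j)
    have hχ' : IsSmooth n χ := hχ
    have hF : Continuous fun x => χ x * L x + gradInner g χ (e j) x :=
      (hχ'.continuous.mul hLc).add (continuous_gradInner g hχ' (he j))
    obtain ⟨K, -, hK⟩ := exists_abs_le hχ'.continuous
    have hw : IsL2Pair g (fun x => χ x * L x + gradInner g χ (e j) x)
        (fun x => χ x • gr g (e j) x) := by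
      refine ⟨hF.memLp_of_hasCompactSupport (HasCompactSupport.of_compactSpace _),
        fun k hk => ?_, ?_⟩
      · simp only [map_smul, smul_eq_mul]
        exact hχ'.continuous.aemeasurable.mul (IsMeasurableField.smooth g (he j) k hk)
      · simp only [map_smul, smul_apply, smul_eq_mul]
        exact integrable_of_continuous g (hχ'.continuous.mul (hχ'.continuous.mul
          (continuous_gradInner g (he j) (he j))))
    have hlim := tendsto_pairing hw (fun k => (IsL2Pair.smooth g (hf k)).sub hu) hfu
    -- The pairing of the test pair with (f k - 0, ∇f k - X) tends to 0, yet equals -∫ χ de(X) for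
    -- every k.
    refine neg_eq_zero.1 (tendsto_nhds_unique (tendsto_const_nhds.congr fun k => ?_) hlim)
    have i1 : ∫ x, (χ x * L x + gradInner g χ (e j) x) * (f k x - 0) ∂(vol g) =
        -∫ x, χ x * gradInner g (f k) (e j) x ∂(vol g) := by
      have i0 := hL (fun x => χ x * f k x) (hχ'.mul (hf k))
      have c1 : Integrable (fun x => χ x * f k x * L x) (vol g) :=
        integrable_of_continuous g ((hχ'.continuous.mul (hf k).continuous).mul hLc)
      have c2 : Integrable (fun x => f k x * gradInner g χ (e j) x) (vol g) :=
        integrable_of_continuous g ((hf k).continuous.mul (continuous_gradInner g hχ' (he j)))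
      have c3 : Integrable (fun x => χ x * gradInner g (f k) (e j) x) (vol g) :=
        integrable_of_continuous g (hχ'.continuous.mul (continuous_gradInner g (hf k) (he j)))
      simp only [gradInner_mul_left g hχ' (hf k)] at i0
      rw [integral_add c3 c2] at i0
      rw [show (fun x => (χ x * L x + gradInner g χ (e j) x) * (f k x - 0)) = fun x =>
        χ x * f k x * L x + f k x * gradInner g χ (e j) x by ext x; ring, integral_add c1 c2]
      linarith
    have i2 : ∫ x, ip g x (χ x • gr g (e j) x) (gr g (f k) x - X x) ∂(vol g) =
        ∫ x, χ x * gradInner g (f k) (e j) x ∂(vol g) - ∫ x, χ x • dif n (e j) x (X x) ∂(vol g) := by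
      have c3 : Integrable (fun x => χ x * gradInner g (f k) (e j) x) (vol g) :=
        integrable_of_continuous g (hχ'.continuous.mul (continuous_gradInner g (hf k) (he j)))
      have c4 : Integrable (fun x => χ x • dif n (e j) x (X x)) (vol g) :=
        hint.bdd_mul (c := K) hχ'.continuous.aestronglyMeasurable (ae_of_all _ hK)
      rw [← integral_sub c3 c4]
      congr 1
      ext x
      rw [gradInner_comm, gradInner_eq_ip, map_smul, smul_apply, map_sub, ip_gr g (e j) x (X x),
        smul_eq_mul, smul_eq_mul, mul_sub]
    rw [i1, i2]
    ring
  filter_upwards [ae_all_iff.2 key] with x hx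
  exact hspan x _ hx

theorem HasSobolevGrad.ae_eq (h : HasSobolevGrad g u X) (h' : HasSobolevGrad g u Y) :
    ∀ᵐ x ∂(vol g), X x = Y x := by
  have := HasSobolevGrad.gradient_eq_zero (X := fun x => X x - Y x) (by simpa using h.sub h')
  filter_upwards [this] with x hx using sub_eq_zero.1 hx

/-- Completeness of the Sobolev space. -/
theorem exists_isSobolevLimit {f : ℕ → M → ℝ} (hf : ∀ k, IsSmooth n (f k)) {C : ℝ}
    (h : ∀ k l, k ≤ l → normSq g (fun x => f k x - f l x) (fun x => gr g (f k) x - gr g (f l) x) ≤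
      C * (1 / 4) ^ k) :
    ∃ u X, IsL2Pair g u X ∧ IsSobolevLimit g f u X := by
  have hC : 0 ≤ C := by simpa using (normSq_nonneg g _ _).trans (h 0 0 le_rfl)
  have hd k l : IsL2Pair g (fun x => f k x - f l x) (fun x => gr g (f k) x - gr g (f l) x) :=
    (IsL2Pair.smooth g (hf k)).sub (.smooth g (hf l))
  set Q : ℕ → ℕ → M → ℝ := fun k l x => 1 * ip g x (gr g (f k) x - gr g (f l) x)
    (gr g (f k) x - gr g (f l) x) + 1 * (f k x - f l x) ^ 2 with hQ
  have hQint k l : Integrable (Q k l) (vol g) := (hd k l).integrable_quad 1 continuous_const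
  have hQ0 k l x : 0 ≤ Q k l x := by
    have := ip_self_nonneg g x (gr g (f k) x - gr g (f l) x)
    simp only [hQ]
    positivity
  have hQl k l (hkl : k ≤ l) : ∫⁻ x, ENNReal.ofReal (Q k l x) ∂(vol g) ≤
      ENNReal.ofReal (C * (1 / 4) ^ k) := by
    rw [← (hd k l).ofReal_normSq]
    exact ENNReal.ofReal_le_ofReal (h k l hkl)
  -- The integral of Q k (k+1) is at most C/4^k, so the weights 2^k still leave a convergent sum.
  -- Almost everywhere Q k (k+1) is thus at most a constant times 2^{-k}, whence the functions and,
  -- in the fixed fibre, their gradients converge pointwise.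
  have hsum : ∀ᵐ x ∂(vol g), ∑' k, ENNReal.ofReal (2 ^ k * Q k (k + 1) x) < ⊤ := by
    have hm k : AEMeasurable (fun x => ENNReal.ofReal (2 ^ k * Q k (k + 1) x)) (vol g) :=
      ((hQint k (k + 1)).1.aemeasurable.const_mul _).ennreal_ofReal
    refine ae_lt_top' (AEMeasurable.tsum hm) ?_
    rw [lintegral_tsum hm]
    have hs : Summable fun k : ℕ => C * (1 / 2 : ℝ) ^ k :=
      (summable_geometric_of_lt_one (by norm_num) (by norm_num)).mul_left C
    refine ne_top_of_le_ne_top hs.tsum_ofReal_ne_top (ENNReal.tsum_le_tsum fun k => ?_)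
    have h2k : (0 : ℝ) ≤ 2 ^ k := by positivity
    simp only [ENNReal.ofReal_mul h2k]
    rw [lintegral_const_mul' _ _ ENNReal.ofReal_ne_top]
    refine (mul_le_mul_right (hQl k (k + 1) (Nat.le_succ k)) _).trans_eq ?_
    rw [← ENNReal.ofReal_mul h2k, mul_left_comm, ← mul_pow]
    norm_num
  have hlim : ∀ᵐ x ∂(vol g), ∃ a A, Tendsto (fun k => f k x) atTop (𝓝 a) ∧
      Tendsto (fun k => gr g (f k) x) atTop (𝓝 A) := by
    filter_upwards [hsum] with x hx
    have hK k : Q k (k + 1) x ≤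
        (∑' k, ENNReal.ofReal (2 ^ k * Q k (k + 1) x)).toReal * (1 / 2) ^ k := by
      have h1 := (ENNReal.ofReal_le_iff_le_toReal hx.ne).1
        (ENNReal.le_tsum (f := fun k => ENNReal.ofReal (2 ^ k * Q k (k + 1) x)) k)
      have h2 := mul_le_mul_of_nonneg_right h1 (by positivity : (0 : ℝ) ≤ (1 / 2) ^ k)
      have h3 : (2 : ℝ) ^ k * (1 / 2) ^ k = 1 := by rw [← mul_pow]; norm_num
      calc _ = 2 ^ k * (1 / 2) ^ k * Q k (k + 1) x := by rw [h3, one_mul]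
        _ ≤ _ := by linarith
    obtain ⟨D, hD0, hD⟩ := exists_norm_sq_le_ip g x
    obtain ⟨a, ha⟩ := exists_tendsto_of_dist_sq_le (s := fun k => f k x) fun k => by
      refine le_trans ?_ (hK k)
      rw [Real.dist_eq, sq_abs]
      have := ip_self_nonneg g x (gr g (f k) x - gr g (f (k + 1)) x)
      simp only [hQ]
      linarith
    obtain ⟨A, hA⟩ := exists_tendsto_of_dist_sq_le (s := fun k => gr g (f k) x)
        (K := D * (∑' k, ENNReal.ofReal (2 ^ k * Q k (k + 1) x)).toReal) fun k => by
      rw [dist_eq_norm, mul_assoc]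
      refine (hD _).trans (mul_le_mul_of_nonneg_left (le_trans ?_ (hK k)) hD0)
      have := sq_nonneg (f k x - f (k + 1) x)
      simp only [hQ]
      linarith
    exact ⟨a, A, ha, hA⟩
  -- The limits are chosen pointwise, with default value 0 where they fail to exist, a null set.
  have hch : ∀ x, ∃ a A, (∃ a A, Tendsto (fun k => f k x) atTop (𝓝 a) ∧
      Tendsto (fun k => gr g (f k) x) atTop (𝓝 A)) → Tendsto (fun k => f k x) atTop (𝓝 a) ∧
      Tendsto (fun k => gr g (f k) x) atTop (𝓝 A) := fun x => by
    by_cases hx : ∃ a A, Tendsto (fun k => f k x) atTop (𝓝 a) ∧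
      Tendsto (fun k => gr g (f k) x) atTop (𝓝 A)
    · obtain ⟨a, A, h⟩ := hx
      exact ⟨a, A, fun _ => h⟩
    · exact ⟨0, 0, fun h => absurd h hx⟩
  choose u X huX using hch
  replace hlim : ∀ᵐ x ∂(vol g), Tendsto (fun k => f k x) atTop (𝓝 (u x)) ∧
      Tendsto (fun k => gr g (f k) x) atTop (𝓝 (X x)) := hlim.mono fun x hx => huX x hx
  have hum : AEMeasurable u (vol g) := aemeasurable_of_tendsto_metrizable_ae' (f := f)
    (fun k => (hf k).continuous.aemeasurable) (hlim.mono fun x hx => hx.1)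
  have hXm : IsMeasurableField g X := fun e he => aemeasurable_of_tendsto_metrizable_ae'
    (f := fun k x => dif n e x (gr g (f k) x)) (fun k => IsMeasurableField.smooth g (hf k) e he)
    (hlim.mono fun x hx => ((dif n e x).continuous.tendsto _).comp hx.2)
  -- Fatou's lemma in l turns the Cauchy estimate for f k - f l into the same bound for f k - u.
  have hfatou k : ∫⁻ x, ENNReal.ofReal (1 * ip g x (gr g (f k) x - X x) (gr g (f k) x - X x)
      + 1 * (f k x - u x) ^ 2) ∂(vol g) ≤ ENNReal.ofReal (C * (1 / 4) ^ k) := by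
    calc _ ≤ ∫⁻ x, liminf (fun l => ENNReal.ofReal (Q k l x)) atTop ∂(vol g) := by
          refine lintegral_mono_ae (hlim.mono fun x hx => le_of_eq (Tendsto.liminf_eq ?_).symm)
          refine ENNReal.tendsto_ofReal ?_
          have hB : Continuous fun v : E n => ip g x v v :=
            (ip g x).continuous.clm_apply continuous_id
          exact (((hB.tendsto _).comp (hx.2.const_sub _)).const_mul 1).add
            (((hx.1.const_sub _).pow 2).const_mul 1)
      _ ≤ liminf (fun l => ∫⁻ x, ENNReal.ofReal (Q k l x) ∂(vol g)) atTop :=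
          lintegral_liminf_le' fun l => (hQint k l).1.aemeasurable.ennreal_ofReal
      _ ≤ _ := liminf_le_of_frequently_le'
          ((eventually_ge_atTop k).mono fun l hl => hQl k l hl).frequently
  have hp k : IsL2Pair g (fun x => f k x - u x) (fun x => gr g (f k) x - X x) :=
    isL2Pair_of_lintegral_ne_top ((hf k).continuous.aemeasurable.sub hum)
      ((IsMeasurableField.smooth g (hf k)).sub hXm)
      (ne_top_of_le_ne_top ENNReal.ofReal_ne_top (hfatou k))
  refine ⟨u, X, by simpa only [sub_sub_cancel] using (IsL2Pair.smooth g (hf 0)).sub (hp 0), hf, ?_⟩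
  have h0 : Tendsto (fun k : ℕ => C * (1 / 4 : ℝ) ^ k) atTop (𝓝 0) := by
    simpa using (tendsto_pow_atTop_nhds_zero_of_lt_one (r := (1 / 4 : ℝ)) (by norm_num)
      (by norm_num)).const_mul C
  refine squeeze_zero (fun _ => normSq_nonneg g _ _) (fun k => ?_) h0
  have := hfatou k
  rw [← (hp k).ofReal_normSq] at this
  exact (ENNReal.ofReal_le_ofReal_iff (by positivity)).1 this

/-- The constant `4(n-1)/(n-2)`. -/
def gradCoeff (n : ℕ) : ℝ := 4 * (((n : ℝ) - 1) / ((n : ℝ) - 2))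

/-- The gradient selected in `form` agrees almost everywhere with any given one, so the form may be
computed with whichever gradient is at hand. -/
theorem form_self_eq {u : Lp ℝ 2 (vol g)} (hu : HasSobolevGrad g u X) :
    form g u u = quad g (gradCoeff n) (scalarCurvature g) u X := by
  have hex : ∃ X : ∀ x : M, TangentSpace (𝓡 n) x, HasSobolevGrad g u X := ⟨X, hu⟩
  have hg : HasSobolevGrad g u (grad g u) := by
    rw [grad, dif_pos hex]
    exact hex.choose_spec
  have hR := continuous_scalarCurvature g
  obtain ⟨K, -, hK⟩ := exists_abs_le hR
  have hL := hu.isL2Pair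
  rw [form, quad, integral_add (hL.integrable_ip_self.const_mul _)
    (hL.integrable_sq.bdd_mul (c := K) hR.aestronglyMeasurable (ae_of_all _ hK)),
    integral_const_mul]
  congr 2
  · refine integral_congr_ae ((hg.ae_eq hu).mono fun x hx => ?_)
    simp only
    rw [hx]
    rfl
  · ext x
    ring

theorem smoothForm_eq_quad (g : Metric n M) {f : M → ℝ} (hf : IsSmooth n f) :
    smoothForm g f = quad g (gradCoeff n) (scalarCurvature g) f (gr g f) := by
  have c1 : Integrable (fun x => scalarCurvature g x * f x ^ 2) (vol g) :=
    integrable_of_continuous g ((continuous_scalarCurvature g).mul (hf.continuous.pow 2))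
  rw [quad, integral_add ((IsL2Pair.smooth g hf).integrable_ip_self.const_mul _) c1,
    integral_const_mul]
  rfl

end Completeness

/-! ### The Sobolev inequality, its conformal invariance, and coercivity -/

section SobolevInequality

variable {n : ℕ} {M : Type*} [TopologicalSpace M] [ChartedSpace (E n) M] [IsManifold (𝓡 n) ∞ M]
  [T2Space M] [CompactSpace M] [MeasurableSpace M] [BorelSpace M]

set_option linter.unusedSectionVars false

/-- The Sobolev inequality `c ‖f‖²_{L^{2*}} ≤ ⟨f, f⟩` for smooth functions. -/
def SobolevInequality (g : Metric n M) (c : ℝ) : Prop :=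
  ∀ f : M → ℝ, IsSmooth n f →
    c * (eLpNorm f (ENNReal.ofReal (twoStar n)) (vol g)).toReal ^ 2 ≤ smoothForm g f

theorem memLp_of_continuous (g : Metric n M) {f : M → ℝ} (hf : Continuous f) (p : ℝ≥0∞) :
    MemLp f p (vol g) :=
  hf.memLp_of_hasCompactSupport (HasCompactSupport.of_compactSpace f)

theorem two_lt_twoStar (hn : 3 ≤ n) : 2 < twoStar n := by
  have : (3 : ℝ) ≤ n := by exact_mod_cast hn
  rw [twoStar, lt_div_iff₀ (by linarith)]
  linarith

theorem gradCoeff_pos (hn : 3 ≤ n) : 0 < gradCoeff n := by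
  have : (3 : ℝ) ≤ n := by exact_mod_cast hn
  have h1 : (0 : ℝ) < n - 1 := by linarith
  have h2 : (0 : ℝ) < n - 2 := by linarith
  rw [gradCoeff]
  positivity

theorem yamabeInvariant_mul_le {g : Metric n M} (hY : 0 < yamabeInvariant g) {f : M → ℝ}
    (hf : IsSmooth n f) (hf0 : ∀ x, 0 < f x) :
    yamabeInvariant g * (eLpNorm f (ENNReal.ofReal (twoStar n)) (vol g)).toReal ^ 2 ≤
      smoothForm g f := by
  have hm := memLp_of_continuous g hf.continuous 2
  set u : Lp ℝ 2 (vol g) := hm.toLp f with hu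
  have hae : u =ᵐ[vol g] f := hm.coeFn_toLp
  have hG : HasSobolevGrad g u (gr g f) := (HasSobolevGrad.smooth g hf).congr hae.symm
  have hmem : u ∈ H1Plus g := ⟨⟨_, hG⟩, hae.mono fun x hx => by rw [hx]; exact hf0 x⟩
  -- For a set unbounded below `sInf` is 0 by convention, which positivity of the invariant
  -- excludes.
  have hb : BddBelow (J g (twoStar n - 1) '' H1Plus g) := by
    by_contra hb
    rw [yamabeInvariant, Y, Real.sInf_of_not_bddBelow hb] at hY
    exact hY.false
  have hJ : yamabeInvariant g ≤ J g (twoStar n - 1) u := csInf_le hb (mem_image_of_mem _ hmem)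
  have hform : form g u u = smoothForm g f := by
    rw [form_self_eq hG, smoothForm_eq_quad g hf, quad, quad]
    refine integral_congr_ae (hae.mono fun x hx => ?_)
    simp only
    rw [hx]
  rw [J, normL, sub_add_cancel, eLpNorm_congr_ae hae, hform] at hJ
  have hpos := hY.trans_le hJ
  -- A vanishing norm would make the quotient 0 by convention, but it is at least the positive
  -- invariant.
  have hne : (eLpNorm f (ENNReal.ofReal (twoStar n)) (vol g)).toReal ^ 2 ≠ 0 := fun h => by
    rw [h, div_zero] at hpos
    exact hpos.false
  exact (le_div_iff₀ ((sq_nonneg _).lt_of_ne' hne)).1 hJ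

/-- The invariant only sees positive functions, and |f| is not smooth. The function k = √(f² + ε) is
positive and smooth, with |f| ≤ k, |∇k| ≤ |∇f| and ∫ R k² = ∫ R f² + ε ∫ R; then ε tends to 0. -/
theorem sobolevInequality_yamabeInvariant (hn : 3 ≤ n) {g : Metric n M}
    (hY : 0 < yamabeInvariant g) : SobolevInequality g (yamabeInvariant g) := by
  intro f hf
  set B := ∫ x, scalarCurvature g x ∂(vol g)
  have key (ε : ℝ) (hε : 0 < ε) :
      yamabeInvariant g * (eLpNorm f (ENNReal.ofReal (twoStar n)) (vol g)).toReal ^ 2 ≤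
        smoothForm g f + ε * B := by
    have hpos (t : ℝ) : 0 < t ^ 2 + ε := by positivity
    set k : M → ℝ := fun x => √(f x ^ 2 + ε) with hk
    have hks : IsSmooth n k := hf.comp (F := fun t => √(t ^ 2 + ε)) fun x =>
      (((contDiff_id.pow 2).add contDiff_const).sqrt fun t => (hpos t).ne').contDiffAt
    have hk0 x : 0 < k x := Real.sqrt_pos.2 (hpos _)
    have hk2 x : k x ^ 2 = f x ^ 2 + ε := Real.sq_sqrt (hpos _).le
    have hgrad x : gradInner g k k x ≤ gradInner g f f x := by
      have hd : HasDerivAt (fun t => √(t ^ 2 + ε)) (f x / k x) (f x) := by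
        have h1 : HasDerivAt (fun t : ℝ => t ^ 2 + ε) (2 * f x) (f x) := by
          simpa using (hasDerivAt_pow 2 (f x)).add_const ε
        convert h1.sqrt (hpos _).ne' using 1
        rw [mul_div_mul_left _ _ two_ne_zero]
      have h1 := gradInner_comp_left g hf hd k
      have h2 := gradInner_comp_left g hf hd f
      rw [gradInner_comm] at h2
      have h3 : gradInner g k k x = (f x / k x) ^ 2 * gradInner g f f x := by
        rw [sq, mul_assoc, ← h2]
        exact h1
      rw [h3]
      refine mul_le_of_le_one_left (gradInner_self_nonneg g f x) ?_
      rw [div_pow, hk2, div_le_one (hpos _)]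
      linarith
    have hle := yamabeInvariant_mul_le hY hks hk0
    have hnorm : eLpNorm f (ENNReal.ofReal (twoStar n)) (vol g) ≤
        eLpNorm k (ENNReal.ofReal (twoStar n)) (vol g) :=
      eLpNorm_mono_real fun x => Real.abs_le_sqrt (by linarith)
    have hnorm' := ENNReal.toReal_mono (memLp_of_continuous g hks.continuous _).2.ne hnorm
    have hsq := pow_le_pow_left₀ ENNReal.toReal_nonneg hnorm' 2
    have hcR := continuous_scalarCurvature g
    have hform : smoothForm g k ≤ smoothForm g f + ε * B := by
      have i1 : ∫ x, gradInner g k k x ∂(vol g) ≤ ∫ x, gradInner g f f x ∂(vol g) :=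
        integral_mono (integrable_of_continuous g (continuous_gradInner g hks hks))
          (integrable_of_continuous g (continuous_gradInner g hf hf)) hgrad
      have i2 : ∫ x, scalarCurvature g x * k x ^ 2 ∂(vol g) =
          ∫ x, scalarCurvature g x * f x ^ 2 ∂(vol g) + ε * B := by
        have c1 : Integrable (fun x => scalarCurvature g x * f x ^ 2) (vol g) :=
          integrable_of_continuous g (hcR.mul (hf.continuous.pow 2))
        rw [← integral_const_mul,
          ← integral_add c1 ((integrable_of_continuous g hcR).const_mul ε)]
        congr 1
        ext x
        rw [hk2]
        ring
      have i3 := mul_le_mul_of_nonneg_left i1 (gradCoeff_pos hn).le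
      rw [gradCoeff] at i3
      rw [smoothForm, smoothForm, i2]
      linarith
    have := mul_le_mul_of_nonneg_left hsq hY.le
    linarith
  have hlim : Tendsto (fun ε : ℝ => smoothForm g f + ε * B) (𝓝[>] 0) (𝓝 (smoothForm g f)) := by
    have : Continuous fun ε : ℝ => smoothForm g f + ε * B := by fun_prop
    simpa using (this.tendsto 0).mono_left nhdsWithin_le_nhds
  exact ge_of_tendsto hlim (eventually_mem_nhdsWithin.mono fun ε hε => key ε hε)

/-- The critical exponent satisfies (n-2)/2 · 2* = n, so the factor e^{(n-2)φ/2} raised to the power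
2* is exactly the density e^{nφ} of the new volume. -/
theorem IsConformalTo.eLpNorm_twoStar (hn : 3 ≤ n) {g h : Metric n M} {φ : M → ℝ}
    (hc : IsConformalTo g h φ) (hφ : Continuous φ) {f : M → ℝ} (hf : Continuous f) :
    eLpNorm f (ENNReal.ofReal (twoStar n)) (vol h) =
      eLpNorm (fun x => Real.exp (((n : ℝ) - 2) / 2 * φ x) * f x)
        (ENNReal.ofReal (twoStar n)) (vol g) := by
  have hn2 : (n : ℝ) - 2 ≠ 0 := by
    have : (3 : ℝ) ≤ n := by exact_mod_cast hn
    linarith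
  have hs : 0 < twoStar n := two_pos.trans (two_lt_twoStar hn)
  have hw : Measurable fun m => ENNReal.ofReal (Real.exp (n * φ m)) :=
    (Real.continuous_exp.comp (continuous_const.mul hφ)).measurable.ennreal_ofReal
  rw [eLpNorm_eq_lintegral_rpow_enorm_toReal (by simpa using hs) ENNReal.ofReal_ne_top,
    eLpNorm_eq_lintegral_rpow_enorm_toReal (by simpa using hs) ENNReal.ofReal_ne_top,
    ENNReal.toReal_ofReal hs.le, vol_eq hc hφ, lintegral_withDensity_eq_lintegral_mul _ hw
      (hf.measurable.enorm.pow_const _)]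
  congr 1
  refine lintegral_congr fun x => ?_
  rw [Pi.mul_apply, enorm_mul, ENNReal.mul_rpow_of_nonneg _ _ hs.le,
    Real.enorm_of_nonneg (Real.exp_pos _).le, ENNReal.ofReal_rpow_of_pos (Real.exp_pos _),
    ← Real.exp_mul, show ((n : ℝ) - 2) / 2 * φ x * twoStar n = n * φ x by
      rw [twoStar]
      field_simp]

theorem SobolevInequality.of_isConformalTo (hn : 3 ≤ n) {g h : Metric n M} {φ : M → ℝ} {c : ℝ}
    (hg : SobolevInequality g c) (hc : IsConformalTo g h φ) (hφ : IsSmooth n φ) :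
    SobolevInequality h c := fun f hf => by
  rw [hc.smoothForm_eq hn hφ hf, hc.eLpNorm_twoStar hn hφ.continuous hf.continuous]
  refine hg _ (IsSmooth.mul ?_ hf)
  exact hφ.comp (F := fun t => Real.exp (((n : ℝ) - 2) / 2 * t)) fun x =>
    (Real.contDiff_exp.comp (contDiff_const.mul contDiff_id)).contDiffAt

/-- For the zero measure every quotient is 0, and the invariant could not be positive. This guards
against an empty M. -/
theorem vol_ne_zero {g : Metric n M} (hY : 0 < yamabeInvariant g) : vol g ≠ 0 := fun h0 => by
  have hJ (u : Lp ℝ 2 (vol g)) : J g (twoStar n - 1) u = 0 := by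
    simp [J, form, h0]
  have : yamabeInvariant g ≤ 0 := by
    refine Real.sInf_nonpos ?_
    rintro _ ⟨u, -, rfl⟩
    exact (hJ u).le
  linarith

theorem IsConformalTo.vol_ne_zero {g h : Metric n M} {φ : M → ℝ} (hc : IsConformalTo g h φ)
    (hφ : Continuous φ) (hg : vol g ≠ 0) : vol h ≠ 0 := fun h0 => by
  have hw : Measurable fun m => ENNReal.ofReal (Real.exp (n * φ m)) :=
    (Real.continuous_exp.comp (continuous_const.mul hφ)).measurable.ennreal_ofReal
  have := withDensity_absolutelyContinuous' (μ := vol g) hw.aemeasurable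
    (ae_of_all _ fun x => by simpa using Real.exp_pos _)
  rw [← vol_eq hc hφ, h0] at this
  exact hg (Measure.absolutelyContinuous_zero_iff.1 this)

namespace SobolevInequality

variable {h : Metric n M} {c : ℝ} {u : M → ℝ} {X : M → E n}

theorem exists_integral_sq_le (hn : 3 ≤ n) (hc : 0 < c) (hS : SobolevInequality h c) :
    ∃ D, 0 ≤ D ∧ ∀ f, IsSmooth n f → ∫ x, f x ^ 2 ∂(vol h) ≤ D * smoothForm h f := by
  have h2 : (2 : ℝ≥0∞) ≤ ENNReal.ofReal (twoStar n) := by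
    rw [← ENNReal.ofReal_ofNat]
    exact ENNReal.ofReal_le_ofReal (two_lt_twoStar hn).le
  set K := vol h univ ^ (1 / (2 : ℝ≥0∞).toReal - 1 / (ENNReal.ofReal (twoStar n)).toReal) with hK
  have hKtop : K ≠ ⊤ := by
    refine ENNReal.rpow_ne_top_of_nonneg ?_ (measure_ne_top _ _)
    rw [ENNReal.toReal_ofReal (two_pos.trans (two_lt_twoStar hn)).le, ENNReal.toReal_ofNat,
      sub_nonneg]
    exact one_div_le_one_div_of_le two_pos (two_lt_twoStar hn).le
  refine ⟨K.toReal ^ 2 / c, by positivity, fun f hf => ?_⟩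
  have hfm := memLp_of_continuous h hf.continuous
  have h3 : eLpNorm f 2 (vol h) ≤ eLpNorm f (ENNReal.ofReal (twoStar n)) (vol h) * K :=
    eLpNorm_le_eLpNorm_mul_rpow_measure_univ h2 (hfm 2).1
  have h4 := ENNReal.toReal_mono (ENNReal.mul_ne_top (hfm _).2.ne hKtop) h3
  have h5 : ∫ x, f x ^ 2 ∂(vol h) = (eLpNorm f 2 (vol h)).toReal ^ 2 := by
    rw [← ENNReal.toReal_pow, eLpNorm_two_sq, integral_eq_lintegral_of_nonneg_ae
      (ae_of_all _ fun x => sq_nonneg _) (hfm 2).integrable_sq.1]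
  rw [ENNReal.toReal_mul] at h4
  have h6 := pow_le_pow_left₀ ENNReal.toReal_nonneg h4 2
  rw [h5]
  refine h6.trans ?_
  rw [mul_pow, mul_comm, div_mul_eq_mul_div, mul_div_assoc]
  refine mul_le_mul_of_nonneg_left ?_ (sq_nonneg _)
  rw [le_div_iff₀' hc]
  exact hS f hf

/-- The form `⟨u, u⟩` controls the Sobolev norm. -/
theorem exists_normSq_le (hn : 3 ≤ n) (hc : 0 < c) (hS : SobolevInequality h c) :
    ∃ C, 0 < C ∧ ∀ u X, HasSobolevGrad h u X →
      normSq h u X ≤ C * quad h (gradCoeff n) (scalarCurvature h) u X := by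
  obtain ⟨D, hD0, hD⟩ := hS.exists_integral_sq_le hn hc
  have ha := gradCoeff_pos hn
  have hcR := continuous_scalarCurvature h
  obtain ⟨K, hK0, hK⟩ := exists_abs_le hcR
  -- With a = 4(n-1)/(n-2) and |R| ≤ K: a∫|∇f|² = ⟨f,f⟩ - ∫ R f² ≤ (1 + KD)⟨f,f⟩, and ∫ f² ≤ D⟨f,f⟩.
  -- Both sides pass to the limit from smooth functions.
  refine ⟨(1 + K * D) / gradCoeff n + D, by positivity, fun u X huX => ?_⟩
  obtain ⟨hL, f, hf, hfu⟩ := hasSobolevGrad_iff.1 huX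
  have t1 := tendsto_quad 1 (R := fun _ => 1) continuous_const hL
    (fun k => IsL2Pair.smooth h (hf k)) hfu
  have t2 := tendsto_quad (gradCoeff n) hcR hL (fun k => IsL2Pair.smooth h (hf k)) hfu
  refine le_of_tendsto_of_tendsto' t1 (t2.const_mul _) fun k => ?_
  have hfk := hf k
  have hLk := IsL2Pair.smooth h hfk
  have e1 : quad h 1 (fun _ => 1) (f k) (gr h (f k)) =
      ∫ x, gradInner h (f k) (f k) x ∂(vol h) + ∫ x, f k x ^ 2 ∂(vol h) := by
    simp only [quad, one_mul]
    exact integral_add hLk.integrable_ip_self hLk.integrable_sq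
  have e2 : smoothForm h (f k) = gradCoeff n * ∫ x, gradInner h (f k) (f k) x ∂(vol h)
      + ∫ x, scalarCurvature h x * f k x ^ 2 ∂(vol h) := rfl
  have e3 : -(K * ∫ x, f k x ^ 2 ∂(vol h)) ≤ ∫ x, scalarCurvature h x * f k x ^ 2 ∂(vol h) := by
    rw [← integral_const_mul, ← integral_neg]
    refine integral_mono (hLk.integrable_sq.const_mul K).neg
      (hLk.integrable_sq.bdd_mul (c := K) hcR.aestronglyMeasurable (ae_of_all _ hK)) fun x => ?_
    have := mul_le_mul_of_nonneg_right (neg_le_of_abs_le (hK x)) (sq_nonneg (f k x))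
    simp only
    linarith
  have e4 := hD _ hfk
  have e5 := mul_le_mul_of_nonneg_left e4 hK0
  rw [e1, ← smoothForm_eq_quad h hfk, add_mul]
  refine add_le_add ?_ e4
  rw [div_mul_eq_mul_div, le_div_iff₀' ha]
  linarith

/-- The forms of smooth approximants converge, so the approximants are bounded in L^{2*}; Fatou's
lemma along an almost everywhere convergent subsequence bounds the limit. -/
theorem memLp_twoStar (hc : 0 < c) (hS : SobolevInequality h c) (hu : HasSobolevGrad h u X) :
    MemLp u (ENNReal.ofReal (twoStar n)) (vol h) := by
  obtain ⟨hL, f, hf⟩ := hasSobolevGrad_iff.1 hu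
  have hfs := hf.1
  have t2 := tendsto_quad (gradCoeff n) (continuous_scalarCurvature h) hL
    (fun k => IsL2Pair.smooth h (hfs k)) hf.2
  obtain ⟨B, hB⟩ := t2.bddAbove_range
  have hbound k : eLpNorm (f k) (ENNReal.ofReal (twoStar n)) (vol h) ≤
      ENNReal.ofReal (√(B / c)) := by
    have h1 := hS _ (hfs k)
    rw [smoothForm_eq_quad h (hfs k)] at h1
    rw [ENNReal.le_ofReal_iff_toReal_le (memLp_of_continuous h (hfs k).continuous _).2.ne
      (Real.sqrt_nonneg _)]
    refine Real.le_sqrt_of_sq_le ?_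
    rw [le_div_iff₀' hc]
    exact h1.trans (hB (mem_range_self k))
  obtain ⟨ns, hns⟩ := exists_subseq_tendsto_ae (fun k => IsL2Pair.smooth h (hfs k)) hL hf.2
  refine ⟨hL.memLp.1, (Lp.eLpNorm_lim_le_liminf_eLpNorm
    (fun k => (hfs (ns k)).continuous.aestronglyMeasurable) u hns).trans_lt ?_⟩
  exact (liminf_le_of_frequently_le' (Frequently.of_forall fun k => hbound (ns k))).trans_lt
    ENNReal.ofReal_lt_top

end SobolevInequality

end SobolevInequality

/-! ### Existence and uniqueness for the obstacle problem -/

section Obstacle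

variable {n : ℕ} {M : Type*} [TopologicalSpace M] [ChartedSpace (E n) M] [IsManifold (𝓡 n) ∞ M]
  [T2Space M] [CompactSpace M] [MeasurableSpace M] [BorelSpace M]

variable {h : Metric n M} {C : ℝ}

/-- The form `⟨u, u⟩` controls the square of the Sobolev norm. -/
def IsCoercive (h : Metric n M) (C : ℝ) : Prop :=
  ∀ u X, HasSobolevGrad h u X → normSq h u X ≤ C * quad h (gradCoeff n) (scalarCurvature h) u X

omit [T2Space M] [CompactSpace M] [BorelSpace M] in
theorem IsCoercive.quad_nonneg (hC : 0 < C) (hco : IsCoercive h C) {u : M → ℝ} {X : M → E n}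
    (hu : HasSobolevGrad h u X) : 0 ≤ quad h (gradCoeff n) (scalarCurvature h) u X :=
  nonneg_of_mul_nonneg_right ((normSq_nonneg h u X).trans (hco u X hu)) hC

theorem IsCoercive.form_nonneg (hC : 0 < C) (hco : IsCoercive h C) {u : Lp ℝ 2 (vol h)}
    (hu : u ∈ H1 h) : 0 ≤ form h u u := by
  obtain ⟨X, hX⟩ := hu
  rw [form_self_eq hX]
  exact hco.quad_nonneg hC hX

omit [T2Space M] [CompactSpace M] [BorelSpace M] in
theorem quad_congr {a : ℝ} {R : M → ℝ} {u v : M → ℝ} (X : M → E n) (huv : u =ᵐ[vol h] v) :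
    quad h a R u X = quad h a R v X :=
  integral_congr_ae (huv.mono fun x hx => by simp only; rw [hx])

/-- A competitor in the obstacle problem, given by a function and its gradient. -/
theorem HasSobolevGrad.toLp_competitor {u : Lp ℝ 2 (vol h)} (hu : u ∈ H1Plus h) {v : M → ℝ}
    {X : M → E n} (hv : HasSobolevGrad h v X) (huv : u ≤ᵐ[vol h] v) :
    (hv.memLp.toLp v ∈ H1Plus h ∧ u ≤ hv.memLp.toLp v) ∧
      form h (hv.memLp.toLp v) (hv.memLp.toLp v) =
        quad h (gradCoeff n) (scalarCurvature h) v X := by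
  have hae := hv.memLp.coeFn_toLp
  have hG := hv.congr hae.symm
  refine ⟨⟨⟨⟨X, hG⟩, ?_⟩, ?_⟩, by rw [form_self_eq hG, quad_congr X hae]⟩
  · filter_upwards [hae, huv, hu.2] with x h1 h2 h3
    rw [h1]
    exact h3.trans_le h2
  · rw [← Lp.coeFn_le]
    filter_upwards [hae, huv] with x h1 h2
    rw [h1]
    exact h2

/-- The midpoint argument: competitors of almost minimal energy are close to each other. -/
theorem quad_sub_le {u v w : M → ℝ} {X Y : M → E n} {m δ₁ δ₂ : ℝ}
    (hm : ∀ v X, HasSobolevGrad h v X → u ≤ᵐ[vol h] v →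
      m ≤ quad h (gradCoeff n) (scalarCurvature h) v X)
    (hv : HasSobolevGrad h v X) (huv : u ≤ᵐ[vol h] v)
    (hvm : quad h (gradCoeff n) (scalarCurvature h) v X ≤ m + δ₁)
    (hw : HasSobolevGrad h w Y) (huw : u ≤ᵐ[vol h] w)
    (hwm : quad h (gradCoeff n) (scalarCurvature h) w Y ≤ m + δ₂) :
    quad h (gradCoeff n) (scalarCurvature h) (fun x => v x - w x) (fun x => X x - Y x) ≤
      2 * (δ₁ + δ₂) := by
  have h1 := quad_parallelogram (gradCoeff n) (continuous_scalarCurvature h) hv.isL2Pair hw.isL2Pair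
  -- The midpoint is again above u, so Q(v - w) = 2Q(v) + 2Q(w) - 4Q((v + w)/2) ≤ 2(m + δ₁) + 2(m +
  -- δ₂) - 4m.
  have h2 := hm _ _ ((hv.add hw).const_mul (1 / 2)) (by
    filter_upwards [huv, huw] with x hx hy
    linarith)
  rw [quad_const_mul] at h2
  linarith

/-- Direct method. The midpoint argument and coercivity make a minimizing sequence Cauchy in the
Sobolev norm, so the convergence is strong and no weak compactness is needed. -/
theorem exists_isObstacleSolution (hC : 0 < C) (hco : IsCoercive h C) {u : Lp ℝ 2 (vol h)}
    (hu : u ∈ H1Plus h) : ∃ v, IsObstacleSolution h u v := by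
  set S : Set ℝ := (fun v : Lp ℝ 2 (vol h) => form h v v) '' {v | v ∈ H1Plus h ∧ u ≤ v} with hS
  have hSne : S.Nonempty := ⟨_, mem_image_of_mem _ ⟨hu, le_rfl⟩⟩
  have hSb : BddBelow S := ⟨0, by
    rintro _ ⟨v, hv, rfl⟩
    exact hco.form_nonneg hC hv.1.1⟩
  set m := sInf S with hm_def
  have hm (v : M → ℝ) (X : M → E n) (hv : HasSobolevGrad h v X) (huv : u ≤ᵐ[vol h] v) :
      m ≤ quad h (gradCoeff n) (scalarCurvature h) v X := by
    obtain ⟨hmem, hform⟩ := hv.toLp_competitor hu huv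
    rw [← hform]
    exact csInf_le hSb (mem_image_of_mem _ hmem)
  have hseq (k : ℕ) : ∃ (v : M → ℝ) (X : M → E n), HasSobolevGrad h v X ∧ u ≤ᵐ[vol h] v ∧
      quad h (gradCoeff n) (scalarCurvature h) v X ≤ m + (1 / 4) ^ k := by
    obtain ⟨_, ⟨v, ⟨hv, huv⟩, rfl⟩, hlt⟩ := exists_lt_of_csInf_lt hSne
      (lt_add_of_pos_right m (by positivity : (0 : ℝ) < (1 / 4) ^ k))
    obtain ⟨X, hX⟩ := hv.1
    refine ⟨v, X, hX, (Lp.coeFn_le _ _).2 huv, ?_⟩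
    rw [← form_self_eq hX]
    exact hlt.le
  choose v X hvX huv hvm using hseq
  -- Completeness is available for smooth sequences, so each v k is replaced by a smooth f k at
  -- squared distance at most 4^{-k}; f k need not lie above u.
  have happrox (k : ℕ) : ∃ f, IsSmooth n f ∧
      normSq h (fun x => f x - v k x) (fun x => gr h f x - X k x) ≤ (1 / 4) ^ k := by
    obtain ⟨-, f, hf, hlim⟩ := hasSobolevGrad_iff.1 (hvX k)
    obtain ⟨i, hi⟩ := (hlim.eventually_lt_const (by positivity : (0 : ℝ) < (1 / 4) ^ k)).exists
    exact ⟨f i, hf i, hi.le⟩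
  choose f hf hfv using happrox
  have hL k := (hvX k).isL2Pair
  have hfL k := IsL2Pair.smooth h (hf k)
  have hpow {k l : ℕ} (hkl : k ≤ l) : (1 / 4 : ℝ) ^ l ≤ (1 / 4) ^ k :=
    pow_le_pow_of_le_one (by norm_num) (by norm_num) hkl
  -- Split f k - f l = (f k - v k) + ((v k - v l) - (f l - v l)). With ‖v k - v l‖² ≤ 2C(4^{-k} +
  -- 4^{-l}), the bound is 2·4^{-k} + 8C(4^{-k} + 4^{-l}) + 4·4^{-l} ≤ (6 + 16C)4^{-k}.
  obtain ⟨w, W, hw, hfw⟩ := exists_isSobolevLimit (g := h) hf (C := 6 + 16 * C) fun k l hkl => by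
    have e1 := quad_sub_le hm (hvX k) (huv k) (hvm k) (hvX l) (huv l) (hvm l)
    have e2 := hco _ _ ((hvX k).sub (hvX l))
    have e3 := normSq_add_le ((hfL k).sub (hL k)) (((hL k).sub (hL l)).sub ((hfL l).sub (hL l)))
    have e4 := normSq_sub_le ((hL k).sub (hL l)) ((hfL l).sub (hL l))
    simp only [sub_sub_sub_cancel_right, sub_add_sub_cancel] at e3
    have e5 := mul_le_mul_of_nonneg_left e1 hC.le
    have e6 := hpow hkl
    have e7 := mul_le_mul_of_nonneg_left e6 hC.le
    have e8 := hfv k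
    have e9 := hfv l
    simp only [sub_sub_sub_cancel_right] at e4
    linarith
  have hwG : HasSobolevGrad h w W := hasSobolevGrad_iff.2 ⟨hw, f, hfw⟩
  have hvw : Tendsto (fun k => normSq h (fun x => v k x - w x) fun x => X k x - W x)
      atTop (𝓝 0) := by
    have t1 : Tendsto (fun k : ℕ => 2 * (1 / 4 : ℝ) ^ k
        + 2 * normSq h (fun x => f k x - w x) fun x => gr h (f k) x - W x) atTop (𝓝 0) := by
      simpa using ((tendsto_pow_atTop_nhds_zero_of_lt_one (r := (1 / 4 : ℝ)) (by norm_num)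
        (by norm_num)).const_mul 2).add (hfw.2.const_mul 2)
    refine squeeze_zero (fun _ => normSq_nonneg h _ _) (fun k => ?_) t1
    have e1 := normSq_sub_le ((hfL k).sub hw) ((hfL k).sub (hL k))
    simp only [sub_sub_sub_cancel_left] at e1
    linarith [hfv k]
  have hwm : quad h (gradCoeff n) (scalarCurvature h) w W ≤ m := by
    have t1 := tendsto_quad (gradCoeff n) (continuous_scalarCurvature h) hw hL hvw
    have t2 : Tendsto (fun k : ℕ => m + (1 / 4 : ℝ) ^ k) atTop (𝓝 m) := by
      simpa using (tendsto_pow_atTop_nhds_zero_of_lt_one (r := (1 / 4 : ℝ)) (by norm_num)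
        (by norm_num)).const_add m
    exact le_of_tendsto_of_tendsto' t1 t2 hvm
  -- The constraint survives along an almost everywhere convergent subsequence. Positivity of the
  -- limit is then automatic from w ≥ u > 0.
  have huw : u ≤ᵐ[vol h] w := by
    obtain ⟨ns, hns⟩ := exists_subseq_tendsto_ae hL hw hvw
    filter_upwards [hns, ae_all_iff.2 huv] with x h1 h2
    exact ge_of_tendsto' h1 fun i => h2 _
  obtain ⟨hmem, hform⟩ := hwG.toLp_competitor hu huw
  refine ⟨_, hmem, fun v' hv' huv' => ?_⟩
  rw [hform]
  exact hwm.trans (csInf_le hSb (mem_image_of_mem _ ⟨hv', huv'⟩))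

/-- The midpoint estimate with δ₁ = δ₂ = 0 gives Q(v - w) ≤ 0, and coercivity forces v = w. -/
theorem IsObstacleSolution.eq (hC : 0 < C) (hco : IsCoercive h C) {u v w : Lp ℝ 2 (vol h)}
    (hu : u ∈ H1Plus h) (hv : IsObstacleSolution h u v) (hw : IsObstacleSolution h u w) :
    v = w := by
  obtain ⟨X, hX⟩ : ∃ X : M → E n, HasSobolevGrad h v X := hv.1.1.1
  obtain ⟨Y, hY⟩ : ∃ Y : M → E n, HasSobolevGrad h w Y := hw.1.1.1
  have huv := (Lp.coeFn_le _ _).2 hv.1.2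
  have huw := (Lp.coeFn_le _ _).2 hw.1.2
  have h1 := hv.2 w hw.1.1 hw.1.2
  have h2 := hw.2 v hv.1.1 hv.1.2
  have hm (k : M → ℝ) (Z : M → E n) (hk : HasSobolevGrad h k Z) (huk : u ≤ᵐ[vol h] k) :
      form h v v ≤ quad h (gradCoeff n) (scalarCurvature h) k Z := by
    obtain ⟨hmem, hform⟩ := hk.toLp_competitor hu huk
    rw [← hform]
    exact hv.2 _ hmem.1 hmem.2
  have h3 := quad_sub_le (δ₁ := 0) (δ₂ := 0) hm hX huv (by rw [← form_self_eq hX, add_zero]) hY huw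
    (by rw [← form_self_eq hY, add_zero]; exact h2)
  have h4 := hco _ _ (hX.sub hY)
  have hd := (hX.sub hY).isL2Pair
  have h5 : normSq h (fun x => v x - w x) (fun x => X x - Y x) ≤ 0 := by
    refine h4.trans (mul_nonpos_of_nonneg_of_nonpos hC.le ?_)
    linarith
  have h6 := hd.ofReal_normSq
  rw [lintegral_ofReal_ip_add hd.memLp.1.aemeasurable, ENNReal.ofReal_of_nonpos h5, eq_comm,
    add_eq_zero] at h6
  have h7 := (eLpNorm_eq_zero_iff hd.memLp.1 two_ne_zero).1 (by simpa using h6.2)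
  refine Lp.ext (h7.mono fun x hx => ?_)
  exact sub_eq_zero.1 hx

end Obstacle

/-! ### Comparison of the Yamabe and the optimal control functionals -/

section Functionals

variable {n : ℕ} {M : Type*} [TopologicalSpace M] [ChartedSpace (E n) M] [IsManifold (𝓡 n) ∞ M]
  [T2Space M] [CompactSpace M] [MeasurableSpace M] [BorelSpace M]

variable {h : Metric n M} {u v : Lp ℝ 2 (vol h)} {q : ℝ}

omit [T2Space M] [CompactSpace M] [BorelSpace M] in
theorem normL_pos (hvol : vol h ≠ 0) (hq : 0 < q) (hu : u ∈ H1Plus h)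
    (hLq : MemLp u (ENNReal.ofReal q) (vol h)) : 0 < normL h q u := by
  -- Finiteness matters: an infinite norm would be sent to 0 by `toReal`.
  refine ENNReal.toReal_pos (fun h0 => ?_) hLq.2.ne
  rw [eLpNorm_eq_zero_iff hLq.1 (by simpa using hq)] at h0
  have : ∀ᵐ _ ∂(vol h), False := by
    filter_upwards [h0, hu.2] with x h1 h2
    rw [h1] at h2
    exact h2.false
  rw [eventually_false_iff_eq_bot, ae_eq_bot] at this
  exact hvol this

omit [T2Space M] [CompactSpace M] [BorelSpace M] in
theorem normL_mono (hu : u ∈ H1Plus h) (huv : u ≤ v)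
    (hLq : MemLp v (ENNReal.ofReal q) (vol h)) : normL h q u ≤ normL h q v := by
  refine ENNReal.toReal_mono hLq.2.ne (eLpNorm_mono_ae ?_)
  filter_upwards [hu.2, (Lp.coeFn_le _ _).2 huv] with x h1 h2
  rw [Real.norm_of_nonneg h1.le, Real.norm_of_nonneg (h1.le.trans h2)]
  exact h2

omit [T2Space M] [CompactSpace M] [BorelSpace M] in
/-- The comparison of the two functionals, given solvability of the obstacle problem. -/
theorem functionals_compare (hform : ∀ u ∈ H1Plus h, 0 ≤ form h u u)
    (hex : ∀ u ∈ H1Plus h, ∃! v, IsObstacleSolution h u v) {p : ℝ}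
    (hpos : ∀ u ∈ H1Plus h, 0 < normL h (p + 1) u)
    (hmono : ∀ u ∈ H1Plus h, ∀ v ∈ H1Plus h, u ≤ v → normL h (p + 1) u ≤ normL h (p + 1) v) :
    (BddBelow (J h p '' H1Plus h) ∧ BddBelow (I h p '' H1Plus h)) ∧
    ∀ u ∈ H1Plus h, (J h p u = Y h p ↔ I h p u = Yoc h p) ∧
      (J h p u = Y h p → T h u = u) ∧ (I h p u = Yoc h p → T h u = u) := by
  have hT u (hu : u ∈ H1Plus h) : IsObstacleSolution h u (T h u) := by
    rw [T, dif_pos (hex u hu)]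
    exact (hex u hu).choose_spec.1
  -- Every competitor above T(u) is a competitor above u, so T(u) is also minimal for the obstacle
  -- T(u).
  have hTT u (hu : u ∈ H1Plus h) : T h (T h u) = T h u := by
    have h1 := hT u hu
    refine (hex _ h1.1.1).unique (hT _ h1.1.1) ⟨⟨h1.1.1, le_rfl⟩, fun v hv huv => ?_⟩
    exact h1.2 v hv (h1.1.2.trans huv)
  have hJb : BddBelow (J h p '' H1Plus h) := ⟨0, by
    rintro _ ⟨u, hu, rfl⟩
    exact div_nonneg (hform u hu) (sq_nonneg _)⟩
  have hIb : BddBelow (I h p '' H1Plus h) := ⟨0, by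
    rintro _ ⟨u, hu, rfl⟩
    exact div_nonneg (hform u hu) (sq_nonneg _)⟩
  refine ⟨⟨hJb, hIb⟩, fun u hu => ?_⟩
  have hIJ w (hw : w ∈ H1Plus h) : I h p w ≤ J h p w := by
    have h1 := (hT w hw).1
    exact div_le_div_of_nonneg_left (hform w hw) (pow_pos (hpos w hw) 2)
      (pow_le_pow_left₀ (hpos w hw).le (hmono w hw _ h1.1 h1.2) 2)
  have hJI w (hw : w ∈ H1Plus h) : J h p (T h w) ≤ I h p w :=
    div_le_div_of_nonneg_right ((hT w hw).2 w hw le_rfl) (sq_nonneg _)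
  have hYJ w (hw : w ∈ H1Plus h) : Y h p ≤ J h p w := csInf_le hJb (mem_image_of_mem _ hw)
  have hYI w (hw : w ∈ H1Plus h) : Yoc h p ≤ I h p w := csInf_le hIb (mem_image_of_mem _ hw)
  have hne : (H1Plus h).Nonempty := ⟨u, hu⟩
  have hYY : Y h p = Yoc h p := by
    refine le_antisymm (le_csInf (hne.image _) ?_) (le_csInf (hne.image _) ?_)
    · rintro _ ⟨w, hw, rfl⟩
      exact (hYJ _ (hT w hw).1.1).trans (hJI w hw)
    · rintro _ ⟨w, hw, rfl⟩
      exact (hYI w hw).trans (hIJ w hw)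
  -- By idempotence I(u) and I(T(u)) share a denominator, so minimality of I at u compares the
  -- numerators: u has no more energy than T(u) and solves its own obstacle problem.
  have hfix (hI : I h p u = Yoc h p) : T h u = u := by
    have h1 := hT u hu
    have h2 : I h p u ≤ I h p (T h u) := hI.trans_le (hYI _ h1.1.1)
    have h3 : form h u u ≤ form h (T h u) (T h u) := by
      rw [I, I, hTT u hu] at h2
      exact (div_le_div_iff_of_pos_right (pow_pos (hpos _ h1.1.1) 2)).1 h2
    exact (hex u hu).unique h1 ⟨⟨hu, le_rfl⟩, fun v hv huv => h3.trans (h1.2 v hv huv)⟩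
  have hJtoI (hJ : J h p u = Y h p) : I h p u = Yoc h p :=
    le_antisymm ((hIJ u hu).trans_eq (hJ.trans hYY)) (hYI u hu)
  refine ⟨⟨hJtoI, fun hI => ?_⟩, fun hJ => hfix (hJtoI hJ), hfix⟩
  have h1 : I h p u = J h p u := by rw [I, J, hfix hI]
  rw [← h1, hI, hYY]

end Functionals

end

end Yamabe

theorem proposition7p4 {n : ℕ} (hn : 3 ≤ n) {M : Type*} [TopologicalSpace M] [T2Space M]
    [CompactSpace M] [ChartedSpace (Yamabe.E n) M] [IsManifold (𝓡 n) ∞ M]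
    [MeasurableSpace M] [BorelSpace M]
    (g h : Yamabe.Metric n M) (hY : 0 < Yamabe.yamabeInvariant g)
    (hh : h ∈ Yamabe.conformalClass g)
    (p : ℝ) (hp1 : 1 ≤ p) (hp2 : p ≤ Yamabe.twoStar n - 1) :
    (∀ u ∈ Yamabe.H1Plus h, ∃! v, Yamabe.IsObstacleSolution h u v) ∧
    (BddBelow (Yamabe.J h p '' Yamabe.H1Plus h) ∧
      BddBelow (Yamabe.I h p '' Yamabe.H1Plus h)) ∧
    ∀ u ∈ Yamabe.H1Plus h,
      (Yamabe.J h p u = Yamabe.Y h p ↔ Yamabe.I h p u = Yamabe.Yoc h p) ∧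
      (Yamabe.J h p u = Yamabe.Y h p → Yamabe.T h u = u) ∧
      (Yamabe.I h p u = Yamabe.Yoc h p → Yamabe.T h u = u) := by
  obtain ⟨φ, hφ, hc⟩ := Yamabe.exists_isConformalTo hn hh
  -- Positivity is assumed for g; conformal invariance gives h the Sobolev inequality with the same
  -- constant.
  have hS := (Yamabe.sobolevInequality_yamabeInvariant hn hY).of_isConformalTo hn hc hφ
  have hvol := hc.vol_ne_zero hφ.continuous (Yamabe.vol_ne_zero hY)
  obtain ⟨C, hC, hco⟩ := hS.exists_normSq_le hn hY
  replace hco : Yamabe.IsCoercive h C := hco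
  have hex u (hu : u ∈ Yamabe.H1Plus h) : ∃! v, Yamabe.IsObstacleSolution h u v := by
    obtain ⟨v, hv⟩ := Yamabe.exists_isObstacleSolution hC hco hu
    exact ⟨v, hv, fun w hw => hw.eq hC hco hu hv⟩
  have hLp u (hu : u ∈ Yamabe.H1Plus h) : MemLp u (ENNReal.ofReal (p + 1)) (Yamabe.vol h) := by
    obtain ⟨X, hX⟩ := hu.1
    -- On a finite measure space L^{2*} embeds in L^{p+1}, because p + 1 ≤ 2*.
    exact (hS.memLp_twoStar hY hX).mono_exponent (ENNReal.ofReal_le_ofReal (by linarith))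
  exact ⟨hex, Yamabe.functionals_compare (fun u hu => hco.form_nonneg hC hu.1) hex
    (fun u hu => Yamabe.normL_pos hvol (by linarith) hu (hLp u hu))
    fun u hu v hv huv => Yamabe.normL_mono hu huv (hLp v hv)⟩
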